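/- Let $d\ge 1$, $a,m_1,m_2,f\in\mathbb{R}$ with $m_1>0$, and put $s=\sqrt{1+a^2}$. Let $\mathbb{S}^d\subset\mathbb{R}^{d+1}$ be the unit sphere with the round metric, with coordinates $(x,y,z)\in\mathbb{R}^{d-1}\times\mathbb{R}\times\mathbb{R}$ on $\mathbb{R}^{d+1}$, and let $\mathbb{S}^d_{SH}=\{q\in\mathbb{S}^d: z<0\}$ be the lower hemisphere. Put $Z_1=(0,a,-1)/s$, $Z_2=(0,-a,-1)/s$, $Z_0=(0,0,-1)$, and let $\theta_i$ be the central angle between $q$ and $Z_i$. The hemispherical Lagrange problem is the natural mechanical system on $\mathbb{S}^d_{SH}$ with energy $$\tilde E_{sph}=E_{sKep}+\tilde V_{sph,2},\qquad E_{sKep}(q,v)=\tfrac12\|v\|^2-m_1 s\cot\theta_1,\qquad \tilde V_{sph,2}(q)=-m_2 s\cot\theta_2+f\tan^2\theta_0 .$$ Let $\mathcal{R}_s\subset T\mathbb{S}^d_{SH}$ be the set of all $(q,v)$ whose orbit under the spherical Kepler problem $E_{sKep}$ on $\mathbb{S}^d$ is non-singular (it exists for all times and avoids $\pm Z_1$),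 is contained in $\mathbb{S}^d_{SH}$, and does not pass through $Z_2$. These orbits are closed, and the partially-averaged system is defined on $\mathcal{R}_s$ by the Hamiltonian $$\tilde E_{sph,a}=E_{sKep}+\int_{S^1}\tilde V_{sph,2}\,ds,$$ where the integral is the average over the closed orbit of $E_{sKep}$ through the given point, parametrized by $S^1=\mathbb{R}/\mathbb{Z}$ proportionally to time. Let $(x,y)$, with $(x,y,-1)\in\mathbb{R}q$, be the central projection of $q\in\mathbb{S}^d_{SH}$ to $\mathbb{R}^d$, and let $\xi=x$, $\eta=(y-a)/s$, $P=(\xi,\eta)\in\mathbb{R}^d$. Let $(\dot\xi,\dot\eta)$ be $(1+\|x\|^2+y^2)^{-1}$ times the derivative of $(\xi,\eta)$ at $q$ in the direction $v$. Define the function $D$ on $T(\mathbb{S}^d_{SH}\setminus\{Z_1\})$ by $$D=C^2-\frac{2a}{s}A_1,\qquad C^2=\sum_{i<j}(P_i\dot P_j-P_j\dot P_i)^2,\qquad A_1=\sum_{i}(\xi_i\dot\eta-\eta\dot\xi_i)\dot\xi_i+\frac{m_1\eta}{\sqrt{\|\xi\|^2+\eta^2}} .$$ Let $\{\cdot,\cdot\}$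 be the Poisson bracket on $T\mathbb{S}^d$ transported from $T^*\mathbb{S}^d$ by the Legendre transformation of the round metric. Then $\tilde E_{sph,a}$ and $D$ are differentiable at every point of $\mathcal{R}_s$, and $D$ is a first integral of the partially-averaged system on $\mathcal{R}_s$: $$\{\tilde E_{sph,a},D\}=0 .$$ -/

import Mathlib

open scoped RealInnerProductSpace

noncomputable section

namespace HemisphericalLagrange

/-- The ambient space `ℝ^{d+1}` of the unit sphere `S^d`, where `d = n + 1`. A point is written
`(x₁, …, x_n, y, z)`; the `y`-coordinate has index `n` and the `z`-coordinate index `n + 1`. -/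
abbrev Ambient (n : ℕ) : Type := EuclideanSpace ℝ (Fin (n + 2))

/-- The space `ℝ^d`, `d = n + 1`, with coordinates `(x₁, …, x_n, y)`. -/
abbrev Chart (n : ℕ) : Type := EuclideanSpace ℝ (Fin (n + 1))

variable {n : ℕ}

/-! ### The sphere, its tangent bundle and its Poisson bracket -/

/-- The index of the coordinate `y` in the ambient space. -/
def yIdx (n : ℕ) : Fin (n + 2) := (Fin.last n).castSucc

/-- The index of the coordinate `z` in the ambient space. -/
def zIdx (n : ℕ) : Fin (n + 2) := Fin.last (n + 1)

/-- The contact point `(0, …, 0, -1)` of the sphere with the hyperplane `z = -1`. -/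
def southPole (n : ℕ) : Ambient n := -EuclideanSpace.single (zIdx n) 1

/-- The open lower hemisphere of the unit sphere. -/
def lowerHemisphere (n : ℕ) : Set (Ambient n) := {q | ‖q‖ = 1 ∧ q (zIdx n) < 0}

/-- Orthogonal projection of `w` to the tangent space `q^⊥` of the unit sphere at `q`. -/
def tangentialPart (q w : Ambient n) : Ambient n := w - ⟪q, w⟫ • q

/-- The projection `T^*(ℝ^{d+1} ∖ 0) → T^*S^d` given by polar coordinates: for `q = ρ u` with
`ρ = ‖q‖`, one has `p · dq = ⟪p, u⟫ dρ + ρ p^⊥ · du`, so that `(q, p)` has the spherical part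
`(u, ρ p^⊥)`. Covectors are identified with vectors through the round metric (the Legendre
transformation). The map is the identity on `TS^d = {‖q‖ = 1, ⟪q, p⟫ = 0}`. -/
def toTangentSphere (z : Ambient n × Ambient n) : Ambient n × Ambient n :=
  (‖z.1‖⁻¹ • z.1, ‖z.1‖ • tangentialPart (‖z.1‖⁻¹ • z.1) z.2)

/-- The canonical Poisson bracket `∑ᵢ (∂F/∂qᵢ ∂G/∂pᵢ - ∂F/∂pᵢ ∂G/∂qᵢ)` on
`T^*ℝ^{d+1} = ℝ^{d+1} × ℝ^{d+1}`. -/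
def canonicalBracket (F G : Ambient n × Ambient n → ℝ) (z : Ambient n × Ambient n) : ℝ :=
  ∑ i, (fderiv ℝ F z (EuclideanSpace.single i 1, 0) * fderiv ℝ G z (0, EuclideanSpace.single i 1)
    - fderiv ℝ F z (0, EuclideanSpace.single i 1) * fderiv ℝ G z (EuclideanSpace.single i 1, 0))

/-- The Poisson bracket on `TS^d`, transported from `T^*S^d` by the Legendre transformation of the
round metric. Only the values of `F` and `G` on `TS^d` matter: they are pulled back by the
projection `T^*(ℝ^{d+1} ∖ 0) = T^*S^d × T^*ℝ_{>0} → T^*S^d`, which is a Poisson map. -/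
def spherePoisson (F G : Ambient n × Ambient n → ℝ) (z : Ambient n × Ambient n) : ℝ :=
  canonicalBracket (F ∘ toTangentSphere) (G ∘ toTangentSphere) z

/-! ### The hemispherical Lagrange problem -/

/-- The first Kepler center `(0, …, 0, a, -1) / √(1 + a²)`. -/
def center₁ (n : ℕ) (a : ℝ) : Ambient n :=
  (√(1 + a ^ 2))⁻¹ • (EuclideanSpace.single (yIdx n) a + southPole n)

/-- The second Kepler center `(0, …, 0, -a, -1) / √(1 + a²)`. -/
def center₂ (n : ℕ) (a : ℝ) : Ambient n := center₁ n (-a)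

/-- The spherical Kepler potential `-m cot θ`, where `θ` is the central angle between `q` and the
center `Z`. -/
def keplerPotential (m : ℝ) (Z q : Ambient n) : ℝ :=
  -m * Real.cot (InnerProductGeometry.angle q Z)

/-- The spherical Hooke potential `f tan² θ`, where `θ` is the central angle between `q` and the
south pole. -/
def hookePotential (f : ℝ) (q : Ambient n) : ℝ :=
  f * Real.tan (InnerProductGeometry.angle q (southPole n)) ^ 2

/-- The potential of the first center, of spherical mass `m₁ √(1 + a²)`. -/
def firstPotential (a m₁ : ℝ) (q : Ambient n) : ℝ :=
  keplerPotential (m₁ * √(1 + a ^ 2)) (center₁ n a) q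

/-- The remaining part of the potential of the Lagrange problem: the second center, of spherical
mass `m₂ √(1 + a²)`, and the Hooke center. -/
def perturbingPotential (a m₂ f : ℝ) (q : Ambient n) : ℝ :=
  keplerPotential (m₂ * √(1 + a ^ 2)) (center₂ n a) q + hookePotential f q

/-- The energy of the spherical Kepler problem of the first center. -/
def keplerEnergy (a m₁ : ℝ) (z : Ambient n × Ambient n) : ℝ :=
  ‖z.2‖ ^ 2 / 2 + firstPotential a m₁ z.1

/-! ### Averaging along the orbits of the spherical Kepler problem -/

/-- `γ : ℝ → S^d` is a non-singular motion of the spherical Kepler problem of the first center,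
`∇_{γ'} γ' = -grad V`, with initial position and velocity `z`. -/
structure IsKeplerMotion (a m₁ : ℝ) (z : Ambient n × Ambient n) (γ : ℝ → Ambient n) : Prop where
  contDiff : ContDiff ℝ 2 γ
  norm_eq_one : ∀ t, ‖γ t‖ = 1
  ne_center : ∀ t, γ t ≠ center₁ n a
  ne_antipode : ∀ t, γ t ≠ -center₁ n a
  newton : ∀ t, tangentialPart (γ t) (deriv (deriv γ) t) =
    -tangentialPart (γ t) (gradient (firstPotential a m₁) (γ t))
  position : γ 0 = z.1
  velocity : deriv γ 0 = z.2

/-- The averaging region in `TS^d`: the Kepler orbit is non-singular, is contained in the lower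
hemisphere, and does not pass through the second center. -/
def averagingRegion (n : ℕ) (a m₁ : ℝ) : Set (Ambient n × Ambient n) :=
  {z | ∃ γ : ℝ → Ambient n, IsKeplerMotion a m₁ z γ ∧
    (∀ t, γ t ∈ lowerHemisphere n) ∧ ∀ t, γ t ≠ center₂ n a}

/-- `γ` is a closed Kepler motion through `z`, with period `T` (not necessarily the least one). -/
def IsClosedKeplerMotion (a m₁ : ℝ) (z : Ambient n × Ambient n) (γ : ℝ → Ambient n) (T : ℝ) :
    Prop :=
  IsKeplerMotion a m₁ z γ ∧ 0 < T ∧ Function.Periodic γ T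

open Classical in
/-- The average `∫_{S¹} U ds` of a function `U` of the position over the closed Kepler orbit
through `z`, parametrized by `S¹ = ℝ/ℤ` proportionally to time (and `0` if there is no such
orbit). The motion through `z` is unique, and the average is the same for all its periods. -/
def orbitAverage (a m₁ : ℝ) (U : Ambient n → ℝ) (z : Ambient n × Ambient n) : ℝ :=
  if h : ∃ p : (ℝ → Ambient n) × ℝ, IsClosedKeplerMotion a m₁ z p.1 p.2 then
    ∫ s in (0 : ℝ)..1, U (h.choose.1 (h.choose.2 * s))
  else 0

/-- The Hamiltonian of the partially-averaged hemispherical Lagrange problem. -/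
def averagedEnergy (a m₁ m₂ f : ℝ) (z : Ambient n × Ambient n) : ℝ :=
  keplerEnergy a m₁ z + orbitAverage a m₁ (perturbingPotential a m₂ f) z

/-! ### The function `D` -/

/-- The central projection `q ↦ (x, y)` with `(x, y, -1) ∈ ℝ q`. -/
def centralProjection (q : Ambient n) : Chart n :=
  WithLp.toLp 2 fun i => -q i.castSucc / q (zIdx n)

/-- The central projection in the affine coordinates `(ξ, η)`, `x = ξ`, `y = √(1 + a²) η + a`, in
which the norm `√(|x|² + y² / (1 + a²))` is the standard one and the first center is the origin. -/
def euclPosition (a : ℝ) (q : Ambient n) : Chart n :=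
  WithLp.toLp 2 fun i =>
    if i = Fin.last n then (centralProjection q i - a) / √(1 + a ^ 2) else centralProjection q i

/-- The velocity `(ξ', η')` that corresponds to the velocity `v` on the sphere at `q`. The projective
correspondence changes time by the factor `1 + |x|² + y²`: the derivative with respect to the
spherical time is `1 + |x|² + y²` times that with respect to the Euclidean time. -/
def euclVelocity (a : ℝ) (q v : Ambient n) : Chart n :=
  (1 + ‖centralProjection q‖ ^ 2)⁻¹ • fderiv ℝ (euclPosition a) q v

/-- The squared norm `∑_{i < j} (Pᵢ Wⱼ - Pⱼ Wᵢ)²` of the total angular momentum. -/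
def angularMomentumSq (P W : Chart n) : ℝ :=
  ∑ i, ∑ j ∈ Finset.Ioi i, (P i * W j - P j * W i) ^ 2

/-- The component along the axis of the centers of the Laplace-Runge-Lenz vector, with the sign for
which it equals `(ξ η' - η ξ') ξ' + m η / √(ξ² + η²)` in dimension two. -/
def laplaceRungeLenz (m : ℝ) (P W : Chart n) : ℝ :=
  ∑ i, (P i * W (Fin.last n) - P (Fin.last n) * W i) * W i + m * P (Fin.last n) / ‖P‖

/-- The function `D = C² - 2 h A₁`, where `h = a / √(1 + a²)` is half the distance between the two
centers in the coordinates `(ξ, η)`, as a function on the tangent bundle of the hemisphere. -/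
def functionD (a m₁ : ℝ) (z : Ambient n × Ambient n) : ℝ :=
  angularMomentumSq (euclPosition a z.1) (euclVelocity a z.1 z.2)
    - 2 * (a / √(1 + a ^ 2))
      * laplaceRungeLenz m₁ (euclPosition a z.1) (euclVelocity a z.1 z.2)

end HemisphericalLagrange

end

/-! The proof lives in homogeneous coordinates on T^*ℝ^{d+1} and sees a Kepler orbit through the
cone over it. Let Z be the first center and M its spherical mass. Cut the cone at distance one from
the axis ℝZ and use the angle φ about the axis, with dφ/dt = ℓ‖X‖² and ℓ the angular momentum about
Z. The Kepler equation then becomes linear, X'' = κZ - X with κ = M/ℓ², so the section is the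
explicit curve X(φ) = κ(1 - cos φ)Z + (cos φ)x + (sin φ)e (`exists_angle_of_motion`). Non-singular
orbits have ℓ > 0, since with ℓ = 0 the body falls into the center
(`axialMomentumSq_pos_of_motion`). Hence orbits close up after one turn, and an average is a
quotient of two integrals over [0, 2π] (`IsClosedKeplerMotion.average_eq`) whose integrands depend
differentiably on the initial point.

The pullbacks of the averaged energy and of D are invariant under the symplectic maps (q, p) ↦
(c⁻¹q, cp + dq), and `toTangentSphere` is such a map at each point. It therefore suffices to
differentiate the averaged energy along the Hamiltonian vector field of D at points (x, ℓe) with x,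
e orthonormal modulo Z.

Two facts make this derivative vanish. First, D commutes with the Kepler energy
(`hasDerivAt_axialEnergy_flow`), and its flow carries Kepler orbits to Kepler orbits: X(φ) moves by
the Hamiltonian field of D at X(φ), up to a radial term and a shift of the angle
(`hasDerivAt_keplerCone_flow`). Second, the perturbing potential V has an explicit companion W with
{V, D} = dW/dt along Kepler orbits, so that D + W is conserved before averaging
(`fderiv_perturbingPotential_flowPosition`). Together they show that the variation of the integrand
of the time integral of V is the φ-derivative of a 2π-periodic function, so the integral over a turn
does not change (`fderiv_orbitIntegral_flow`). The case V = 1, W = 0 gives the same for the period,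
hence for the average. -/

open scoped RealInnerProductSpace

noncomputable section

namespace HemisphericalLagrange

/-! ### Cones over Kepler orbits -/

section Cone

variable {H : Type*} [NormedAddCommGroup H] [InnerProductSpace ℝ H]

/-- The inner product of the components of `q` and `p` orthogonal to the unit vector `Z`. -/
def axialInner (Z q p : H) : ℝ := ⟪q, p⟫ - ⟪Z, q⟫ * ⟪Z, p⟫

/-- The distance of `q` to the axis spanned by the unit vector `Z`. -/
def axialRadius (Z q : H) : ℝ := √(axialInner Z q q)

/-- The squared norm of the angular momentum of `(q, p)` about the axis spanned by `Z`. -/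
def axialMomentumSq (Z : H) (z : H × H) : ℝ :=
  axialInner Z z.1 z.1 * axialInner Z z.2 z.2 - axialInner Z z.1 z.2 ^ 2

/-- The norm of the angular momentum of `(q, p)` about the axis spanned by `Z`. -/
def axialMomentum (Z : H) (z : H × H) : ℝ := √(axialMomentumSq Z z)

/-- The multiple of `q` at distance one from the axis. -/
def conePosition (Z : H) (z : H × H) : H := (axialRadius Z z.1)⁻¹ • z.1

/-- The velocity of `conePosition`, divided by its squared norm. -/
def coneVelocity (Z : H) (z : H × H) : H :=
  axialRadius Z z.1 • z.2 - (axialInner Z z.1 z.2 / axialRadius Z z.1) • z.1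

/-- The section at distance one from the axis of the cone over the Kepler orbit through `z`, as a
function of the angle about the axis. -/
def keplerCone (Z : H) (M : ℝ) (z : H × H) (φ : ℝ) : H :=
  (M / axialMomentum Z z ^ 2 * (1 - Real.cos φ)) • Z + Real.cos φ • conePosition Z z
    + (Real.sin φ / axialMomentum Z z) • coneVelocity Z z

/-- The derivative of `keplerCone` with respect to the angle. -/
def keplerConeDeriv (Z : H) (M : ℝ) (z : H × H) (φ : ℝ) : H :=
  (M / axialMomentum Z z ^ 2 * Real.sin φ) • Z - Real.sin φ • conePosition Z z
    + (Real.cos φ / axialMomentum Z z) • coneVelocity Z z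

lemma axialInner_comm (Z q p : H) : axialInner Z q p = axialInner Z p q := by
  simp only [axialInner, real_inner_comm q p]; ring

lemma axialInner_add_left (Z q q' p : H) :
    axialInner Z (q + q') p = axialInner Z q p + axialInner Z q' p := by
  simp only [axialInner, inner_add_left, inner_add_right]; ring

lemma axialInner_sub_left (Z q q' p : H) :
    axialInner Z (q - q') p = axialInner Z q p - axialInner Z q' p := by
  simp only [axialInner, inner_sub_left, inner_sub_right]; ring

lemma axialInner_smul_left (Z q p : H) (c : ℝ) :
    axialInner Z (c • q) p = c * axialInner Z q p := by
  simp only [axialInner, real_inner_smul_left, real_inner_smul_right]; ring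

lemma axialInner_add_right (Z q p p' : H) :
    axialInner Z q (p + p') = axialInner Z q p + axialInner Z q p' := by
  simp only [axialInner, inner_add_right]; ring

lemma axialInner_sub_right (Z q p p' : H) :
    axialInner Z q (p - p') = axialInner Z q p - axialInner Z q p' := by
  simp only [axialInner, inner_sub_right]; ring

lemma axialInner_smul_right (Z q p : H) (c : ℝ) :
    axialInner Z q (c • p) = c * axialInner Z q p := by
  simp only [axialInner, real_inner_smul_right]; ring

variable {Z : H}

lemma axialInner_axis_right (hZ : ‖Z‖ = 1) (q : H) : axialInner Z q Z = 0 := by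
  simp [axialInner, hZ, real_inner_comm]

lemma axialInner_axis_left (hZ : ‖Z‖ = 1) (q : H) : axialInner Z Z q = 0 := by
  rw [axialInner_comm, axialInner_axis_right hZ]

lemma axialInner_eq_inner (hZ : ‖Z‖ = 1) (q p : H) :
    axialInner Z q p = ⟪q - ⟪Z, q⟫ • Z, p - ⟪Z, p⟫ • Z⟫ := by
  simp only [axialInner, inner_sub_left, inner_sub_right,
    real_inner_smul_right, real_inner_self_eq_norm_sq, hZ, real_inner_comm]
  ring

lemma axialInner_self_nonneg (hZ : ‖Z‖ = 1) (q : H) : 0 ≤ axialInner Z q q := by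
  rw [axialInner_eq_inner hZ]; exact real_inner_self_nonneg

lemma axialMomentumSq_nonneg (hZ : ‖Z‖ = 1) (z : H × H) : 0 ≤ axialMomentumSq Z z := by
  have := real_inner_mul_inner_self_le (z.1 - ⟪Z, z.1⟫ • Z) (z.2 - ⟪Z, z.2⟫ • Z)
  rw [axialMomentumSq, axialInner_eq_inner hZ, axialInner_eq_inner hZ, axialInner_eq_inner hZ]
  nlinarith

lemma axialInner_self_pos_of_momentum (hZ : ‖Z‖ = 1) {z : H × H} (hz : 0 < axialMomentumSq Z z) :
    0 < axialInner Z z.1 z.1 := by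
  refine (axialInner_self_nonneg hZ z.1).lt_of_ne fun h => ?_
  rw [axialMomentumSq, ← h] at hz
  nlinarith [sq_nonneg (axialInner Z z.1 z.2)]

lemma axialMomentum_sq (hZ : ‖Z‖ = 1) (z : H × H) :
    axialMomentum Z z ^ 2 = axialMomentumSq Z z := Real.sq_sqrt (axialMomentumSq_nonneg hZ z)

lemma axialMomentum_pos {z : H × H} (hz : 0 < axialMomentumSq Z z) : 0 < axialMomentum Z z :=
  Real.sqrt_pos.2 hz

lemma axialRadius_sq (hZ : ‖Z‖ = 1) (q : H) : axialRadius Z q ^ 2 = axialInner Z q q :=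
  Real.sq_sqrt (axialInner_self_nonneg hZ q)

lemma axialRadius_pos {q : H} (hq : 0 < axialInner Z q q) : 0 < axialRadius Z q :=
  Real.sqrt_pos.2 hq

lemma axialInner_conePosition_self (hZ : ‖Z‖ = 1) {z : H × H} (hz : 0 < axialInner Z z.1 z.1) :
    axialInner Z (conePosition Z z) (conePosition Z z) = 1 := by
  have hr := axialRadius_pos hz
  rw [conePosition, axialInner_smul_left, axialInner_smul_right, ← axialRadius_sq hZ]
  field_simp

lemma axialInner_conePosition_coneVelocity (hZ : ‖Z‖ = 1) {z : H × H}
    (hz : 0 < axialInner Z z.1 z.1) :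
    axialInner Z (conePosition Z z) (coneVelocity Z z) = 0 := by
  have hr := axialRadius_pos hz
  rw [conePosition, coneVelocity, axialInner_smul_left, axialInner_sub_right,
    axialInner_smul_right, axialInner_smul_right, ← axialRadius_sq hZ]
  field_simp
  ring

lemma axialInner_coneVelocity_self (hZ : ‖Z‖ = 1) {z : H × H} (hz : 0 < axialInner Z z.1 z.1) :
    axialInner Z (coneVelocity Z z) (coneVelocity Z z) = axialMomentumSq Z z := by
  have hr := axialRadius_pos hz
  simp only [coneVelocity, axialInner_sub_left, axialInner_sub_right, axialInner_smul_left,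
    axialInner_smul_right, axialMomentumSq, axialInner_comm Z z.2 z.1]
  rw [← axialRadius_sq hZ z.1]
  field_simp
  ring

/-- Modulo Z the vectors `conePosition` and `coneVelocity / axialMomentum` are orthonormal, so the
curve lies over the unit circle of their plane. -/
lemma axialInner_keplerCone_self (hZ : ‖Z‖ = 1) (M : ℝ) {z : H × H}
    (hz : 0 < axialMomentumSq Z z) (φ : ℝ) :
    axialInner Z (keplerCone Z M z φ) (keplerCone Z M z φ) = 1 := by
  have hq := axialInner_self_pos_of_momentum hZ hz
  have hl := axialMomentum_pos hz
  simp only [keplerCone, axialInner_add_left, axialInner_add_right, axialInner_smul_left,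
    axialInner_smul_right, axialInner_axis_left hZ, axialInner_axis_right hZ,
    axialInner_conePosition_self hZ hq, axialInner_conePosition_coneVelocity hZ hq,
    axialInner_coneVelocity_self hZ hq, axialInner_comm Z (coneVelocity Z z) (conePosition Z z),
    ← axialMomentum_sq hZ]
  field_simp
  linear_combination axialMomentum Z z ^ 3 * Real.sin_sq_add_cos_sq φ

lemma axialInner_keplerCone_keplerConeDeriv (hZ : ‖Z‖ = 1) (M : ℝ) {z : H × H}
    (hz : 0 < axialMomentumSq Z z) (φ : ℝ) :
    axialInner Z (keplerCone Z M z φ) (keplerConeDeriv Z M z φ) = 0 := by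
  have hq := axialInner_self_pos_of_momentum hZ hz
  have hl := axialMomentum_pos hz
  simp only [keplerCone, keplerConeDeriv, axialInner_add_left, axialInner_add_right,
    axialInner_sub_right, axialInner_smul_left,
    axialInner_smul_right, axialInner_axis_left hZ, axialInner_axis_right hZ,
    axialInner_conePosition_self hZ hq, axialInner_conePosition_coneVelocity hZ hq,
    axialInner_coneVelocity_self hZ hq, axialInner_comm Z (coneVelocity Z z) (conePosition Z z),
    ← axialMomentum_sq hZ]
  field_simp
  ring

lemma hasDerivAt_keplerCone (Z : H) (M : ℝ) (z : H × H) (φ : ℝ) :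
    HasDerivAt (keplerCone Z M z) (keplerConeDeriv Z M z φ) φ := by
  have h1 : HasDerivAt (fun φ => (M / axialMomentum Z z ^ 2 * (1 - Real.cos φ)) • Z)
      ((M / axialMomentum Z z ^ 2 * Real.sin φ) • Z) φ := by
    have := ((Real.hasDerivAt_cos φ).const_sub 1).const_mul (M / axialMomentum Z z ^ 2)
    simpa using this.smul_const Z
  have h2 := (Real.hasDerivAt_cos φ).smul_const (conePosition Z z)
  have h3 := ((Real.hasDerivAt_sin φ).div_const (axialMomentum Z z)).smul_const (coneVelocity Z z)
  refine ((h1.add h2).add h3).congr_deriv ?_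
  rw [keplerConeDeriv]
  module

/-- In the angle variable the Kepler problem is a harmonic oscillator centered at κZ, κ = M/ℓ². -/
lemma hasDerivAt_keplerConeDeriv (Z : H) (M : ℝ) (z : H × H) (φ : ℝ) :
    HasDerivAt (keplerConeDeriv Z M z)
      ((M / axialMomentum Z z ^ 2) • Z - keplerCone Z M z φ) φ := by
  have h1 := ((Real.hasDerivAt_sin φ).const_mul (M / axialMomentum Z z ^ 2)).smul_const Z
  have h2 := (Real.hasDerivAt_sin φ).smul_const (conePosition Z z)
  have h3 := ((Real.hasDerivAt_cos φ).div_const (axialMomentum Z z)).smul_const (coneVelocity Z z)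
  refine ((h1.sub h2).add h3).congr_deriv ?_
  rw [keplerCone]
  module

lemma keplerCone_add_two_pi (Z : H) (M : ℝ) (z : H × H) (φ : ℝ) :
    keplerCone Z M z (φ + 2 * Real.pi) = keplerCone Z M z φ := by
  simp [keplerCone]

lemma keplerConeDeriv_add_two_pi (Z : H) (M : ℝ) (z : H × H) (φ : ℝ) :
    keplerConeDeriv Z M z (φ + 2 * Real.pi) = keplerConeDeriv Z M z φ := by
  simp [keplerConeDeriv]

lemma keplerCone_zero (Z : H) (M : ℝ) (z : H × H) :
    keplerCone Z M z 0 = conePosition Z z := by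
  simp [keplerCone]

lemma norm_sq_eq_axialInner (Z q : H) : ‖q‖ ^ 2 = axialInner Z q q + ⟪Z, q⟫ ^ 2 := by
  rw [axialInner, real_inner_self_eq_norm_sq]; ring

lemma norm_keplerCone_sq (hZ : ‖Z‖ = 1) (M : ℝ) {z : H × H}
    (hz : 0 < axialMomentumSq Z z) (φ : ℝ) :
    ‖keplerCone Z M z φ‖ ^ 2 = 1 + ⟪Z, keplerCone Z M z φ⟫ ^ 2 := by
  rw [norm_sq_eq_axialInner Z, axialInner_keplerCone_self hZ M hz]

lemma norm_keplerCone_pos (hZ : ‖Z‖ = 1) (M : ℝ) {z : H × H}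
    (hz : 0 < axialMomentumSq Z z) (φ : ℝ) : 0 < ‖keplerCone Z M z φ‖ := by
  have := norm_keplerCone_sq hZ M hz φ
  have h2 : 0 < ‖keplerCone Z M z φ‖ ^ 2 := by rw [this]; positivity
  exact lt_of_pow_lt_pow_left₀ 2 (norm_nonneg _) (by simpa using h2)

end Cone

/-! ### Kepler motions in the cone coordinates -/

section ConeMotion

variable {H : Type*} [NormedAddCommGroup H] [InnerProductSpace ℝ H] {Z : H}

lemma cot_angle_eq (hZ : ‖Z‖ = 1) (q : H) :
    Real.cot (InnerProductGeometry.angle q Z) = ⟪Z, q⟫ / axialRadius Z q := by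
  rcases eq_or_ne q 0 with rfl | hq
  · simp [Real.cot_eq_cos_div_sin]
  have hq' : ‖q‖ ≠ 0 := norm_ne_zero_iff.2 hq
  have hZ0 : Z ≠ 0 := norm_ne_zero_iff.1 (by rw [hZ]; exact one_ne_zero)
  have hs := InnerProductGeometry.sin_angle_mul_norm_mul_norm q Z
  have hc := InnerProductGeometry.cos_angle_mul_norm_mul_norm q Z
  have hrad : axialRadius Z q = √(⟪q, q⟫ * ⟪Z, Z⟫ - ⟪q, Z⟫ * ⟪q, Z⟫) := by
    rw [axialRadius, axialInner, real_inner_self_eq_norm_sq Z, hZ, real_inner_comm q Z]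
    simp
  rw [hZ, mul_one] at hs hc
  rw [hrad, ← hs, real_inner_comm, ← hc, Real.cot_eq_cos_div_sin, mul_div_mul_right _ _ hq']

lemma hasDerivAt_axialInner {f g : ℝ → H} {f' g' : H} {t : ℝ} (Z : H) (hf : HasDerivAt f f' t)
    (hg : HasDerivAt g g' t) :
    HasDerivAt (fun t => axialInner Z (f t) (g t))
      (axialInner Z f' (g t) + axialInner Z (f t) g') t := by
  have hZ := hasDerivAt_const t Z
  refine ((hf.inner ℝ hg).sub ((hZ.inner ℝ hf).mul (hZ.inner ℝ hg))).congr_deriv ?_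
  simp only [axialInner, inner_zero_left]
  ring

lemma hasDerivAt_axialRadius {f : ℝ → H} {f' : H} {t : ℝ} (Z : H) (hf : HasDerivAt f f' t)
    (hr : 0 < axialInner Z (f t) (f t)) :
    HasDerivAt (fun t => axialRadius Z (f t))
      (axialInner Z (f t) f' / axialRadius Z (f t)) t := by
  refine ((hasDerivAt_axialInner Z hf hf).sqrt hr.ne').congr_deriv ?_
  rw [axialInner_comm Z f', axialRadius]
  ring

variable {γ v : ℝ → H} {k M t : ℝ}

/-- Modulo Z the acceleration is parallel to the position, so there is no torque about the axis. The
multiplier `k` is arbitrary; on the sphere it is the constraint force. -/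
lemma hasDerivAt_axialMomentumSq (hZ : ‖Z‖ = 1) (hγ : HasDerivAt γ (v t) t)
    (hv : HasDerivAt v (k • γ t + (M / axialRadius Z (γ t) ^ 3) • Z) t) :
    HasDerivAt (fun t => axialMomentumSq Z (γ t, v t)) 0 t := by
  refine (((hasDerivAt_axialInner Z hγ hγ).mul (hasDerivAt_axialInner Z hv hv)).sub
    ((hasDerivAt_axialInner Z hγ hv).pow 2)).congr_deriv ?_
  simp only [axialInner_add_left, axialInner_add_right, axialInner_smul_left,
    axialInner_smul_right, axialInner_axis_left hZ, axialInner_axis_right hZ,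
    axialInner_comm Z (v t) (γ t)]
  ring

lemma hasDerivAt_conePosition (hr : 0 < axialInner Z (γ t) (γ t))
    (hγ : HasDerivAt γ (v t) t) :
    HasDerivAt (fun t => conePosition Z (γ t, v t))
      ((axialRadius Z (γ t) ^ 2)⁻¹ • coneVelocity Z (γ t, v t)) t := by
  have hr' := axialRadius_pos hr
  refine (((hasDerivAt_axialRadius Z hγ hr).inv hr'.ne').smul hγ).congr_deriv ?_
  simp only [coneVelocity, Pi.inv_apply]
  match_scalars <;> field_simp

/-- After the time change by the squared axial radius the equation of motion is linear, and the
constraint force `k` drops out. -/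
lemma hasDerivAt_coneVelocity (hZ : ‖Z‖ = 1) (hr : 0 < axialInner Z (γ t) (γ t))
    (hγ : HasDerivAt γ (v t) t)
    (hv : HasDerivAt v (k • γ t + (M / axialRadius Z (γ t) ^ 3) • Z) t) :
    HasDerivAt (fun t => coneVelocity Z (γ t, v t))
      ((axialRadius Z (γ t) ^ 2)⁻¹ •
        (M • Z - axialMomentumSq Z (γ t, v t) • conePosition Z (γ t, v t))) t := by
  have hr' := axialRadius_pos hr
  have h1 := hasDerivAt_axialRadius Z hγ hr
  refine ((h1.smul hv).sub
    (((hasDerivAt_axialInner Z hγ hv).div h1 hr'.ne').smul hγ)).congr_deriv ?_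
  simp only [conePosition, axialMomentumSq, axialInner_add_right, Pi.div_apply,
    axialInner_smul_right, axialInner_axis_right hZ, ← axialRadius_sq hZ (γ t)]
  match_scalars
  · field_simp
    ring
  · field_simp
  · field_simp
    ring

lemma eq_cos_smul_add_sin_smul (φ : ℝ) (b c : H) :
    b = Real.cos φ • (Real.cos φ • b - Real.sin φ • c)
      + Real.sin φ • (Real.sin φ • b + Real.cos φ • c) := by
  have hcs := Real.sin_sq_add_cos_sq φ
  match_scalars
  · linear_combination -hcs
  · ring

lemma norm_conePosition (hr : 0 < axialInner Z (γ t) (γ t)) (h1 : ‖γ t‖ = 1) :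
    ‖conePosition Z (γ t, v t)‖ = (axialRadius Z (γ t))⁻¹ := by
  rw [conePosition, norm_smul, h1, norm_inv, Real.norm_eq_abs, abs_of_pos (axialRadius_pos hr),
    mul_one]

/-- A motion of the Kepler problem on the sphere which never meets the axis has non-vanishing
angular momentum: otherwise it would fall into the attracting center. -/
lemma axialMomentumSq_pos_of_motion {k : ℝ → ℝ} (hZ : ‖Z‖ = 1) (hM : 0 < M) (h1 : ∀ t, ‖γ t‖ = 1)
    (hr : ∀ t, 0 < axialInner Z (γ t) (γ t)) (hγ : ∀ t, HasDerivAt γ (v t) t)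
    (hv : ∀ t, HasDerivAt v (k t • γ t + (M / axialRadius Z (γ t) ^ 3) • Z) t) :
    ∀ t, 0 < axialMomentumSq Z (γ t, v t) := by
  have hconst : ∀ t, axialMomentumSq Z (γ t, v t) = axialMomentumSq Z (γ 0, v 0) := fun t =>
    is_const_of_deriv_eq_zero
      (fun t => (hasDerivAt_axialMomentumSq hZ (hγ t) (hv t)).differentiableAt)
      (fun t => (hasDerivAt_axialMomentumSq hZ (hγ t) (hv t)).deriv) t 0
  intro t
  rw [hconst]
  refine (axialMomentumSq_nonneg hZ _).lt_of_ne fun h0 => ?_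
  set w : ℝ → ℝ := fun t => ⟪Z, conePosition Z (γ t, v t)⟫ with hw
  set ψ : ℝ → ℝ := fun t => ⟪Z, coneVelocity Z (γ t, v t)⟫ with hψ
  -- Here w = cot θ, with θ the angle to the center, and 1/sin² θ = 1 + cot² θ on the unit sphere.
  have hinv : ∀ t, (axialRadius Z (γ t) ^ 2)⁻¹ = 1 + w t ^ 2 := fun t => by
    rw [← inv_pow, ← norm_conePosition (v := v) (hr t) (h1 t), norm_sq_eq_axialInner Z,
      axialInner_conePosition_self hZ (hr t)]
  have hw' : ∀ t, HasDerivAt w ((1 + w t ^ 2) * ψ t) t := fun t => by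
    refine ((hasDerivAt_const t Z).inner ℝ (hasDerivAt_conePosition (hr t) (hγ t))).congr_deriv ?_
    rw [inner_zero_left, add_zero, real_inner_smul_right, hinv]
  have hψ' : ∀ t, HasDerivAt ψ ((1 + w t ^ 2) * M) t := fun t => by
    refine ((hasDerivAt_const t Z).inner ℝ
      (hasDerivAt_coneVelocity hZ (hr t) (hγ t) (hv t))).congr_deriv ?_
    rw [inner_zero_left, add_zero, real_inner_smul_right, hinv, hconst, ← h0, zero_smul, sub_zero,
      real_inner_smul_right, real_inner_self_eq_norm_sq, hZ]
    ring
  -- The function arctan w is π/2 - θ: it is bounded, but its derivative ψ grows at rate at least M.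
  have hat : ∀ t, HasDerivAt (fun t => Real.arctan (w t)) (ψ t) t := fun t => by
    refine (hw' t).arctan.congr_deriv ?_
    have : 1 + w t ^ 2 ≠ 0 := by positivity
    field_simp
  have hψmono : Monotone fun t => ψ t - M * t := by
    refine monotone_of_hasDerivAt_nonneg
      (f' := fun t => (1 + w t ^ 2) * M - M * 1)
      (fun t => (hψ' t).sub ((hasDerivAt_id t).const_mul M)) fun t => ?_
    simp only [Pi.zero_apply]
    nlinarith [mul_nonneg (sq_nonneg (w t)) hM.le]
  have hmono : MonotoneOn (fun t => Real.arctan (w t) - (ψ 0 * t + M * t ^ 2 / 2)) (Set.Ici 0) := by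
    have hd : ∀ t, HasDerivAt (fun t => Real.arctan (w t) - (ψ 0 * t + M * t ^ 2 / 2))
        (ψ t - (ψ 0 + M * t)) t := fun t => by
      refine ((hat t).sub (((hasDerivAt_id t).const_mul (ψ 0)).add
        ((((hasDerivAt_id t).pow 2).const_mul M).div_const 2))).congr_deriv ?_
      simp
      ring
    refine monotoneOn_of_deriv_nonneg (convex_Ici 0)
      (fun t _ => (hd t).continuousAt.continuousWithinAt)
      (fun t _ => (hd t).differentiableAt.differentiableWithinAt) fun t ht => ?_
    rw [interior_Ici] at ht
    rw [(hd t).deriv]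
    have := hψmono (le_of_lt ht)
    simp only [mul_zero, sub_zero] at this
    linarith
  -- With this τ ≥ 1, the lower bound ψ(0)τ + Mτ²/2 for the increment of arctan w is at least 4τ ≥ 4
  -- ≥ π, which exceeds the possible variation of arctan.
  set τ : ℝ := 2 * (|ψ 0| + M + 4) / M with hτ
  have hτ0 : 0 ≤ τ := by positivity
  have hMτ : M * τ = 2 * (|ψ 0| + M + 4) := by rw [hτ]; field_simp
  have hτ1 : 1 ≤ τ := by nlinarith [abs_nonneg (ψ 0)]
  have hle := hmono (Set.mem_Ici.2 le_rfl) (Set.mem_Ici.2 hτ0) hτ0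
  have hb1 := Real.arctan_lt_pi_div_two (w τ)
  have hb2 := Real.neg_pi_div_two_lt_arctan (w 0)
  have hpi := Real.pi_le_four
  have habs := neg_abs_le (ψ 0)
  simp only [mul_zero, add_zero, sub_zero, ne_eq, OfNat.ofNat_ne_zero, not_false_eq_true, zero_pow,
    zero_div] at hle
  have e1 : M * τ ^ 2 / 2 = (|ψ 0| + M + 4) * τ := by
    linear_combination τ / 2 * hMτ
  have e2 : 0 ≤ (ψ 0 + |ψ 0|) * τ := mul_nonneg (by linarith) hτ0
  nlinarith

/-- In the cone coordinates, every motion of the Kepler problem with non-vanishing angular momentum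
is a time-changed trigonometric motion. -/
lemma exists_angle_of_motion {k : ℝ → ℝ} (hZ : ‖Z‖ = 1) (h1 : ∀ t, ‖γ t‖ = 1)
    (hr : ∀ t, 0 < axialInner Z (γ t) (γ t)) (hγ : ∀ t, HasDerivAt γ (v t) t)
    (hv : ∀ t, HasDerivAt v (k t • γ t + (M / axialRadius Z (γ t) ^ 3) • Z) t)
    (hl : 0 < axialMomentumSq Z (γ 0, v 0)) :
    ∃ φ : ℝ → ℝ, φ 0 = 0 ∧
      (∀ t, HasDerivAt φ
        (axialMomentum Z (γ 0, v 0) * ‖keplerCone Z M (γ 0, v 0) (φ t)‖ ^ 2) t) ∧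
      ∀ t, γ t = ‖keplerCone Z M (γ 0, v 0) (φ t)‖⁻¹ • keplerCone Z M (γ 0, v 0) (φ t) := by
  have hconst : ∀ t, axialMomentumSq Z (γ t, v t) = axialMomentumSq Z (γ 0, v 0) := fun t =>
    is_const_of_deriv_eq_zero
      (fun t => (hasDerivAt_axialMomentumSq hZ (hγ t) (hv t)).differentiableAt)
      (fun t => (hasDerivAt_axialMomentumSq hZ (hγ t) (hv t)).deriv) t 0
  set ℓ := axialMomentum Z (γ 0, v 0) with hℓ
  have hℓ0 : 0 < ℓ := axialMomentum_pos hl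
  have hℓsq : axialMomentumSq Z (γ 0, v 0) = ℓ ^ 2 := (axialMomentum_sq hZ _).symm
  set κ := M / ℓ ^ 2 with hκ
  have hcont : Continuous fun t => ℓ * (axialRadius Z (γ t) ^ 2)⁻¹ := by
    refine continuous_const.mul (Continuous.inv₀ (Continuous.pow ?_ 2) fun t => ?_)
    · exact continuous_iff_continuousAt.2 fun t =>
        (hasDerivAt_axialRadius Z (hγ t) (hr t)).continuousAt
    · exact pow_ne_zero _ (axialRadius_pos (hr t)).ne'
  -- The angle swept about the axis, obtained by integrating angular momentum over squared radius.
  set φ : ℝ → ℝ := fun t => ∫ x in (0 : ℝ)..t, ℓ * (axialRadius Z (γ x) ^ 2)⁻¹ with hφ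
  have hφ' : ∀ t, HasDerivAt φ (ℓ * (axialRadius Z (γ t) ^ 2)⁻¹) t := fun t =>
    intervalIntegral.integral_hasDerivAt_right (hcont.intervalIntegrable _ _)
      (hcont.stronglyMeasurableAtFilter _ _) hcont.continuousAt
  have hφ0 : φ 0 = 0 := by simp [hφ]
  set X : ℝ → H := fun t => conePosition Z (γ t, v t) with hX
  set Θ : ℝ → H := fun t => coneVelocity Z (γ t, v t) with hΘ
  have hX' : ∀ t, HasDerivAt X ((axialRadius Z (γ t) ^ 2)⁻¹ • Θ t) t := fun t =>
    hasDerivAt_conePosition (hr t) (hγ t)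
  have hΘ' : ∀ t, HasDerivAt Θ ((axialRadius Z (γ t) ^ 2)⁻¹ • (M • Z - ℓ ^ 2 • X t)) t :=
    fun t => by
      refine (hasDerivAt_coneVelocity hZ (hr t) (hγ t) (hv t)).congr_deriv ?_
      rw [hconst, hℓsq]
  have hcos := fun t => (hφ' t).cos
  have hsin := fun t => (hφ' t).sin
  -- Rotating the pair (X - κZ, Θ/ℓ) back by the angle φ yields two constant vectors; this solves
  -- the linear equation without a uniqueness theorem for differential equations.
  have hA : ∀ t, HasDerivAt
      (fun t => Real.cos (φ t) • (X t - κ • Z) - Real.sin (φ t) • (ℓ⁻¹ • Θ t)) 0 t := fun t => by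
    refine (((hcos t).smul ((hX' t).sub_const _)).sub
      ((hsin t).smul ((hΘ' t).const_smul ℓ⁻¹))).congr_deriv ?_
    simp only [hκ, Pi.smul_apply]
    match_scalars <;> field_simp <;> ring
  have hB : ∀ t, HasDerivAt
      (fun t => Real.sin (φ t) • (X t - κ • Z) + Real.cos (φ t) • (ℓ⁻¹ • Θ t)) 0 t := fun t => by
    refine (((hsin t).smul ((hX' t).sub_const _)).add
      ((hcos t).smul ((hΘ' t).const_smul ℓ⁻¹))).congr_deriv ?_
    simp only [hκ, Pi.smul_apply]
    match_scalars <;> field_simp <;> ring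
  have hcone : ∀ t, X t = keplerCone Z M (γ 0, v 0) (φ t) := fun t => by
    have ea := is_const_of_deriv_eq_zero (fun t => (hA t).differentiableAt)
      (fun t => (hA t).deriv) t 0
    have eb := is_const_of_deriv_eq_zero (fun t => (hB t).differentiableAt)
      (fun t => (hB t).deriv) t 0
    simp only [hφ0, Real.cos_zero, Real.sin_zero, one_smul, zero_smul, sub_zero, zero_add] at ea eb
    have hrot : X t - κ • Z = Real.cos (φ t) • (X 0 - κ • Z) + Real.sin (φ t) • (ℓ⁻¹ • Θ 0) := by
      rw [← ea, ← eb]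
      exact eq_cos_smul_add_sin_smul _ _ _
    rw [sub_eq_iff_eq_add.1 hrot, keplerCone]
    simp only [hκ, hℓ, hX, hΘ]
    module
  have hnorm : ∀ t, ‖keplerCone Z M (γ 0, v 0) (φ t)‖ = (axialRadius Z (γ t))⁻¹ := fun t => by
    rw [← hcone]
    exact norm_conePosition (hr t) (h1 t)
  refine ⟨φ, hφ0, fun t => ?_, fun t => ?_⟩
  · rw [hnorm, inv_pow]; exact hφ' t
  · rw [hnorm, ← hcone]
    simp only [hX, conePosition, inv_inv, smul_smul,
      mul_inv_cancel₀ (axialRadius_pos (hr t)).ne', one_smul]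

end ConeMotion

/-! ### The motions of the spherical Kepler problem -/

section Smoothness

variable {H : Type*} [NormedAddCommGroup H] [InnerProductSpace ℝ H] {Z : H} {m : WithTop ℕ∞}

lemma contDiff_axialInner (Z : H) : ContDiff ℝ m fun z : H × H => axialInner Z z.1 z.2 :=
  (contDiff_fst.inner ℝ contDiff_snd).sub
    ((contDiff_const.inner ℝ contDiff_fst).mul (contDiff_const.inner ℝ contDiff_snd))

lemma contDiff_axialInner_self (Z : H) : ContDiff ℝ m fun q : H => axialInner Z q q :=
  (contDiff_axialInner Z).comp (contDiff_id.prodMk contDiff_id)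

lemma contDiffAt_axialRadius {q : H} (hq : 0 < axialInner Z q q) :
    ContDiffAt ℝ m (axialRadius Z) q :=
  (contDiff_axialInner_self Z).contDiffAt.sqrt hq.ne'

lemma contDiff_keplerCone (Z : H) (M : ℝ) (z : H × H) : ContDiff ℝ m (keplerCone Z M z) := by
  unfold keplerCone
  fun_prop

end Smoothness

section Surjectivity

/-- Used for both time changes: every time is reached as a function of the angle, and every angle as
a function of time. -/
lemma surjective_of_le_hasDerivAt {f f' : ℝ → ℝ} {c : ℝ} (hc : 0 < c)
    (hf : ∀ x, HasDerivAt f (f' x) x) (h : ∀ x, c ≤ f' x) : Function.Surjective f := by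
  have hmono : Monotone fun x => f x - c * x := by
    refine monotone_of_hasDerivAt_nonneg (f' := fun x => f' x - c * 1)
      (fun x => (hf x).sub ((hasDerivAt_id x).const_mul c)) fun x => ?_
    simpa using h x
  have hcont : Continuous f := continuous_iff_continuousAt.2 fun x => (hf x).continuousAt
  refine hcont.surjective ?_ ?_
  · refine Filter.tendsto_atTop_mono' Filter.atTop (f₁ := fun x => c * x + f 0) ?_
      (Filter.tendsto_atTop_add_const_right _ _ (Filter.tendsto_id.const_mul_atTop hc))
    filter_upwards [Filter.eventually_ge_atTop 0] with x hx
    have := hmono hx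
    simp only [mul_zero, sub_zero] at this
    linarith
  · refine Filter.tendsto_atBot_mono' Filter.atBot (f₁ := fun x => c * x + f 0) ?_
      (Filter.tendsto_atBot_add_const_right _ _ (Filter.tendsto_id.const_mul_atBot hc))
    filter_upwards [Filter.eventually_le_atBot 0] with x hx
    have := hmono hx
    simp only [mul_zero, sub_zero] at this
    linarith

end Surjectivity

variable {n : ℕ} {a m₁ : ℝ} {z : Ambient n × Ambient n} {γ : ℝ → Ambient n}

/-! ### The force of the first center and the equation of motion. -/

lemma norm_southPole (n : ℕ) : ‖southPole n‖ = 1 := by simp [southPole]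

lemma yIdx_ne_zIdx (n : ℕ) : yIdx n ≠ zIdx n := (Fin.castSucc_lt_last _).ne

lemma norm_center₁ (n : ℕ) (a : ℝ) : ‖center₁ n a‖ = 1 := by
  have hs : 0 < √(1 + a ^ 2) := by positivity
  have h : ‖EuclideanSpace.single (yIdx n) a + southPole n‖ ^ 2 = 1 + a ^ 2 := by
    rw [@norm_add_sq_real, norm_southPole]
    simp [southPole, EuclideanSpace.inner_single_left, yIdx_ne_zIdx n]
    ring
  rw [center₁, norm_smul, norm_inv, Real.norm_eq_abs, abs_of_pos hs,
    ← Real.sqrt_sq (norm_nonneg (EuclideanSpace.single (yIdx n) a + southPole n)), h]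
  field_simp

lemma axialInner_self_pos_of_ne {H : Type*} [NormedAddCommGroup H] [InnerProductSpace ℝ H]
    {Z q : H} (hZ : ‖Z‖ = 1) (hq : ‖q‖ = 1) (h₁ : q ≠ Z) (h₂ : q ≠ -Z) :
    0 < axialInner Z q q := by
  have e₁ : ⟪Z, q⟫ ≠ 1 := fun h => h₁ ((inner_eq_one_iff_of_norm_eq_one hZ hq).1 h).symm
  have e₂ : ⟪Z, q⟫ ≠ -1 := fun h => by
    have h' : ⟪Z, -q⟫ = 1 := by rw [inner_neg_right, h, neg_neg]
    exact h₂ (by rw [(inner_eq_one_iff_of_norm_eq_one hZ (by rwa [norm_neg])).1 h', neg_neg])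
  have hle := abs_real_inner_le_norm Z q
  rw [hZ, hq, one_mul] at hle
  obtain ⟨l1, l2⟩ := abs_le.1 hle
  have l3 := lt_of_le_of_ne l2 e₁
  have l4 := lt_of_le_of_ne l1 e₂.symm
  rw [axialInner, real_inner_self_eq_norm_sq, hq]
  nlinarith

lemma firstPotential_eq (a m₁ : ℝ) (q : Ambient n) :
    firstPotential a m₁ q
      = -(m₁ * √(1 + a ^ 2)) * (⟪center₁ n a, q⟫ / axialRadius (center₁ n a) q) := by
  rw [firstPotential, keplerPotential, cot_angle_eq (norm_center₁ n a)]

lemma tangentialPart_add (q w w' : Ambient n) :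
    tangentialPart q (w + w') = tangentialPart q w + tangentialPart q w' := by
  simp only [tangentialPart, inner_add_right]; module

lemma tangentialPart_smul (q w : Ambient n) (c : ℝ) :
    tangentialPart q (c • w) = c • tangentialPart q w := by
  simp only [tangentialPart, real_inner_smul_right]; module

lemma tangentialPart_self {q : Ambient n} (hq : ‖q‖ = 1) : tangentialPart q q = 0 := by
  simp [tangentialPart, hq]

lemma gradient_firstPotential {q : Ambient n} (hq : 0 < axialInner (center₁ n a) q q) :
    gradient (firstPotential a m₁) q = -((m₁ * √(1 + a ^ 2)) / axialRadius (center₁ n a) q) •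
      (center₁ n a - (⟪center₁ n a, q⟫ / axialRadius (center₁ n a) q ^ 2) •
        (q - ⟪center₁ n a, q⟫ • center₁ n a)) := by
  set Z := center₁ n a
  have hr := axialRadius_pos hq
  have hd : DifferentiableAt ℝ (firstPotential a m₁) q := by
    have : firstPotential a m₁ = fun q : Ambient n =>
      -(m₁ * √(1 + a ^ 2)) * (⟪Z, q⟫ / axialRadius Z q) := funext (firstPotential_eq a m₁)
    rw [this]
    have hin : DifferentiableAt ℝ (fun q => ⟪Z, q⟫) q :=
      (differentiableAt_const Z).inner ℝ differentiableAt_id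
    have hrad : DifferentiableAt ℝ (axialRadius Z) q :=
      (contDiffAt_axialRadius (m := 1) hq).differentiableAt one_ne_zero
    simp only [div_eq_mul_inv]
    exact (hin.mul (hrad.inv hr.ne')).const_mul _
  refine ext_inner_right ℝ fun δ => ?_
  rw [inner_gradient_left]
  have hline : HasDerivAt (fun t : ℝ => q + t • δ) δ 0 := by
    simpa using ((hasDerivAt_id (0 : ℝ)).smul_const δ).const_add q
  have h0 : q + (0 : ℝ) • δ = q := by simp
  have h1 := HasFDerivAt.comp_hasDerivAt (0 : ℝ) (by rw [h0]; exact hd.hasFDerivAt) hline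
  have hq' : 0 < axialInner Z (q + (0 : ℝ) • δ) (q + (0 : ℝ) • δ) := by rwa [h0]
  have h2 := ((((hasDerivAt_const (0 : ℝ) Z).inner ℝ hline).div
    (hasDerivAt_axialRadius Z hline hq')
    (axialRadius_pos hq').ne').const_mul (-(m₁ * √(1 + a ^ 2))))
  have h3 : firstPotential a m₁ ∘ (fun t : ℝ => q + t • δ) = fun t : ℝ =>
      -(m₁ * √(1 + a ^ 2)) * (((fun t : ℝ => ⟪Z, q + t • δ⟫) /
        fun t : ℝ => axialRadius Z (q + t • δ)) t) := funext fun t => firstPotential_eq a m₁ _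
  rw [h3] at h1
  rw [h1.unique h2, h0]
  simp only [inner_zero_left, add_zero, inner_smul_left, inner_sub_left, axialInner,
    RCLike.conj_to_real]
  field_simp

/-- The gradient lies in the span of q and Z, and the tangential projection kills the q-component.
-/
lemma tangentialPart_gradient_firstPotential {q : Ambient n} (h1 : ‖q‖ = 1)
    (hq : 0 < axialInner (center₁ n a) q q) :
    tangentialPart q (gradient (firstPotential a m₁) q) =
      -((m₁ * √(1 + a ^ 2)) / axialRadius (center₁ n a) q ^ 3) •
        tangentialPart q (center₁ n a) := by
  have hr := axialRadius_pos hq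
  have hsq : axialRadius (center₁ n a) q ^ 2 + ⟪center₁ n a, q⟫ ^ 2 = 1 := by
    rw [axialRadius_sq (norm_center₁ n a), ← norm_sq_eq_axialInner, h1, one_pow]
  have key : gradient (firstPotential a m₁) q =
      (-((m₁ * √(1 + a ^ 2)) / axialRadius (center₁ n a) q ^ 3)) • center₁ n a
      + ((m₁ * √(1 + a ^ 2)) * ⟪center₁ n a, q⟫ / axialRadius (center₁ n a) q ^ 3) • q := by
    rw [gradient_firstPotential hq]
    match_scalars
    · field_simp
      linear_combination -m₁ * hsq
    · field_simp
  rw [key, tangentialPart_add, tangentialPart_smul, tangentialPart_smul, tangentialPart_self h1,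
    smul_zero, add_zero]

lemma IsKeplerMotion.axialInner_pos (h : IsKeplerMotion a m₁ z γ) (t : ℝ) :
    0 < axialInner (center₁ n a) (γ t) (γ t) :=
  axialInner_self_pos_of_ne (norm_center₁ n a) (h.norm_eq_one t) (h.ne_center t) (h.ne_antipode t)

lemma IsKeplerMotion.hasDerivAt (h : IsKeplerMotion a m₁ z γ) (t : ℝ) :
    HasDerivAt γ (deriv γ t) t :=
  (h.contDiff.differentiable two_ne_zero t).hasDerivAt

/-- Newton's equation fixes the acceleration up to its normal component, which is absorbed in the
unspecified multiplier `k`. -/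
lemma IsKeplerMotion.exists_hasDerivAt_deriv (h : IsKeplerMotion a m₁ z γ) (t : ℝ) :
    ∃ k : ℝ, HasDerivAt (deriv γ) (k • γ t +
      (m₁ * √(1 + a ^ 2) / axialRadius (center₁ n a) (γ t) ^ 3) • center₁ n a) t := by
  have hd : HasDerivAt (deriv γ) (deriv (deriv γ) t) t := by
    have h2 : ContDiff ℝ (1 + 1) γ := by simpa [one_add_one_eq_two] using h.contDiff
    exact ((contDiff_succ_iff_deriv.1 h2).2.2.differentiable one_ne_zero t).hasDerivAt
  have hn := h.newton t
  rw [tangentialPart_gradient_firstPotential (h.norm_eq_one t) (h.axialInner_pos t), neg_smul,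
    neg_neg, tangentialPart, tangentialPart, sub_eq_iff_eq_add] at hn
  refine ⟨⟪γ t, deriv (deriv γ) t⟫ - m₁ * √(1 + a ^ 2) / axialRadius (center₁ n a) (γ t) ^ 3 *
    ⟪γ t, center₁ n a⟫, hd.congr_deriv ?_⟩
  refine hn.trans ?_
  module

/-- The cone over a non-singular Kepler orbit is parametrized by the angle about the axis, which is
a diffeomorphic time change of the motion. -/
lemma IsKeplerMotion.exists_angle (h : IsKeplerMotion a m₁ z γ) (hm₁ : 0 < m₁) :
    0 < axialMomentumSq (center₁ n a) z ∧ ⟪z.1, z.2⟫ = 0 ∧ ‖z.1‖ = 1 ∧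
    ∃ φ : ℝ → ℝ, φ 0 = 0 ∧
      (∀ t, HasDerivAt φ (axialMomentum (center₁ n a) z *
        ‖keplerCone (center₁ n a) (m₁ * √(1 + a ^ 2)) z (φ t)‖ ^ 2) t) ∧
      ∀ t, γ t = ‖keplerCone (center₁ n a) (m₁ * √(1 + a ^ 2)) z (φ t)‖⁻¹ •
        keplerCone (center₁ n a) (m₁ * √(1 + a ^ 2)) z (φ t) := by
  choose k hk using h.exists_hasDerivAt_deriv
  have hz : z = (γ 0, deriv γ 0) := by rw [h.position, h.velocity]
  have hpos := axialMomentumSq_pos_of_motion (norm_center₁ n a) (by positivity) h.norm_eq_one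
    h.axialInner_pos h.hasDerivAt hk
  have horth : ⟪z.1, z.2⟫ = 0 := by
    have h1 := (h.hasDerivAt 0).inner ℝ (h.hasDerivAt 0)
    have h2 : (fun t => ⟪γ t, γ t⟫) = fun _ => (1 : ℝ) := by
      funext t; rw [real_inner_self_eq_norm_sq, h.norm_eq_one, one_pow]
    rw [h2] at h1
    have h3 := h1.unique (hasDerivAt_const _ _)
    rw [real_inner_comm (γ 0) (deriv γ 0), h.position, h.velocity] at h3
    linarith
  rw [hz]
  refine ⟨hpos 0, by rw [← hz]; exact horth, h.norm_eq_one 0, ?_⟩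
  exact exists_angle_of_motion (norm_center₁ n a) h.norm_eq_one
    h.axialInner_pos h.hasDerivAt hk (hpos 0)

/-! ### Time as an integral over the angle, and the period. -/

section Period

variable {H : Type*} [NormedAddCommGroup H] [InnerProductSpace ℝ H] {Z : H} {M : ℝ} {z : H × H}

/-- The density of time with respect to the angle about the axis along a Kepler orbit. -/
def timeDensity (Z : H) (M : ℝ) (z : H × H) (φ : ℝ) : ℝ :=
  (axialMomentum Z z * ‖keplerCone Z M z φ‖ ^ 2)⁻¹

/-- The time integral of a function on the cone over one turn of the Kepler orbit through `z`. -/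
def orbitIntegral (Z : H) (M : ℝ) (U : H → ℝ) (z : H × H) : ℝ :=
  ∫ φ in (0 : ℝ)..2 * Real.pi, U (keplerCone Z M z φ) * timeDensity Z M z φ

lemma timeDensity_pos (hZ : ‖Z‖ = 1) (hz : 0 < axialMomentumSq Z z) (φ : ℝ) :
    0 < timeDensity Z M z φ := by
  have h1 := norm_keplerCone_pos hZ M hz φ
  have h2 := axialMomentum_pos hz
  unfold timeDensity
  positivity

lemma contDiff_timeDensity (hZ : ‖Z‖ = 1) (hz : 0 < axialMomentumSq Z z) {m : WithTop ℕ∞} :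
    ContDiff ℝ m (timeDensity Z M z) := by
  unfold timeDensity
  refine (contDiff_const.mul ((contDiff_keplerCone Z M z).norm_sq ℝ)).inv fun φ => ?_
  have h1 := norm_keplerCone_pos hZ M hz φ
  have h2 := axialMomentum_pos hz
  positivity

lemma timeDensity_add_two_pi (Z : H) (M : ℝ) (z : H × H) (φ : ℝ) :
    timeDensity Z M z (φ + 2 * Real.pi) = timeDensity Z M z φ := by
  simp [timeDensity, keplerCone_add_two_pi]

/-- The time at which the Kepler motion reaches a given angle about the axis. -/
def timeOfAngle (Z : H) (M : ℝ) (z : H × H) (φ : ℝ) : ℝ :=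
  ∫ x in (0 : ℝ)..φ, timeDensity Z M z x

lemma hasDerivAt_timeOfAngle (hZ : ‖Z‖ = 1) (hz : 0 < axialMomentumSq Z z) (φ : ℝ) :
    HasDerivAt (timeOfAngle Z M z) (timeDensity Z M z φ) φ := by
  have hcont : Continuous (timeDensity Z M z) := (contDiff_timeDensity (m := 0) hZ hz).continuous
  exact intervalIntegral.integral_hasDerivAt_right (hcont.intervalIntegrable _ _)
    (hcont.stronglyMeasurableAtFilter _ _) hcont.continuousAt

lemma timeOfAngle_add_two_pi (hZ : ‖Z‖ = 1) (hz : 0 < axialMomentumSq Z z) (φ : ℝ) :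
    timeOfAngle Z M z (φ + 2 * Real.pi)
      = timeOfAngle Z M z φ + timeOfAngle Z M z (2 * Real.pi) := by
  have hcont : Continuous (timeDensity Z M z) := (contDiff_timeDensity (m := 0) hZ hz).continuous
  have hp : Function.Periodic (timeDensity Z M z) (2 * Real.pi) := timeDensity_add_two_pi Z M z
  have := hp.intervalIntegral_add_eq φ 0
  rw [zero_add] at this
  rw [timeOfAngle, timeOfAngle, timeOfAngle, ← this,
    intervalIntegral.integral_add_adjacent_intervals (hcont.intervalIntegrable _ _)
      (hcont.intervalIntegrable _ _)]

lemma surjective_timeOfAngle (hZ : ‖Z‖ = 1) (hz : 0 < axialMomentumSq Z z) :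
    Function.Surjective (timeOfAngle Z M z) := by
  have hl := axialMomentum_pos hz
  -- A bound for the cone by the triangle inequality; it bounds the density of time from below.
  set K : ℝ := |M / axialMomentum Z z ^ 2| * 2 + ‖conePosition Z z‖
    + ‖coneVelocity Z z‖ / axialMomentum Z z with hK
  have hbound : ∀ φ, ‖keplerCone Z M z φ‖ ≤ K := fun φ => by
    have hc := Real.abs_cos_le_one φ
    have hs := Real.abs_sin_le_one φ
    have h1 : ‖(M / axialMomentum Z z ^ 2 * (1 - Real.cos φ)) • Z‖
        ≤ |M / axialMomentum Z z ^ 2| * 2 := by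
      rw [norm_smul, hZ, mul_one, norm_mul, Real.norm_eq_abs, Real.norm_eq_abs]
      refine mul_le_mul_of_nonneg_left (abs_le.2 ⟨?_, ?_⟩) (abs_nonneg _) <;>
        linarith [(abs_le.1 hc).1, (abs_le.1 hc).2]
    have h2 : ‖Real.cos φ • conePosition Z z‖ ≤ ‖conePosition Z z‖ := by
      rw [norm_smul, Real.norm_eq_abs]
      exact mul_le_of_le_one_left (norm_nonneg _) hc
    have h3 : ‖(Real.sin φ / axialMomentum Z z) • coneVelocity Z z‖
        ≤ ‖coneVelocity Z z‖ / axialMomentum Z z := by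
      rw [norm_smul, norm_div, Real.norm_eq_abs, Real.norm_eq_abs, abs_of_pos hl,
        div_mul_eq_mul_div]
      gcongr
      exact mul_le_of_le_one_left (norm_nonneg _) hs
    exact (norm_add₃_le).trans (add_le_add (add_le_add h1 h2) h3)
  have hK0 : 0 < K := (norm_keplerCone_pos hZ M hz 0).trans_le (hbound 0)
  refine surjective_of_le_hasDerivAt (c := (axialMomentum Z z * K ^ 2)⁻¹) (by positivity)
    (hasDerivAt_timeOfAngle hZ hz) fun φ => ?_
  have h1 := norm_keplerCone_pos hZ M hz φ
  unfold timeDensity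
  gcongr
  exact hbound φ

/-- The angle about the axis along the Kepler motion. -/
lemma exists_angleOfTime (hZ : ‖Z‖ = 1) (hz : 0 < axialMomentumSq Z z) :
    ∃ φ : ℝ → ℝ, φ 0 = 0 ∧ ContDiff ℝ 2 φ ∧
      (∀ t, HasDerivAt φ (axialMomentum Z z * ‖keplerCone Z M z (φ t)‖ ^ 2) t) ∧
      ∀ t, φ (t + timeOfAngle Z M z (2 * Real.pi)) = φ t + 2 * Real.pi := by
  have hder := hasDerivAt_timeOfAngle (M := M) hZ hz
  have hmono : StrictMono (timeOfAngle Z M z) :=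
    strictMono_of_hasDerivAt_pos hder (timeDensity_pos hZ hz)
  set e := (hmono.orderIsoOfSurjective _ (surjective_timeOfAngle hZ hz)).toHomeomorph with he
  have hcoe : ∀ x, e x = timeOfAngle Z M z x := fun x => rfl
  have hcoe' : (e : ℝ → ℝ) = timeOfAngle Z M z := rfl
  have hinv : ∀ t, timeOfAngle Z M z (e.symm t) = t := fun t => e.apply_symm_apply t
  refine ⟨e.symm, ?_, ?_, fun t => ?_, fun t => ?_⟩
  · rw [e.symm_apply_eq, hcoe, timeOfAngle, intervalIntegral.integral_same]
  -- The inverse of a C² homeomorphism with non-vanishing derivative is C².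
  · refine e.contDiff_symm_deriv (f' := timeDensity Z M z)
      (fun x => (timeDensity_pos hZ hz x).ne') hder ?_
    rw [hcoe', show (2 : WithTop ℕ∞) = 1 + 1 from one_add_one_eq_two.symm, contDiff_succ_iff_deriv]
    refine ⟨fun x => (hder x).differentiableAt, by simp, ?_⟩
    rw [show deriv (timeOfAngle Z M z) = timeDensity Z M z from funext fun x => (hder x).deriv]
    exact contDiff_timeDensity hZ hz
  · have := HasDerivAt.of_local_left_inverse (f := timeOfAngle Z M z) (g := e.symm) (a := t)
      e.symm.continuous.continuousAt (hder _) (timeDensity_pos hZ hz _).ne'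
      (Filter.Eventually.of_forall hinv)
    simpa only [timeDensity, inv_inv] using this
  · rw [e.symm_apply_eq, hcoe, timeOfAngle_add_two_pi hZ hz, hinv]

end Period

/-! ### Existence of closed motions and the formula for averages. -/

variable {n : ℕ} {a m₁ : ℝ} {z : Ambient n × Ambient n} {γ : ℝ → Ambient n}

/-- Kepler motions with non-vanishing angular momentum are closed. -/
lemma exists_isClosedKeplerMotion (h1 : ‖z.1‖ = 1) (horth : ⟪z.1, z.2⟫ = 0)
    (hz : 0 < axialMomentumSq (center₁ n a) z) :
    ∃ (γ : ℝ → Ambient n) (T : ℝ), IsClosedKeplerMotion a m₁ z γ T := by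
  have hZ := norm_center₁ n a
  set Z := center₁ n a with hZdef
  set M := m₁ * √(1 + a ^ 2) with hM
  set ℓ := axialMomentum Z z with hℓ
  have hℓ0 : 0 < ℓ := axialMomentum_pos hz
  obtain ⟨φ, hφ0, hφC, hφ', hφp⟩ := exists_angleOfTime (M := M) hZ hz
  -- The motion is built backwards: run through the explicit cone with the right time law and
  -- project it radially to the sphere.
  set X : ℝ → Ambient n := fun t => keplerCone Z M z (φ t) with hX
  set Θ : ℝ → Ambient n := fun t => ℓ • keplerConeDeriv Z M z (φ t) with hΘ
  have hXpos : ∀ t, 0 < ‖X t‖ := fun t => norm_keplerCone_pos hZ M hz _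
  have hXC : ContDiff ℝ 2 X := (contDiff_keplerCone Z M z).comp hφC
  have hX' : ∀ t, HasDerivAt X (‖X t‖ ^ 2 • Θ t) t := fun t => by
    refine ((hasDerivAt_keplerCone Z M z (φ t)).scomp t (hφ' t)).congr_deriv ?_
    simp only [hΘ, hX]
    module
  have hΘ' : ∀ t, HasDerivAt Θ (‖X t‖ ^ 2 • (M • Z - ℓ ^ 2 • X t)) t := fun t => by
    refine (((hasDerivAt_keplerConeDeriv Z M z (φ t)).scomp t (hφ' t)).const_smul ℓ).congr_deriv ?_
    simp only [hX, ← hℓ]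
    match_scalars <;> field_simp
  have hN : ∀ t, HasDerivAt (fun t => ‖X t‖) (‖X t‖ * ⟪X t, Θ t⟫) t := fun t => by
    have hs := ((hX' t).inner ℝ (hX' t)).sqrt (by
      rw [real_inner_self_eq_norm_sq]; exact (pow_pos (hXpos t) 2).ne')
    have e : (fun t => ‖X t‖) = fun t => √⟪X t, X t⟫ := by
      funext t; rw [real_inner_self_eq_norm_sq, Real.sqrt_sq (norm_nonneg _)]
    rw [e]
    refine hs.congr_deriv ?_
    have := hXpos t
    rw [real_inner_self_eq_norm_sq, Real.sqrt_sq (norm_nonneg _), real_inner_smul_left,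
      real_inner_smul_right, real_inner_comm (X t) (Θ t)]
    field_simp
    ring
  set γ : ℝ → Ambient n := fun t => ‖X t‖⁻¹ • X t with hγ
  set g : ℝ → ℝ := fun t => ⟪X t, Θ t⟫ / ‖X t‖ with hg
  have hγ' : ∀ t, HasDerivAt γ (‖X t‖ • Θ t - g t • X t) t := fun t => by
    refine (((hN t).inv (hXpos t).ne').smul (hX' t)).congr_deriv ?_
    have := hXpos t
    simp only [hg, Pi.inv_apply]
    match_scalars <;> field_simp
  have hγd : deriv γ = fun t => ‖X t‖ • Θ t - g t • X t := funext fun t => (hγ' t).deriv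
  -- Only the Z-coefficient matters: X is normal to the sphere at γ, and ‖X‖³M is M over the cube of
  -- the axial radius, as the force law demands.
  have hγ'' : ∀ t, ∃ c : ℝ, deriv (deriv γ) t = c • X t + (‖X t‖ ^ 3 * M) • Z := fun t => by
    have hgd : DifferentiableAt ℝ g t :=
      (((hX' t).inner ℝ (hΘ' t)).div (hN t) (hXpos t).ne').differentiableAt
    refine ⟨-(‖X t‖ ^ 3 * ℓ ^ 2 + deriv g t), ?_⟩
    rw [hγd]
    refine HasDerivAt.deriv ((((hN t).smul (hΘ' t)).sub
      (hgd.hasDerivAt.smul (hX' t))).congr_deriv ?_)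
    have := hXpos t
    simp only [hg]
    match_scalars <;> field_simp <;> ring
  have hnorm : ∀ t, ‖γ t‖ = 1 := fun t => by
    simp only [hγ]
    rw [norm_smul, norm_inv, norm_norm, inv_mul_cancel₀ (hXpos t).ne']
  have hax : ∀ t, axialInner Z (γ t) (γ t) = (‖X t‖⁻¹) ^ 2 := fun t => by
    simp only [hγ, axialInner_smul_left, axialInner_smul_right, hX,
      axialInner_keplerCone_self hZ M hz]
    ring
  have hax0 : ∀ t, 0 < axialInner Z (γ t) (γ t) := fun t => by
    rw [hax]; exact pow_pos (inv_pos.2 (hXpos t)) 2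
  have hr : ∀ t, axialRadius Z (γ t) = ‖X t‖⁻¹ := fun t => by
    rw [axialRadius, hax, Real.sqrt_sq (inv_nonneg.2 (norm_nonneg _))]
  have hq := axialInner_self_pos_of_momentum hZ hz
  have hrq := axialRadius_pos hq
  have hX0 : X 0 = (axialRadius Z z.1)⁻¹ • z.1 := by
    simp only [hX, hφ0, keplerCone_zero, conePosition]
  have hnX0 : ‖X 0‖ = (axialRadius Z z.1)⁻¹ := by
    rw [hX0, norm_smul, h1, norm_inv, Real.norm_eq_abs, abs_of_pos hrq, mul_one]
  have hΘ0 : Θ 0 = coneVelocity Z z := by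
    simp only [hΘ, hφ0, keplerConeDeriv, Real.sin_zero, Real.cos_zero, ← hℓ]
    match_scalars <;> field_simp <;> ring
  refine ⟨γ, timeOfAngle Z M z (2 * Real.pi), ⟨?_, ?_, ?_, ?_, ?_, ?_, ?_⟩, ?_, ?_⟩
  · exact ((hXC.norm ℝ fun t => norm_pos_iff.1 (hXpos t)).inv fun t => (hXpos t).ne').smul hXC
  · exact hnorm
  · intro t ht
    have := hax0 t
    rw [ht, axialInner_axis_left hZ] at this
    exact this.false
  · intro t ht
    have := hax0 t
    rw [ht, ← neg_one_smul ℝ (center₁ n a), axialInner_smul_left, axialInner_smul_right,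
      axialInner_axis_left hZ] at this
    simp at this
  · intro t
    obtain ⟨c, hc⟩ := hγ'' t
    rw [tangentialPart_gradient_firstPotential (hnorm t) (hax0 t), hc, ← hZdef, hr, ← hM]
    have hXγ : X t = ‖X t‖ • γ t := by
      simp only [hγ, smul_smul, mul_inv_cancel₀ (hXpos t).ne', one_smul]
    have e : tangentialPart (γ t) (X t) = 0 := by
      rw [hXγ, tangentialPart_smul, tangentialPart_self (hnorm t), smul_zero]
    rw [tangentialPart_add, tangentialPart_smul, tangentialPart_smul, e, smul_zero, zero_add,
      neg_smul, neg_neg]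
    congr 1
    have := hXpos t
    field_simp
  · simp only [hγ]
    rw [hnX0, hX0, inv_inv, smul_smul, mul_inv_cancel₀ hrq.ne', one_smul]
  · rw [hγd]
    simp only [hg]
    rw [hnX0, hΘ0, hX0, coneVelocity, inner_sub_right, real_inner_smul_left, real_inner_smul_left,
      real_inner_smul_right, real_inner_smul_right, horth, real_inner_self_eq_norm_sq, h1]
    match_scalars <;> field_simp
    ring
  · rw [timeOfAngle]
    exact intervalIntegral.intervalIntegral_pos_of_pos
      ((contDiff_timeDensity (m := 0) hZ hz).continuous.intervalIntegrable _ _)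
      (timeDensity_pos hZ hz) Real.two_pi_pos
  · intro t
    simp only [hγ, hX, hφp, keplerCone_add_two_pi]

/-- The time average over a closed Kepler motion is a quotient of integrals over one turn about the
axis. -/
lemma IsClosedKeplerMotion.average_eq {T : ℝ} (h : IsClosedKeplerMotion a m₁ z γ T) (hm₁ : 0 < m₁)
    {U : Ambient n → ℝ} (hU : ∀ (c : ℝ) q, 0 < c → U (c • q) = U q)
    (hcont : Continuous fun φ => U (keplerCone (center₁ n a) (m₁ * √(1 + a ^ 2)) z φ)) :
    ∫ s in (0 : ℝ)..1, U (γ (T * s)) =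
      orbitIntegral (center₁ n a) (m₁ * √(1 + a ^ 2)) U z /
        orbitIntegral (center₁ n a) (m₁ * √(1 + a ^ 2)) (fun _ => 1) z := by
  obtain ⟨hmot, hT, hper⟩ := h
  obtain ⟨hz, -, h1, φ, hφ0, hφ', hγ⟩ := hmot.exists_angle hm₁
  have hZ := norm_center₁ n a
  set Z := center₁ n a with hZdef
  set M := m₁ * √(1 + a ^ 2) with hM
  have hdens : Continuous (timeDensity Z M z) := (contDiff_timeDensity (m := 0) hZ hz).continuous
  have hφc : Continuous φ := continuous_iff_continuousAt.2 fun t => (hφ' t).continuousAt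
  have hφ'c : Continuous fun t => axialMomentum Z z * ‖keplerCone Z M z (φ t)‖ ^ 2 :=
    continuous_const.mul ((((contDiff_keplerCone (m := 0) Z M z).continuous.comp hφc).norm).pow 2)
  -- As `T` need not be the least period, the orbit makes some number `k` of turns; this number
  -- cancels in the quotient.
  obtain ⟨k, hk⟩ : ∃ k : ℤ, (k : ℝ) * (2 * Real.pi) = φ T := by
    rw [← Real.cos_eq_one_iff]
    have hq := axialInner_self_pos_of_momentum hZ hz
    have e0 : γ T = γ 0 := by simpa using hper 0
    rw [hγ, hγ 0, hφ0, keplerCone_zero] at e0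
    set b := ‖keplerCone Z M z (φ T)‖⁻¹
    set b' := ‖conePosition Z z‖⁻¹
    have hb : 0 < b := inv_pos.2 (norm_keplerCone_pos hZ M hz _)
    have hb' : 0 < b' := by
      have := norm_keplerCone_pos hZ M hz 0
      rw [keplerCone_zero] at this
      exact inv_pos.2 this
    have e1 : b ^ 2 = b' ^ 2 := by
      have := congrArg (fun q => axialInner Z q q) e0
      simp only [axialInner_smul_left, axialInner_smul_right, axialInner_keplerCone_self hZ M hz,
        axialInner_conePosition_self hZ hq] at this
      linarith
    have e2 : b = b' := by
      rwa [sq_eq_sq₀ hb.le hb'.le] at e1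
    -- Once the two radial factors agree, pairing with the initial direction reads off cos φ(T) = 1.
    have e3 := congrArg (fun q => axialInner Z q (conePosition Z z)) e0
    simp only [axialInner_smul_left, keplerCone, axialInner_add_left, axialInner_axis_left hZ,
      axialInner_conePosition_self hZ hq, axialInner_comm Z (coneVelocity Z z),
      axialInner_conePosition_coneVelocity hZ hq, e2] at e3
    have := hb'.ne'
    field_simp at e3
    simpa using e3
  have hsubst : ∀ V : Ambient n → ℝ, Continuous (fun φ => V (keplerCone Z M z φ)) →
      ∫ t in (0 : ℝ)..T, V (keplerCone Z M z (φ t)) = k * orbitIntegral Z M V z := by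
    intro V hV
    have hG : Continuous fun φ => V (keplerCone Z M z φ) * timeDensity Z M z φ := hV.mul hdens
    have e1 := intervalIntegral.integral_comp_mul_deriv (a := 0) (b := T)
      (fun t _ => hφ' t) hφ'c.continuousOn hG
    have e2 : ∀ t, ((fun φ => V (keplerCone Z M z φ) * timeDensity Z M z φ) ∘ φ) t *
        (axialMomentum Z z * ‖keplerCone Z M z (φ t)‖ ^ 2) = V (keplerCone Z M z (φ t)) :=
      fun t => by
        have h1 := norm_keplerCone_pos hZ M hz (φ t)
        have h2 := axialMomentum_pos hz
        simp only [Function.comp_apply, timeDensity]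
        field_simp
    rw [intervalIntegral.integral_congr fun t _ => e2 t, hφ0, ← hk] at e1
    have hp : Function.Periodic (fun φ => V (keplerCone Z M z φ) * timeDensity Z M z φ)
        (2 * Real.pi) := fun φ => by
      simp only [keplerCone_add_two_pi, timeDensity_add_two_pi]
    have e3 := hp.intervalIntegral_add_zsmul_eq k 0 fun _ _ => hG.intervalIntegrable _ _
    simp only [zero_add, zsmul_eq_mul] at e3
    rw [e1, e3, orbitIntegral]
  have hone := hsubst (fun _ => 1) continuous_const
  have hUU := hsubst U hcont
  have hγU : ∀ t, U (γ t) = U (keplerCone Z M z (φ t)) := fun t => by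
    rw [hγ, hU _ _ (inv_pos.2 (norm_keplerCone_pos hZ M hz _))]
  rw [intervalIntegral.integral_const, smul_eq_mul, mul_one, sub_zero] at hone
  rw [intervalIntegral.integral_comp_mul_left (fun t => U (γ t)) hT.ne', mul_zero, mul_one,
    intervalIntegral.integral_congr fun t _ => hγU t, hUU, smul_eq_mul, hone]
  -- The case U = 1 reads T = k · (time of one turn), so T > 0 excludes k = 0.
  have hk0 : (k : ℝ) ≠ 0 := fun h0 => by rw [h0, zero_mul] at hone; exact hT.ne' hone
  rw [← div_eq_inv_mul, mul_div_mul_left _ _ hk0]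

/-! ### The function `D` in homogeneous coordinates -/

/-- The expression of `D` as a function on `T^*ℝ^{d+1}` which is invariant under
`toTangentSphere`; here `Z` is the first center, `Y` the unit vector orthogonal to `Z` in the plane
of the centers, and `N` the north pole. -/
def axialIntegral {H : Type*} [NormedAddCommGroup H] [InnerProductSpace ℝ H] (Y Z N : H)
    (h m : ℝ) (z : H × H) : ℝ :=
  axialMomentumSq Z z - 2 * h *
    (axialInner Z z.1 z.1 * (⟪Y, z.2⟫ * ⟪N, z.2⟫)
      - axialInner Z z.1 z.2 * (⟪Y, z.2⟫ * ⟪N, z.1⟫ + ⟪Y, z.1⟫ * ⟪N, z.2⟫)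
      + axialInner Z z.2 z.2 * (⟪Y, z.1⟫ * ⟪N, z.1⟫)
      + m * (⟪Y, z.1⟫ / axialRadius Z z.1))

variable {n : ℕ} {a : ℝ}

/-- The unit vector `(0, …, 0, 1, a) / √(1 + a²)`, orthogonal to the first center. -/
def axisVector (n : ℕ) (a : ℝ) : Ambient n :=
  (√(1 + a ^ 2))⁻¹ • (EuclideanSpace.single (yIdx n) 1 + EuclideanSpace.single (zIdx n) a)

/-- The north pole `(0, …, 0, 1)`. -/
def northPole (n : ℕ) : Ambient n := EuclideanSpace.single (zIdx n) 1

lemma inner_axisVector (q : Ambient n) :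
    ⟪axisVector n a, q⟫ = (√(1 + a ^ 2))⁻¹ * (q (yIdx n) + a * q (zIdx n)) := by
  simp [axisVector, inner_add_left, real_inner_smul_left, EuclideanSpace.inner_single_left, mul_add]

lemma inner_center₁ (q : Ambient n) :
    ⟪center₁ n a, q⟫ = (√(1 + a ^ 2))⁻¹ * (a * q (yIdx n) - q (zIdx n)) := by
  simp [center₁, southPole, inner_add_left, real_inner_smul_left,
    EuclideanSpace.inner_single_left, sub_eq_add_neg, mul_add]

lemma inner_northPole (q : Ambient n) : ⟪northPole n, q⟫ = q (zIdx n) := by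
  simp [northPole, EuclideanSpace.inner_single_left]

lemma axisVector_apply_yIdx : axisVector n a (yIdx n) = (√(1 + a ^ 2))⁻¹ := by
  simp [axisVector, yIdx_ne_zIdx n]

lemma axisVector_apply_zIdx : axisVector n a (zIdx n) = (√(1 + a ^ 2))⁻¹ * a := by
  simp [axisVector, (yIdx_ne_zIdx n).symm]

lemma sqrt_one_add_sq (a : ℝ) : √(1 + a ^ 2) ^ 2 = 1 + a ^ 2 := Real.sq_sqrt (by positivity)

lemma inner_center₁_axisVector : ⟪center₁ n a, axisVector n a⟫ = 0 := by
  rw [inner_center₁, axisVector_apply_yIdx, axisVector_apply_zIdx]; ring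

lemma inner_axisVector_self : ⟪axisVector n a, axisVector n a⟫ = 1 := by
  have hs : 0 < √(1 + a ^ 2) := by positivity
  have h2 := sqrt_one_add_sq a
  rw [inner_axisVector, axisVector_apply_yIdx, axisVector_apply_zIdx]
  field_simp
  linear_combination -h2

/-- In the orthonormal frame Y, Z of the plane of the centers, N = hY - kZ with h = a/√(1 + a²), k =
1/√(1 + a²) and h² + k² = 1. The flow computations use the geometry only in this form. -/
lemma northPole_eq : northPole n = (a / √(1 + a ^ 2)) • axisVector n a
    - (√(1 + a ^ 2))⁻¹ • center₁ n a := by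
  have hs : 0 < √(1 + a ^ 2) := by positivity
  have h2 := sqrt_one_add_sq a
  refine ext_inner_right ℝ fun q => ?_
  rw [inner_sub_left, real_inner_smul_left, real_inner_smul_left, inner_northPole,
    inner_axisVector, inner_center₁]
  field_simp
  linear_combination q (zIdx n) * h2

/-- The second center is the reflection of Z in the polar axis, 2⟪N, Z⟫N - Z = (1 - 2h²)Z - 2hkY. -/
lemma center₂_eq : center₂ n a = (1 - 2 * (a / √(1 + a ^ 2)) ^ 2) • center₁ n a
    - (2 * (a / √(1 + a ^ 2)) / √(1 + a ^ 2)) • axisVector n a := by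
  have hs : 0 < √(1 + a ^ 2) := by positivity
  have h2 := sqrt_one_add_sq a
  refine ext_inner_right ℝ fun q => ?_
  rw [inner_sub_left, real_inner_smul_left, real_inner_smul_left, center₂, inner_center₁,
    inner_axisVector, inner_center₁, neg_sq]
  field_simp
  linear_combination (-2 * a * q (yIdx n)) * h2

/-- The coordinates of the component of `q` orthogonal to the first center. -/
def axialCoord (a : ℝ) (q : Ambient n) (i : Fin (n + 1)) : ℝ :=
  if i = Fin.last n then ⟪axisVector n a, q⟫ else q i.castSucc

/-- The x-directions and Y form an orthonormal basis of the orthogonal complement of Z. -/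
lemma sum_axialCoord_mul (q p : Ambient n) :
    ∑ i, axialCoord a q i * axialCoord a p i = axialInner (center₁ n a) q p := by
  have hs : 0 < √(1 + a ^ 2) := by positivity
  have h2 := sqrt_one_add_sq a
  have hl : ∀ i : Fin n, i.castSucc ≠ Fin.last n := fun i => (Fin.castSucc_lt_last i).ne
  rw [Fin.sum_univ_castSucc]
  simp only [axialCoord, hl, if_false, if_true, axialInner, inner_axisVector, inner_center₁]
  rw [PiLp.inner_apply, Fin.sum_univ_castSucc, Fin.sum_univ_castSucc]
  simp only [RCLike.inner_apply, conj_trivial]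
  rw [show (Fin.last n).castSucc = yIdx n from rfl, show Fin.last (n + 1) = zIdx n from rfl]
  simp only [mul_comm (p.ofLp _) (q.ofLp _)]
  field_simp
  linear_combination (-q (yIdx n) * p (yIdx n) - q (zIdx n) * p (zIdx n)) * h2

/-- This is why the affine coordinates (ξ, η) are adapted to the first center: they are the
coordinates of the part of q orthogonal to Z, divided by -z. -/
lemma euclPosition_apply {q : Ambient n} (hq : q (zIdx n) ≠ 0) (i : Fin (n + 1)) :
    euclPosition a q i = -(q (zIdx n))⁻¹ * axialCoord a q i := by
  have hs : 0 < √(1 + a ^ 2) := by positivity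
  simp only [euclPosition, centralProjection, axialCoord, inner_axisVector]
  split_ifs with h
  · subst h
    rw [show (Fin.last n).castSucc = yIdx n from rfl]
    field_simp
    ring
  · field_simp

lemma fderiv_euclPosition_apply {q : Ambient n} (hq : q (zIdx n) ≠ 0) (v : Ambient n)
    (i : Fin (n + 1)) :
    fderiv ℝ (euclPosition a) q v i = ((q (zIdx n)) ^ 2)⁻¹ *
      (axialCoord a q i * v (zIdx n) - axialCoord a v i * q (zIdx n)) := by
  have hs : 0 < √(1 + a ^ 2) := by positivity
  have hco : ∀ j : Fin (n + 2), DifferentiableAt ℝ (fun q : Ambient n => q j) q := fun j => by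
    fun_prop
  have hd : DifferentiableAt ℝ (euclPosition a) q := by
    rw [differentiableAt_euclidean]
    intro j
    simp only [euclPosition, centralProjection]
    split_ifs
    · simp only [div_eq_mul_inv]
      exact ((((hco _).neg.mul ((hco _).inv hq))).sub_const _).mul_const _
    · simp only [div_eq_mul_inv]
      exact (hco _).neg.mul ((hco _).inv hq)
  have hdi : DifferentiableAt ℝ (fun q => euclPosition a q i) q := differentiableAt_euclidean.1 hd i
  have e1 : fderiv ℝ (euclPosition a) q v i = fderiv ℝ (fun q => euclPosition a q i) q v := by
    have := (EuclideanSpace.proj i : Chart n →L[ℝ] ℝ).hasFDerivAt.comp q hd.hasFDerivAt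
    exact (congrArg (fun L => L v) this.fderiv).symm
  have hline : HasDerivAt (fun t : ℝ => q + t • v) v 0 := by
    simpa using ((hasDerivAt_id (0 : ℝ)).smul_const v).const_add q
  have h0 : q + (0 : ℝ) • v = q := by simp
  have h1 := HasFDerivAt.comp_hasDerivAt (0 : ℝ) (by rw [h0]; exact hdi.hasFDerivAt) hline
  have hcl : ∀ j : Fin (n + 2), HasDerivAt (fun t : ℝ => (q + t • v) j) (v j) 0 := fun j => by
    simpa using ((hasDerivAt_id (0 : ℝ)).mul_const (v j)).const_add (q j)
  have hz0 : (q + (0 : ℝ) • v) (zIdx n) ≠ 0 := by rwa [h0]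
  rw [e1]
  have h2 : HasDerivAt (fun t : ℝ => -((q + t • v) i.castSucc) / ((q + t • v) (zIdx n)))
      ((-v i.castSucc * q (zIdx n) + q i.castSucc * v (zIdx n)) / q (zIdx n) ^ 2) 0 := by
    refine ((hcl i.castSucc).neg.div (hcl (zIdx n)) hz0).congr_deriv ?_
    simp
  by_cases h : i = Fin.last n
  · have h3 := (h2.sub_const a).div_const √(1 + a ^ 2)
    have e2 : ((fun q => euclPosition a q i) ∘ fun t : ℝ => q + t • v) = fun t : ℝ =>
        (-((q + t • v) i.castSucc) / ((q + t • v) (zIdx n)) - a) / √(1 + a ^ 2) := by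
      funext t
      simp [euclPosition, centralProjection, h]
    rw [e2] at h1
    rw [h1.unique h3]
    subst h
    simp only [axialCoord, if_true, inner_axisVector]
    rw [show (Fin.last n).castSucc = yIdx n from rfl]
    field_simp
    ring
  · have e2 : ((fun q => euclPosition a q i) ∘ fun t : ℝ => q + t • v) = fun t : ℝ =>
        -((q + t • v) i.castSucc) / ((q + t • v) (zIdx n)) := by
      funext t
      simp [euclPosition, centralProjection, h]
    rw [e2] at h1
    rw [h1.unique h2]
    simp only [axialCoord, h, if_false]
    field_simp
    ring

lemma one_add_norm_centralProjection_sq {q : Ambient n} (h1 : ‖q‖ = 1) (hq : q (zIdx n) ≠ 0) :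
    1 + ‖centralProjection q‖ ^ 2 = (q (zIdx n) ^ 2)⁻¹ := by
  have e : ‖q‖ ^ 2 = ∑ i : Fin (n + 1), q i.castSucc ^ 2 + q (zIdx n) ^ 2 := by
    rw [EuclideanSpace.real_norm_sq_eq, Fin.sum_univ_castSucc]; rfl
  have e2 : ‖centralProjection q‖ ^ 2
      = (q (zIdx n) ^ 2)⁻¹ * ∑ i : Fin (n + 1), q i.castSucc ^ 2 := by
    rw [EuclideanSpace.real_norm_sq_eq, Finset.mul_sum]
    refine Finset.sum_congr rfl fun i _ => ?_
    simp only [centralProjection]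
    field_simp
  rw [h1] at e
  rw [e2]
  field_simp
  linear_combination -e

/-- On the unit sphere the time-change factor is z², which cancels the denominator of the derivative
of the projection. -/
lemma euclVelocity_apply {q : Ambient n} (h1 : ‖q‖ = 1) (hq : q (zIdx n) ≠ 0) (v : Ambient n)
    (i : Fin (n + 1)) :
    euclVelocity a q v i = axialCoord a q i * v (zIdx n) - axialCoord a v i * q (zIdx n) := by
  rw [euclVelocity, PiLp.smul_apply, fderiv_euclPosition_apply hq,
    one_add_norm_centralProjection_sq h1 hq, smul_eq_mul]
  field_simp

/-- Lagrange's identity: the summand is symmetric and zero on the diagonal, so the sum over i < j is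
half the full double sum. -/
lemma sum_sq_mul_sum_sq_sub {ι : Type*} [Fintype ι] [LinearOrder ι] [LocallyFiniteOrderTop ι]
    [LocallyFiniteOrderBot ι] (P W : ι → ℝ) :
    ∑ i, ∑ j ∈ Finset.Ioi i, (P i * W j - P j * W i) ^ 2
      = (∑ i, P i * P i) * (∑ i, W i * W i) - (∑ i, P i * W i) ^ 2 := by
  have hsplit : ∀ F : ι → ι → ℝ, (∀ i, F i i = 0) → (∀ i j, F i j = F j i) →
      ∑ i, ∑ j, F i j = 2 * ∑ i, ∑ j ∈ Finset.Ioi i, F i j := by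
    intro F h0 hs
    have e1 : ∀ i, ∑ j, F i j = ∑ j ∈ Finset.Ioi i, F i j + ∑ j ∈ Finset.Iio i, F i j := by
      intro i
      rw [← Finset.sum_filter_add_sum_filter_not Finset.univ (fun j => i < j)]
      congr 1
      · exact Finset.sum_congr (by ext; simp) fun _ _ => rfl
      · symm
        refine Finset.sum_subset (fun j => by simp; exact le_of_lt) fun j hj hj' => ?_
        simp at hj hj'
        rw [le_antisymm hj hj', h0]
    have e2 : ∑ i, ∑ j ∈ Finset.Iio i, F i j = ∑ i, ∑ j ∈ Finset.Ioi i, F i j := by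
      rw [Finset.sum_comm' (t' := Finset.univ) (s' := fun j => Finset.Ioi j) (by simp)]
      exact Finset.sum_congr rfl fun i _ => Finset.sum_congr rfl fun j _ => hs _ _
    rw [Finset.sum_congr rfl fun i _ => e1 i, Finset.sum_add_distrib, e2]
    ring
  have h := hsplit (fun i j => (P i * W j - P j * W i) ^ 2) (fun i => by ring)
    (fun i j => by ring)
  have e : ∑ i, ∑ j, (P i * W j - P j * W i) ^ 2
      = 2 * ((∑ i, P i * P i) * (∑ i, W i * W i) - (∑ i, P i * W i) ^ 2) := by
    have : ∀ i j, (P i * W j - P j * W i) ^ 2 = (P i * P i) * (W j * W j)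
        + (W i * W i) * (P j * P j) - 2 * ((P i * W i) * (P j * W j)) := fun i j => by ring
    simp only [this, Finset.sum_sub_distrib, Finset.sum_add_distrib, ← Finset.mul_sum,
      ← Finset.sum_mul]
    ring
  linarith

/-- D depends on the position and velocity only through their Gram sums and last coordinates. The
Gram sums are combinations of the axial inner products of q and v; the sign z < 0 enters through the
norm of the position. -/
lemma functionD_eq_axialIntegral {m₁ : ℝ} {q v : Ambient n} (h1 : ‖q‖ = 1)
    (hq : q (zIdx n) < 0) (hqr : 0 < axialInner (center₁ n a) q q) :
    functionD a m₁ (q, v) = axialIntegral (axisVector n a) (center₁ n a) (northPole n)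
      (a / √(1 + a ^ 2)) m₁ (q, v) := by
  have hP := euclPosition_apply (a := a) hq.ne
  have hW := euclVelocity_apply (a := a) h1 hq.ne v
  have hr := axialRadius_pos hqr
  have hlast : ∀ u : Ambient n, axialCoord a u (Fin.last n) = ⟪axisVector n a, u⟫ := fun u => by
    simp [axialCoord]
  set A := axialInner (center₁ n a) q q with hA
  set B := axialInner (center₁ n a) q v with hB
  set C := axialInner (center₁ n a) v v with hC
  have hPP : ∑ i, euclPosition a q i * euclPosition a q i = (q (zIdx n) ^ 2)⁻¹ * A := by
    rw [hA, ← sum_axialCoord_mul, Finset.mul_sum]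
    refine Finset.sum_congr rfl fun i _ => ?_
    rw [hP]; field_simp
  have hPW : ∑ i, euclPosition a q i * euclVelocity a q v i
      = -(q (zIdx n))⁻¹ * (v (zIdx n) * A - q (zIdx n) * B) := by
    rw [hA, hB, ← sum_axialCoord_mul, ← sum_axialCoord_mul, Finset.mul_sum, Finset.mul_sum,
      ← Finset.sum_sub_distrib, Finset.mul_sum]
    refine Finset.sum_congr rfl fun i _ => ?_
    rw [hP, hW]; ring
  have hWW : ∑ i, euclVelocity a q v i * euclVelocity a q v i
      = v (zIdx n) ^ 2 * A - 2 * (v (zIdx n) * q (zIdx n)) * B + q (zIdx n) ^ 2 * C := by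
    rw [hA, hB, hC, ← sum_axialCoord_mul, ← sum_axialCoord_mul, ← sum_axialCoord_mul,
      Finset.mul_sum, Finset.mul_sum, Finset.mul_sum,
      ← Finset.sum_sub_distrib, ← Finset.sum_add_distrib]
    refine Finset.sum_congr rfl fun i _ => ?_
    rw [hW]; ring
  have hnorm : ‖euclPosition a q‖ = -(q (zIdx n))⁻¹ * axialRadius (center₁ n a) q := by
    have hneg : 0 < -(q (zIdx n))⁻¹ := by rw [neg_pos]; exact inv_lt_zero.2 hq
    rw [← Real.sqrt_sq (norm_nonneg (euclPosition a q)), EuclideanSpace.real_norm_sq_eq]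
    simp only [sq (euclPosition a q _)]
    rw [hPP, hA, ← axialRadius_sq (norm_center₁ n a), ← inv_pow, ← mul_pow, Real.sqrt_sq_eq_abs,
      abs_mul, abs_of_neg (inv_lt_zero.2 hq), abs_of_pos hr]
  have hLRL : ∑ i, (euclPosition a q i * euclVelocity a q v (Fin.last n)
        - euclPosition a q (Fin.last n) * euclVelocity a q v i) * euclVelocity a q v i
      = euclVelocity a q v (Fin.last n) * ∑ i, euclPosition a q i * euclVelocity a q v i
        - euclPosition a q (Fin.last n) *
          ∑ i, euclVelocity a q v i * euclVelocity a q v i := by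
    rw [Finset.mul_sum, Finset.mul_sum, ← Finset.sum_sub_distrib]
    exact Finset.sum_congr rfl fun i _ => by ring
  have hq0 := hq.ne
  simp only [functionD, angularMomentumSq, laplaceRungeLenz, axialIntegral, axialMomentumSq]
  rw [sum_sq_mul_sum_sq_sub, hLRL, hPP, hPW, hWW, hnorm, hP, hW, hlast, hlast, inner_northPole,
    inner_northPole, ← hA, ← hB, ← hC]
  field_simp
  ring

/-! ### Differentiation under the integral over an orbit -/

section Parametric

variable {E : Type*} [NormedAddCommGroup E] [NormedSpace ℝ E] {F : E × ℝ → ℝ} {x : E} {b c : ℝ}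

lemma hasFDerivAt_partial {t : ℝ} (h : ContDiffAt ℝ 1 F (x, t)) :
    HasFDerivAt (fun y => F (y, t)) ((fderiv ℝ F (x, t)).comp (ContinuousLinearMap.inl ℝ E ℝ)) x :=
  (h.differentiableAt one_ne_zero).hasFDerivAt.comp x (hasFDerivAt_prodMk_left x t)

lemma continuousOn_fderiv_partial (h : ∀ t ∈ Set.uIcc b c, ContDiffAt ℝ 1 F (x, t)) :
    ContinuousOn (fun t => fderiv ℝ (fun y => F (y, t)) x) (Set.uIcc b c) := by
  have h1 : ContinuousOn (fun t => (fderiv ℝ F (x, t)).comp (ContinuousLinearMap.inl ℝ E ℝ))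
      (Set.uIcc b c) := by
    intro t ht
    have h2 : ContinuousAt (fderiv ℝ F) (x, t) :=
      ((h t ht).fderiv_right (m := 0) (by norm_num)).continuousAt
    have h3 : ContinuousAt (fun t => fderiv ℝ F (x, t)) t :=
      ContinuousAt.comp (f := fun t : ℝ => (x, t)) h2 (by fun_prop)
    exact (h3.clm_comp continuousAt_const).continuousWithinAt
  exact h1.congr fun t ht => (hasFDerivAt_partial (h t ht)).fderiv

/-- Compactness of the interval turns smoothness at each point of {x} × [b, c] into a neighborhood
of x on which smoothness and a bound for the derivative are uniform in t. -/
lemma hasFDerivAt_intervalIntegral_of_contDiffAt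
    (h : ∀ t ∈ Set.uIcc b c, ContDiffAt ℝ 1 F (x, t)) :
    HasFDerivAt (fun y => ∫ t in b..c, F (y, t))
      (∫ t in b..c, fderiv ℝ (fun y => F (y, t)) x) x := by
  have hK : IsCompact (Set.uIcc b c) := isCompact_uIcc
  have hev : ∀ᶠ y in nhds x, ∀ t ∈ Set.uIcc b c, ContDiffAt ℝ 1 F (y, t) :=
    hK.eventually_forall_of_forall_eventually (P := fun y t => ContDiffAt ℝ 1 F (y, t))
      fun t ht => (h t ht).eventually (by simp)
  have hcd : ∀ t ∈ Set.uIcc b c, ContinuousAt (fun p => ‖fderiv ℝ F p‖) (x, t) := fun t ht =>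
    ((h t ht).fderiv_right (m := 0) (by norm_num)).continuousAt.norm
  obtain ⟨C, hC⟩ : ∃ C, ∀ t ∈ Set.uIcc b c, ‖fderiv ℝ F (x, t)‖ ≤ C := by
    have hco : ContinuousOn (fun t => ‖fderiv ℝ F (x, t)‖) (Set.uIcc b c) := fun t ht =>
      (ContinuousAt.comp (f := fun t : ℝ => (x, t)) (hcd t ht)
        (by fun_prop)).continuousWithinAt
    obtain ⟨C, hC⟩ := (hK.bddAbove_image hco)
    exact ⟨C, fun t ht => hC (Set.mem_image_of_mem _ ht)⟩
  have hbd : ∀ᶠ y in nhds x, ∀ t ∈ Set.uIcc b c, ‖fderiv ℝ F (y, t)‖ < C + 1 :=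
    hK.eventually_forall_of_forall_eventually (P := fun y t => ‖fderiv ℝ F (y, t)‖ < C + 1)
      fun t ht => (hcd t ht).eventually_lt continuousAt_const ((hC t ht).trans_lt (lt_add_one C))
  have hcont : ∀ y, (∀ t ∈ Set.uIcc b c, ContDiffAt ℝ 1 F (y, t)) →
      ContinuousOn (fun t => F (y, t)) (Set.uIcc b c) := fun y hy t ht =>
    (ContinuousAt.comp (f := fun t : ℝ => (y, t)) (hy t ht).continuousAt
      (by fun_prop)).continuousWithinAt
  refine intervalIntegral.hasFDerivAt_integral_of_dominated_of_fderiv_le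
    (F := fun y t => F (y, t)) (F' := fun y t => fderiv ℝ (fun y => F (y, t)) y)
    (bound := fun _ => C + 1) (Filter.inter_mem hev hbd) ?_ (hcont x h).intervalIntegrable
    (((continuousOn_fderiv_partial h).mono Set.uIoc_subset_uIcc).aestronglyMeasurable
      measurableSet_uIoc) ?_ intervalIntegrable_const ?_
  · filter_upwards [hev] with y hy
    exact ((hcont y hy).mono Set.uIoc_subset_uIcc).aestronglyMeasurable measurableSet_uIoc
  · refine Filter.Eventually.of_forall fun t ht y hy => ?_
    have ht' := Set.uIoc_subset_uIcc ht
    rw [(hasFDerivAt_partial (hy.1 t ht')).fderiv]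
    refine (ContinuousLinearMap.opNorm_comp_le _ _).trans ?_
    exact (mul_le_of_le_one_right (norm_nonneg _)
      (ContinuousLinearMap.norm_inl_le_one ℝ E ℝ)).trans (hy.2 t ht').le
  · refine Filter.Eventually.of_forall fun t ht y hy => ?_
    exact (hasFDerivAt_partial
      (hy.1 t (Set.uIoc_subset_uIcc ht))).differentiableAt.hasFDerivAt

end Parametric

/-! ### Smooth dependence of the orbit integrals on the initial point. -/

section ConeSmooth

variable {H : Type*} [NormedAddCommGroup H] [InnerProductSpace ℝ H] {Z : H} {M : ℝ} {z : H × H}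
  {m : WithTop ℕ∞}

lemma contDiff_axialMomentumSq (Z : H) : ContDiff ℝ m (axialMomentumSq Z) := by
  unfold axialMomentumSq
  exact (((contDiff_axialInner_self Z).comp contDiff_fst).mul
    ((contDiff_axialInner_self Z).comp contDiff_snd)).sub ((contDiff_axialInner Z).pow 2)

lemma contDiffAt_axialMomentum (hz : 0 < axialMomentumSq Z z) :
    ContDiffAt ℝ m (axialMomentum Z) z :=
  (contDiff_axialMomentumSq Z).contDiffAt.sqrt hz.ne'

lemma contDiffAt_axialRadius_fst (hz : 0 < axialInner Z z.1 z.1) :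
    ContDiffAt ℝ m (fun z : H × H => axialRadius Z z.1) z :=
  (contDiffAt_axialRadius hz).comp z contDiffAt_fst

lemma contDiffAt_conePosition (hz : 0 < axialInner Z z.1 z.1) :
    ContDiffAt ℝ m (conePosition Z) z := by
  unfold conePosition
  exact ((contDiffAt_axialRadius_fst hz).inv (axialRadius_pos hz).ne').smul contDiffAt_fst

lemma contDiffAt_coneVelocity (hz : 0 < axialInner Z z.1 z.1) :
    ContDiffAt ℝ m (coneVelocity Z) z := by
  unfold coneVelocity
  exact ((contDiffAt_axialRadius_fst hz).smul contDiffAt_snd).sub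
    (((contDiff_axialInner Z).contDiffAt.div (contDiffAt_axialRadius_fst hz)
      (axialRadius_pos hz).ne').smul contDiffAt_fst)

lemma contDiffAt_keplerCone_uncurry (hZ : ‖Z‖ = 1) (hz : 0 < axialMomentumSq Z z) (φ : ℝ) :
    ContDiffAt ℝ m (fun p : (H × H) × ℝ => keplerCone Z M p.1 p.2) (z, φ) := by
  have hq := axialInner_self_pos_of_momentum hZ hz
  have hl := axialMomentum_pos hz
  have h1 : ContDiffAt ℝ m (fun p : (H × H) × ℝ => axialMomentum Z p.1) (z, φ) :=
    ContDiffAt.comp (g := axialMomentum Z) (z, φ) (contDiffAt_axialMomentum hz) contDiffAt_fst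
  have h2 : ContDiffAt ℝ m (fun p : (H × H) × ℝ => conePosition Z p.1) (z, φ) :=
    ContDiffAt.comp (z, φ) (contDiffAt_conePosition hq) contDiffAt_fst
  have h3 : ContDiffAt ℝ m (fun p : (H × H) × ℝ => coneVelocity Z p.1) (z, φ) :=
    ContDiffAt.comp (z, φ) (contDiffAt_coneVelocity hq) contDiffAt_fst
  have h4 : ContDiffAt ℝ m (fun p : (H × H) × ℝ => Real.cos p.2) (z, φ) := by fun_prop
  have h5 : ContDiffAt ℝ m (fun p : (H × H) × ℝ => Real.sin p.2) (z, φ) := by fun_prop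
  unfold keplerCone
  exact ((((contDiffAt_const.div (h1.pow 2) (pow_ne_zero 2 hl.ne')).mul
    (contDiffAt_const.sub h4)).smul contDiffAt_const).add (h4.smul h2)).add
      ((h5.div h1 hl.ne').smul h3)

lemma contDiffAt_orbitIntegrand (hZ : ‖Z‖ = 1) (hz : 0 < axialMomentumSq Z z) {U : H → ℝ} {φ : ℝ}
    (hU : ContDiffAt ℝ m U (keplerCone Z M z φ)) :
    ContDiffAt ℝ m (fun p : (H × H) × ℝ => U (keplerCone Z M p.1 p.2) * timeDensity Z M p.1 p.2)
      (z, φ) := by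
  have hl := axialMomentum_pos hz
  have hX := norm_keplerCone_pos hZ M hz φ
  have h1 : ContDiffAt ℝ m (fun p : (H × H) × ℝ => axialMomentum Z p.1) (z, φ) :=
    ContDiffAt.comp (g := axialMomentum Z) (z, φ) (contDiffAt_axialMomentum hz) contDiffAt_fst
  have h2 := contDiffAt_keplerCone_uncurry (M := M) (m := m) hZ hz φ
  refine (ContDiffAt.comp (g := U) (z, φ) hU h2).mul ?_
  unfold timeDensity
  exact (h1.mul (h2.norm_sq ℝ)).inv (by positivity)

lemma hasFDerivAt_orbitIntegral (hZ : ‖Z‖ = 1) (hz : 0 < axialMomentumSq Z z) {U : H → ℝ}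
    (hU : ∀ φ, ContDiffAt ℝ 1 U (keplerCone Z M z φ)) :
    HasFDerivAt (orbitIntegral Z M U) (∫ φ in (0 : ℝ)..2 * Real.pi,
      fderiv ℝ (fun z => U (keplerCone Z M z φ) * timeDensity Z M z φ) z) z :=
  hasFDerivAt_intervalIntegral_of_contDiffAt
    (F := fun p : (H × H) × ℝ => U (keplerCone Z M p.1 p.2) * timeDensity Z M p.1 p.2)
    fun φ _ => contDiffAt_orbitIntegrand hZ hz (hU φ)

lemma orbitIntegral_one_pos (hZ : ‖Z‖ = 1) (hz : 0 < axialMomentumSq Z z) :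
    0 < orbitIntegral Z M (fun _ => 1) z := by
  rw [orbitIntegral]
  simp only [one_mul]
  exact intervalIntegral.intervalIntegral_pos_of_pos
    ((contDiff_timeDensity (m := 0) hZ hz).continuous.intervalIntegrable _ _)
    (timeDensity_pos hZ hz) Real.two_pi_pos

/-- One turn of the cone is compact, so an open condition on it survives perturbation of the orbit;
periodicity covers the other angles. -/
lemma eventually_keplerCone_mem (hZ : ‖Z‖ = 1) (hz : 0 < axialMomentumSq Z z) {S : Set H}
    (hS : IsOpen S) (h : ∀ φ, keplerCone Z M z φ ∈ S) :
    ∀ᶠ y in nhds z, 0 < axialMomentumSq Z y ∧ ∀ φ, keplerCone Z M y φ ∈ S := by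
  have h1 : ∀ᶠ y in nhds z, 0 < axialMomentumSq Z y :=
    ((contDiff_axialMomentumSq (m := 0) Z).continuous.continuousAt).eventually_const_lt hz
  have h2 : ∀ᶠ y in nhds z, ∀ φ ∈ Set.Icc (0 : ℝ) (2 * Real.pi), keplerCone Z M y φ ∈ S :=
    isCompact_Icc.eventually_forall_of_forall_eventually
      (P := fun y φ => keplerCone Z M y φ ∈ S) fun φ _ =>
        (contDiffAt_keplerCone_uncurry (m := 0) hZ hz φ).continuousAt.preimage_mem_nhds
          (hS.mem_nhds (h φ))
  filter_upwards [h1, h2] with y hy1 hy2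
  refine ⟨hy1, fun φ => ?_⟩
  have hp : Function.Periodic (keplerCone Z M y) (2 * Real.pi) := keplerCone_add_two_pi Z M y
  obtain ⟨ψ, hψ, e⟩ := hp.exists_mem_Ico₀ Real.two_pi_pos φ
  rw [e]
  exact hy2 ψ ⟨hψ.1, hψ.2.le⟩

end ConeSmooth

/-! ### The Hamiltonian vector field of `D` -/

section Flow

variable {H : Type*} [NormedAddCommGroup H] [InnerProductSpace ℝ H]

/-- The component of `q` orthogonal to the unit vector `Z`. -/
def axialPart (Z q : H) : H := q - ⟪Z, q⟫ • Z

/-- The position component of the Hamiltonian vector field of `axialIntegral`, at points `(x, y)`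
whose components orthogonal to `Z` are orthogonal, the first being a unit vector. -/
def flowPosition (Y Z N : H) (h : ℝ) (z : H × H) : H :=
  (2 : ℝ) • axialPart Z z.2 - (2 * h) • (⟪N, z.2⟫ • Y + ⟪Y, z.2⟫ • N
    - (⟪Y, z.2⟫ * ⟪N, z.1⟫ + ⟪Y, z.1⟫ * ⟪N, z.2⟫) • axialPart Z z.1
    + (2 * (⟪Y, z.1⟫ * ⟪N, z.1⟫)) • axialPart Z z.2)

/-- The momentum component of the Hamiltonian vector field of `axialIntegral`, at points `(x, y)`
whose components orthogonal to `Z` are orthogonal, the first being a unit vector. -/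
def flowMomentum (Y Z N : H) (h m : ℝ) (z : H × H) : H :=
  -(2 * axialInner Z z.2 z.2) • axialPart Z z.1 + (2 * h) • ((2 * (⟪Y, z.2⟫ * ⟪N, z.2⟫)) •
      axialPart Z z.1
    - (⟪Y, z.2⟫ * ⟪N, z.1⟫ + ⟪Y, z.1⟫ * ⟪N, z.2⟫) • axialPart Z z.2
    + axialInner Z z.2 z.2 • (⟪N, z.1⟫ • Y + ⟪Y, z.1⟫ • N)
    + m • (Y - ⟪Y, z.1⟫ • axialPart Z z.1))

variable {Y Z N : H} {h m M k ℓ : ℝ} {z δ : H × H}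

lemma hasDerivAt_line_fst (z δ : H × H) : HasDerivAt (fun ε : ℝ => (z + ε • δ).1) δ.1 0 := by
  simpa using ((hasDerivAt_id (0 : ℝ)).smul_const δ.1).const_add z.1

lemma hasDerivAt_line_snd (z δ : H × H) : HasDerivAt (fun ε : ℝ => (z + ε • δ).2) δ.2 0 := by
  simpa using ((hasDerivAt_id (0 : ℝ)).smul_const δ.2).const_add z.2

lemma hasDerivAt_line (z δ : H × H) : HasDerivAt (fun ε : ℝ => z + ε • δ) δ 0 := by
  simpa using ((hasDerivAt_id (0 : ℝ)).smul_const δ).const_add z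

lemma inner_axialPart_left (Z q p : H) : ⟪axialPart Z q, p⟫ = axialInner Z q p := by
  rw [axialPart, axialInner, inner_sub_left, real_inner_smul_left]

/-- The restriction to normalized points costs nothing, since `rescale` moves every point off the
axis to such a point. -/
lemma hasDerivAt_axialIntegral_line (hx : axialInner Z z.1 z.1 = 1)
    (hxy : axialInner Z z.1 z.2 = 0) :
    HasDerivAt (fun ε : ℝ => axialIntegral Y Z N h m (z + ε • δ))
      (⟪-flowMomentum Y Z N h m z, δ.1⟫ + ⟪flowPosition Y Z N h z, δ.2⟫) 0 := by
  have hq := hasDerivAt_line_fst z δ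
  have hp := hasDerivAt_line_snd z δ
  have h0 : z + (0 : ℝ) • δ = z := by simp
  have hr : axialRadius Z z.1 = 1 := by rw [axialRadius, hx, Real.sqrt_one]
  have hqq := hasDerivAt_axialInner Z hq hq
  have hqp := hasDerivAt_axialInner Z hq hp
  have hpp := hasDerivAt_axialInner Z hp hp
  have hrad := hasDerivAt_axialRadius Z hq (by rw [h0, hx]; exact one_pos)
  have hYq := (hasDerivAt_const (0 : ℝ) Y).inner ℝ hq
  have hYp := (hasDerivAt_const (0 : ℝ) Y).inner ℝ hp
  have hNq := (hasDerivAt_const (0 : ℝ) N).inner ℝ hq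
  have hNp := (hasDerivAt_const (0 : ℝ) N).inner ℝ hp
  refine (((hqq.mul hpp).sub (hqp.pow 2)).sub (((((hqq.mul (hYp.mul hNp)).sub
    (hqp.mul ((hYp.mul hNq).add (hYq.mul hNp)))).add (hpp.mul (hYq.mul hNq))).add
      ((hYq.div hrad (by rw [h0, hr]; exact one_ne_zero)).const_mul m)).const_mul
        (2 * h))).congr_deriv ?_
  simp only [Pi.mul_apply, Pi.add_apply, h0, hr, hx, hxy, inner_zero_left, add_zero]
  simp only [flowMomentum, flowPosition, inner_add_left, inner_sub_left, inner_neg_left,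
    real_inner_smul_left, inner_axialPart_left, axialInner_comm Z δ.1, axialInner_comm Z δ.2]
  ring

variable {x e : H}

/-- The energy of the Kepler problem in homogeneous coordinates. -/
def axialEnergy (Z : H) (M : ℝ) (z : H × H) : ℝ :=
  (⟪z.1, z.1⟫ * ⟪z.2, z.2⟫ - ⟪z.1, z.2⟫ ^ 2) / 2 - M * (⟪Z, z.1⟫ / axialRadius Z z.1)

lemma inner_eq_axialInner_add (Z q p : H) : ⟪q, p⟫ = axialInner Z q p + ⟪Z, q⟫ * ⟪Z, p⟫ := by
  rw [axialInner]; ring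

lemma axialInner_axialPart_right (hZ : ‖Z‖ = 1) (q p : H) :
    axialInner Z q (axialPart Z p) = axialInner Z q p := by
  rw [axialPart, axialInner_sub_right, axialInner_smul_right, axialInner_axis_right hZ]; ring

lemma inner_axialPart_axis (hZ : ‖Z‖ = 1) (q : H) : ⟪Z, axialPart Z q⟫ = 0 := by
  rw [axialPart, inner_sub_right, real_inner_smul_right, real_inner_self_eq_norm_sq, hZ]; ring

lemma axialInner_axisVector (hYZ : ⟪Z, Y⟫ = 0) (q : H) : axialInner Z q Y = ⟪Y, q⟫ := by
  rw [axialInner, hYZ, mul_zero, sub_zero, real_inner_comm]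

/-- `D` is a first integral of the Kepler problem. -/
lemma hasDerivAt_axialEnergy_flow (hZ : ‖Z‖ = 1) (hYZ : ⟪Z, Y⟫ = 0) (hN : N = h • Y - k • Z)
    (hx : axialInner Z x x = 1) (hxe : axialInner Z x e = 0) (he : axialInner Z e e = 1)
    (hm : m = M * k) :
    HasDerivAt (fun ε : ℝ => axialEnergy Z M ((x, ℓ • e) + ε •
      (flowPosition Y Z N h (x, ℓ • e), flowMomentum Y Z N h m (x, ℓ • e)))) 0 0 := by
  set z : H × H := (x, ℓ • e) with hz
  set δ : H × H := (flowPosition Y Z N h z, flowMomentum Y Z N h m z) with hδ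
  have hq := hasDerivAt_line_fst z δ
  have hp := hasDerivAt_line_snd z δ
  have h0 : z + (0 : ℝ) • δ = z := by simp
  have hr : axialRadius Z z.1 = 1 := by rw [axialRadius, hx, Real.sqrt_one]
  have hrad := hasDerivAt_axialRadius Z hq (by rw [h0, hx]; exact one_pos)
  have hZq := (hasDerivAt_const (0 : ℝ) Z).inner ℝ hq
  refine (((((hq.inner ℝ hq).mul (hp.inner ℝ hp)).sub ((hq.inner ℝ hp).pow 2)).div_const 2).sub
    ((hZq.div hrad (by rw [h0, hr]; exact one_ne_zero)).const_mul M)).congr_deriv ?_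
  have hex : axialInner Z e x = 0 := by rw [axialInner_comm, hxe]
  simp only [h0, hr, inner_zero_left, add_zero]
  simp only [inner_eq_axialInner_add Z δ.1, inner_eq_axialInner_add Z δ.2,
    inner_eq_axialInner_add Z z.1, inner_eq_axialInner_add Z z.2, axialInner_comm Z δ.1,
    axialInner_comm Z δ.2]
  simp only [hδ, hz, flowPosition, flowMomentum, hN, inner_add_right, inner_sub_right,
    inner_sub_left, real_inner_smul_left,
    real_inner_smul_right, axialInner_add_right, axialInner_sub_right, axialInner_smul_right,
    axialInner_smul_left, axialInner_axialPart_right hZ, inner_axialPart_axis hZ, hYZ,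
    axialInner_axisVector hYZ, axialInner_axis_right hZ, hx, hxe, hex, he,
    real_inner_self_eq_norm_sq, hZ, hm]
  ring

end Flow

/-! ### The variation of the Kepler orbits under the flow of `D` -/

section Variation

variable {H : Type*} [NormedAddCommGroup H] [InnerProductSpace ℝ H]
  {Y Z N x e : H} {h m M k ℓ : ℝ}

lemma axialMomentumSq_normalized (hx : axialInner Z x x = 1) (hxe : axialInner Z x e = 0)
    (he : axialInner Z e e = 1) : axialMomentumSq Z (x, ℓ • e) = ℓ ^ 2 := by
  simp only [axialMomentumSq, axialInner_smul_left, axialInner_smul_right, hx, hxe, he]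
  ring

lemma axialMomentum_normalized (hx : axialInner Z x x = 1) (hxe : axialInner Z x e = 0)
    (he : axialInner Z e e = 1) (hℓ : 0 < ℓ) : axialMomentum Z (x, ℓ • e) = ℓ := by
  rw [axialMomentum, axialMomentumSq_normalized hx hxe he, Real.sqrt_sq hℓ.le]

lemma conePosition_normalized (hx : axialInner Z x x = 1) (y : H) : conePosition Z (x, y) = x := by
  simp [conePosition, axialRadius, hx]

lemma coneVelocity_normalized (hx : axialInner Z x x = 1) (hxe : axialInner Z x e = 0) :
    coneVelocity Z (x, ℓ • e) = ℓ • e := by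
  simp [coneVelocity, axialRadius, hx, hxe, axialInner_smul_right]

lemma keplerCone_normalized (hx : axialInner Z x x = 1) (hxe : axialInner Z x e = 0)
    (he : axialInner Z e e = 1) (hℓ : 0 < ℓ) (φ : ℝ) :
    keplerCone Z M (x, ℓ • e) φ = (M / ℓ ^ 2 * (1 - Real.cos φ)) • Z + Real.cos φ • x
      + Real.sin φ • e := by
  rw [keplerCone, conePosition_normalized hx, coneVelocity_normalized hx hxe,
    axialMomentum_normalized hx hxe he hℓ, smul_smul, div_mul_cancel₀ _ hℓ.ne']

lemma keplerConeDeriv_normalized (hx : axialInner Z x x = 1) (hxe : axialInner Z x e = 0)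
    (he : axialInner Z e e = 1) (hℓ : 0 < ℓ) (φ : ℝ) :
    keplerConeDeriv Z M (x, ℓ • e) φ = (M / ℓ ^ 2 * Real.sin φ) • Z - Real.sin φ • x
      + Real.cos φ • e := by
  rw [keplerConeDeriv, conePosition_normalized hx, coneVelocity_normalized hx hxe,
    axialMomentum_normalized hx hxe he hℓ, smul_smul, div_mul_cancel₀ _ hℓ.ne']

/-! ### Directional derivatives of the cone data at a normalized point. -/

section Line

variable {δ : H × H}

lemma hasDerivAt_axialMomentum_line (hx : axialInner Z x x = 1) (hxe : axialInner Z x e = 0)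
    (he : axialInner Z e e = 1) (hℓ : 0 < ℓ) :
    HasDerivAt (fun ε : ℝ => axialMomentum Z ((x, ℓ • e) + ε • δ))
      (ℓ * axialInner Z x δ.1 + axialInner Z e δ.2) 0 := by
  set z : H × H := (x, ℓ • e) with hz
  have hq := hasDerivAt_line_fst z δ
  have hp := hasDerivAt_line_snd z δ
  have h0 : z + (0 : ℝ) • δ = z := by simp
  have hsq : axialMomentumSq Z (z + (0 : ℝ) • δ) = ℓ ^ 2 := by
    rw [h0, hz, axialMomentumSq_normalized hx hxe he]
  have hd : HasDerivAt (fun ε : ℝ => axialMomentumSq Z (z + ε • δ)) _ 0 :=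
    ((hasDerivAt_axialInner Z hq hq).mul (hasDerivAt_axialInner Z hp hp)).sub
      ((hasDerivAt_axialInner Z hq hp).pow 2)
  refine (hd.sqrt (by rw [hsq]; positivity)).congr_deriv ?_
  rw [hsq, Real.sqrt_sq hℓ.le]
  simp only [h0]
  simp only [hz, axialInner_comm Z δ.1, axialInner_comm Z δ.2, axialInner_smul_left,
    axialInner_smul_right, hx, hxe, he]
  field_simp
  ring

lemma hasDerivAt_conePosition_line (hx : axialInner Z x x = 1) (y : H) :
    HasDerivAt (fun ε : ℝ => conePosition Z ((x, y) + ε • δ))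
      (δ.1 - axialInner Z x δ.1 • x) 0 := by
  have hq := hasDerivAt_line_fst (x, y) δ
  have h0 : (x, y) + (0 : ℝ) • δ = (x, y) := by simp
  have hr : axialRadius Z x = 1 := by rw [axialRadius, hx, Real.sqrt_one]
  have hrad := hasDerivAt_axialRadius Z hq (by rw [h0, hx]; exact one_pos)
  refine ((hrad.inv (by rw [h0, hr]; exact one_ne_zero)).smul hq).congr_deriv ?_
  simp only [Pi.inv_apply, h0, hr]
  module

lemma hasDerivAt_coneVelocity_line (hx : axialInner Z x x = 1) (hxe : axialInner Z x e = 0) :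
    HasDerivAt (fun ε : ℝ => coneVelocity Z ((x, ℓ • e) + ε • δ))
      ((ℓ * axialInner Z x δ.1) • e + δ.2
        - (ℓ * axialInner Z e δ.1 + axialInner Z x δ.2) • x) 0 := by
  set z : H × H := (x, ℓ • e) with hz
  have hq := hasDerivAt_line_fst z δ
  have hp := hasDerivAt_line_snd z δ
  have h0 : z + (0 : ℝ) • δ = z := by simp
  have hr : axialRadius Z x = 1 := by rw [axialRadius, hx, Real.sqrt_one]
  have hrad := hasDerivAt_axialRadius Z hq (by rw [h0, hx]; exact one_pos)
  refine ((hrad.smul hp).sub (((hasDerivAt_axialInner Z hq hp).div hrad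
    (by rw [h0, hr]; exact one_ne_zero)).smul hq)).congr_deriv ?_
  simp only [Pi.div_apply, h0]
  simp only [hz, hr, axialInner_smul_left, axialInner_smul_right, hxe, axialInner_comm Z δ.1]
  match_scalars <;> ring

lemma hasDerivAt_keplerCone_line (hx : axialInner Z x x = 1) (hxe : axialInner Z x e = 0)
    (he : axialInner Z e e = 1) (hℓ : 0 < ℓ) (φ : ℝ) :
    HasDerivAt (fun ε : ℝ => keplerCone Z M ((x, ℓ • e) + ε • δ) φ)
      ((-2 * (M / ℓ ^ 2) * (axialInner Z x δ.1 + axialInner Z e δ.2 / ℓ) * (1 - Real.cos φ)) • Z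
        + Real.cos φ • (δ.1 - axialInner Z x δ.1 • x)
        + Real.sin φ • (ℓ⁻¹ • δ.2 - (axialInner Z e δ.1 + axialInner Z x δ.2 / ℓ) • x
          - (axialInner Z e δ.2 / ℓ) • e)) 0 := by
  have h0 : ((x, ℓ • e) : H × H) + (0 : ℝ) • δ = (x, ℓ • e) := by simp
  have hl := hasDerivAt_axialMomentum_line (δ := δ) hx hxe he hℓ
  have hl0 : axialMomentum Z ((x, ℓ • e) + (0 : ℝ) • δ) = ℓ := by
    rw [h0, axialMomentum_normalized hx hxe he hℓ]
  have hv0 : coneVelocity Z ((x, ℓ • e) + (0 : ℝ) • δ) = ℓ • e := by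
    rw [h0, coneVelocity_normalized hx hxe]
  have h1 := ((((hasDerivAt_const (0 : ℝ) M).div (hl.pow 2)
    (by rw [Pi.pow_apply, hl0]; positivity)).mul_const (1 - Real.cos φ)).smul_const Z)
  have h2 := (hasDerivAt_conePosition_line (δ := δ) hx (ℓ • e)).const_smul (Real.cos φ)
  have h3 := ((hasDerivAt_const (0 : ℝ) (Real.sin φ)).div hl
    (by rw [hl0]; exact hℓ.ne')).smul (hasDerivAt_coneVelocity_line (δ := δ) (ℓ := ℓ) hx hxe)
  refine ((h1.add h2).add h3).congr_deriv ?_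
  simp only [Pi.pow_apply, Pi.div_apply, hl0, hv0]
  match_scalars <;> field_simp <;> ring

end Line

/-- The vector identity behind the deformation of Kepler orbits by the flow of `D`. -/
lemma cone_deformation_identity {κ c sn w₀ w₁ y₁ y₂ : ℝ} (hcs : sn ^ 2 + c ^ 2 = 1) (x e Y Z : H)
    {w w' u u' A B A₀ B₀ : ℝ} (hw : w = κ * (1 - c) + c * w₀ + sn * w₁)
    (hw' : w' = κ * sn - sn * w₀ + c * w₁) (hu : u = c * y₁ + sn * y₂)
    (hu' : u' = c * y₂ - sn * y₁) (hA : A = h * u - k * w) (hB : B = h * u' - k * w')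
    (hA₀ : A₀ = h * y₁ - k * w₀) (hB₀ : B₀ = h * y₂ - k * w₁)
    {X X' : H} (hX : X = (κ * (1 - c)) • Z + c • x + sn • e)
    (hX' : X' = (κ * sn) • Z - sn • x + c • e) :
    (-2 * κ * (h * k * (y₁ * w₁ - y₂ * (w₀ - κ))) * (1 - c)) • Z
      + c • ((e - w₁ • Z) - h • (B₀ • Y + y₂ • (h • Y - k • Z) - (y₂ * A₀ + y₁ * B₀) • (x - w₀ • Z)
          + (2 * (y₁ * A₀)) • (e - w₁ • Z)) + (h * k * y₂ * w₀) • x)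
      + sn • (-(h * k * y₂ * w₀) • e
          + (-(x - w₀ • Z) + h • ((2 * (y₂ * B₀)) • (x - w₀ • Z)
            - (y₂ * A₀ + y₁ * B₀) • (e - w₁ • Z) + (A₀ • Y + y₁ • (h • Y - k • Z)))
            + (h * k * κ) • (Y - y₁ • (x - w₀ • Z)))
          - ((1 - h * (2 * h * y₂ ^ 2 - w₁ * y₂ * k + 2 * h * y₁ ^ 2 - 2 * y₁ * w₀ * k))
            + (-1 + h * (2 * (y₂ * B₀) + A₀ * y₁ + h * y₁ ^ 2))) • x
          - (h * k * (y₁ * w₁ - y₂ * (w₀ - κ))) • e)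
    = ((X' - w' • Z) - h • (B • Y + u' • (h • Y - k • Z) - (u' * A + u * B) • (X - w • Z)
          + (2 * (u * A)) • (X' - w' • Z)))
      + (h * k * u' * w) • X
      - (h * k * (w' * u' + 2 * w * u - w₁ * y₂ - 2 * w₀ * y₁)) • X' := by
  rw [hX, hX']
  -- The coefficients of the four vectors are compared; each identity holds modulo sn² + c² = 1.
  match_scalars
  all_goals subst hA hB hA₀ hB₀
  all_goals subst hw hw' hu hu'
  · linear_combination (c * h * k * w₀ * w₁ * y₁ + 2 * c * h * k * w₀ * y₂ * κ
      - c * h * k * w₀ ^ 2 * y₂ - 2 * c * h * k * w₁ * y₁ * κ - c * h * k * y₂ * κ ^ 2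
      + 2 * c * h ^ 2 * w₀ * y₁ * y₂ - 2 * c * h ^ 2 * w₁ * y₁ ^ 2 - h * k * sn * w₀ * w₁ * y₂
      + h * k * sn * w₀ * y₁ * κ + h * k * sn * w₁ * y₂ * κ + h * k * sn * w₁ ^ 2 * y₁
      - h * k * sn * y₁ * κ ^ 2 - 2 * h * k * w₀ * y₂ * κ + 2 * h * k * w₁ * y₁ * κ
      + 2 * h * k * y₂ * κ ^ 2 + 2 * h ^ 2 * sn * w₀ * y₂ ^ 2
      - 2 * h ^ 2 * sn * w₁ * y₁ * y₂) * hcs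
  · linear_combination (c * h * k * w₁ * y₂ + 2 * c * h ^ 2 * y₁ ^ 2 - h * k * sn * w₀ * y₂
      + h * k * sn * y₂ * κ + 2 * h ^ 2 * sn * y₁ * y₂) * hcs
  · ring
  · linear_combination (c * h * k * w₁ * y₁ - 2 * c * h ^ 2 * y₁ * y₂ - h * k * sn * w₀ * y₁
      + h * k * sn * y₁ * κ - 2 * h ^ 2 * sn * y₂ ^ 2) * hcs

/-- The rate at which the flow of `D` shifts the angle about the axis, up to a constant. -/
def angleShift (Y Z : H) (h k ℓ : ℝ) (X X' : H) : ℝ :=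
  2 * ℓ * (h * k * (⟪Z, X'⟫ * ⟪Y, X'⟫ + 2 * ⟪Z, X⟫ * ⟪Y, X⟫))

/-- The flow of D need not preserve the distance to the axis; this component is what the radial term
in `hasDerivAt_keplerCone_flow` compensates. -/
lemma axialInner_flowPosition_left (hZ : ‖Z‖ = 1) (hYZ : ⟪Z, Y⟫ = 0) (hN : N = h • Y - k • Z)
    (hx : axialInner Z x x = 1) (hxe : axialInner Z x e = 0) :
    axialInner Z x (flowPosition Y Z N h (x, ℓ • e)) = -(2 * ℓ) * (h * k * ⟪Y, e⟫ * ⟪Z, x⟫) := by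
  simp only [flowPosition, hN, inner_sub_left, real_inner_smul_left, real_inner_smul_right,
    axialInner_add_right, axialInner_sub_right, axialInner_smul_right,
    axialInner_axialPart_right hZ, axialInner_axisVector hYZ, axialInner_axis_right hZ, hx, hxe]
  ring

lemma axialInner_flowPosition_right (hZ : ‖Z‖ = 1) (hYZ : ⟪Z, Y⟫ = 0) (hN : N = h • Y - k • Z)
    (hxe : axialInner Z x e = 0) (he : axialInner Z e e = 1) :
    axialInner Z e (flowPosition Y Z N h (x, ℓ • e)) = (2 * ℓ) * (1 - h * (2 * h * ⟪Y, e⟫ ^ 2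
      - ⟪Z, e⟫ * ⟪Y, e⟫ * k + 2 * h * ⟪Y, x⟫ ^ 2 - 2 * ⟪Y, x⟫ * ⟪Z, x⟫ * k)) := by
  have hex : axialInner Z e x = 0 := by rw [axialInner_comm, hxe]
  simp only [flowPosition, hN, inner_sub_left, real_inner_smul_left, real_inner_smul_right,
    axialInner_add_right, axialInner_sub_right, axialInner_smul_right,
    axialInner_axialPart_right hZ, axialInner_axisVector hYZ, axialInner_axis_right hZ, hex, he]
  ring

lemma axialInner_flowMomentum_left (hZ : ‖Z‖ = 1) (hYZ : ⟪Z, Y⟫ = 0) (hN : N = h • Y - k • Z)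
    (hx : axialInner Z x x = 1) (hxe : axialInner Z x e = 0) (he : axialInner Z e e = 1) :
    axialInner Z x (flowMomentum Y Z N h m (x, ℓ • e)) = (2 * ℓ) * ℓ * (-1 + h * (2 * (⟪Y, e⟫ *
      (h * ⟪Y, e⟫ - k * ⟪Z, e⟫)) + (h * ⟪Y, x⟫ - k * ⟪Z, x⟫) * ⟪Y, x⟫ + h * ⟪Y, x⟫ ^ 2)) := by
  simp only [flowMomentum, hN, inner_sub_left, real_inner_smul_left, real_inner_smul_right,
    axialInner_add_right, axialInner_sub_right, axialInner_smul_right, axialInner_smul_left,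
    axialInner_axialPart_right hZ, axialInner_axisVector hYZ, axialInner_axis_right hZ, hx, hxe, he]
  ring

lemma axialInner_flowMomentum_right (hZ : ‖Z‖ = 1) (hYZ : ⟪Z, Y⟫ = 0) (hN : N = h • Y - k • Z)
    (hxe : axialInner Z x e = 0) (he : axialInner Z e e = 1) :
    axialInner Z e (flowMomentum Y Z N h m (x, ℓ • e)) = 2 * ℓ * ℓ * (h * k * ⟪Y, x⟫ * ⟪Z, e⟫)
      + 2 * h * m * ⟪Y, e⟫ := by
  have hex : axialInner Z e x = 0 := by rw [axialInner_comm, hxe]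
  simp only [flowMomentum, hN, inner_sub_left, real_inner_smul_left, real_inner_smul_right,
    axialInner_add_right, axialInner_sub_right, axialInner_smul_right, axialInner_smul_left,
    axialInner_axialPart_right hZ, axialInner_axisVector hYZ, axialInner_axis_right hZ, hex, he]
  ring

lemma hasDerivAt_axialMomentum_flow (hZ : ‖Z‖ = 1) (hYZ : ⟪Z, Y⟫ = 0) (hN : N = h • Y - k • Z)
    (hx : axialInner Z x x = 1) (hxe : axialInner Z x e = 0) (he : axialInner Z e e = 1)
    (hm : m = M * k) (hℓ : 0 < ℓ) :
    HasDerivAt (fun ε : ℝ => axialMomentum Z ((x, ℓ • e) + ε •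
        (flowPosition Y Z N h (x, ℓ • e), flowMomentum Y Z N h m (x, ℓ • e))))
      (2 * ℓ * ℓ * (h * k * (⟪Y, x⟫ * ⟪Z, e⟫ - ⟪Y, e⟫ * (⟪Z, x⟫ - M / ℓ ^ 2)))) 0 := by
  refine (hasDerivAt_axialMomentum_line hx hxe he hℓ).congr_deriv ?_
  simp only
  rw [axialInner_flowPosition_left hZ hYZ hN hx hxe, axialInner_flowMomentum_right hZ hYZ hN hxe he,
    hm]
  field_simp
  ring

lemma inner_keplerCone_normalized (hx : axialInner Z x x = 1) (hxe : axialInner Z x e = 0)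
    (he : axialInner Z e e = 1) (hℓ : 0 < ℓ) (φ : ℝ) (u : H) :
    ⟪u, keplerCone Z M (x, ℓ • e) φ⟫ = M / ℓ ^ 2 * (1 - Real.cos φ) * ⟪u, Z⟫
      + Real.cos φ * ⟪u, x⟫ + Real.sin φ * ⟪u, e⟫ := by
  rw [keplerCone_normalized hx hxe he hℓ]
  simp only [inner_add_right, real_inner_smul_right]

lemma inner_keplerConeDeriv_normalized (hx : axialInner Z x x = 1) (hxe : axialInner Z x e = 0)
    (he : axialInner Z e e = 1) (hℓ : 0 < ℓ) (φ : ℝ) (u : H) :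
    ⟪u, keplerConeDeriv Z M (x, ℓ • e) φ⟫ = M / ℓ ^ 2 * Real.sin φ * ⟪u, Z⟫
      - Real.sin φ * ⟪u, x⟫ + Real.cos φ * ⟪u, e⟫ := by
  rw [keplerConeDeriv_normalized hx hxe he hℓ]
  simp only [inner_add_right, inner_sub_right, real_inner_smul_right]

/-- Since D commutes with the Kepler energy, its flow permutes Kepler orbits, so the orbit curve
must move by the Hamiltonian field at its own points, up to two corrections. The multiple of X
restores distance one from the axis; the multiple of X' restores φ as the angle measured from the
initial point, hence the difference of shifts, which vanishes at φ = 0. -/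
lemma hasDerivAt_keplerCone_flow (hZ : ‖Z‖ = 1) (hYZ : ⟪Z, Y⟫ = 0) (hN : N = h • Y - k • Z)
    (hx : axialInner Z x x = 1) (hxe : axialInner Z x e = 0) (he : axialInner Z e e = 1)
    (hm : m = M * k) (hℓ : 0 < ℓ) (φ : ℝ) {X X' : H}
    (hX : X = keplerCone Z M (x, ℓ • e) φ) (hX' : X' = keplerConeDeriv Z M (x, ℓ • e) φ) :
    HasDerivAt (fun ε : ℝ => keplerCone Z M ((x, ℓ • e) + ε •
        (flowPosition Y Z N h (x, ℓ • e), flowMomentum Y Z N h m (x, ℓ • e))) φ)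
      (flowPosition Y Z N h (X, ℓ • X') + (2 * ℓ * (h * k * ⟪Y, X'⟫ * ⟪Z, X⟫)) • X
        - (angleShift Y Z h k ℓ X X' - angleShift Y Z h k ℓ x e) • X') 0 := by
  have hZZ : ⟪Z, Z⟫ = 1 := by rw [real_inner_self_eq_norm_sq, hZ, one_pow]
  have hYZ' : ⟪Y, Z⟫ = 0 := by rw [real_inner_comm, hYZ]
  have key := cone_deformation_identity (h := h) (k := k) (κ := M / ℓ ^ 2) (w₀ := ⟪Z, x⟫)
    (w₁ := ⟪Z, e⟫) (y₁ := ⟪Y, x⟫) (y₂ := ⟪Y, e⟫)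
    (Real.sin_sq_add_cos_sq φ) x e Y Z (w := ⟪Z, X⟫) (w' := ⟪Z, X'⟫) (u := ⟪Y, X⟫) (u' := ⟪Y, X'⟫)
    (X := X) (X' := X')
    (by rw [hX, inner_keplerCone_normalized hx hxe he hℓ, hZZ]; ring)
    (by rw [hX', inner_keplerConeDeriv_normalized hx hxe he hℓ, hZZ]; ring)
    (by rw [hX, inner_keplerCone_normalized hx hxe he hℓ, hYZ']; ring)
    (by rw [hX', inner_keplerConeDeriv_normalized hx hxe he hℓ, hYZ']; ring)
    rfl rfl rfl rfl
    (by rw [hX, keplerCone_normalized hx hxe he hℓ])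
    (by rw [hX', keplerConeDeriv_normalized hx hxe he hℓ])
  have hF : flowPosition Y Z N h (X, ℓ • X') + (2 * ℓ * (h * k * ⟪Y, X'⟫ * ⟪Z, X⟫)) • X
        - (angleShift Y Z h k ℓ X X' - angleShift Y Z h k ℓ x e) • X' = (2 * ℓ) •
      (((X' - ⟪Z, X'⟫ • Z) - h • ((h * ⟪Y, X'⟫ - k * ⟪Z, X'⟫) • Y + ⟪Y, X'⟫ • (h • Y - k • Z)
          - (⟪Y, X'⟫ * (h * ⟪Y, X⟫ - k * ⟪Z, X⟫) + ⟪Y, X⟫ * (h * ⟪Y, X'⟫ - k * ⟪Z, X'⟫)) •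
            (X - ⟪Z, X⟫ • Z)
          + (2 * (⟪Y, X⟫ * (h * ⟪Y, X⟫ - k * ⟪Z, X⟫))) • (X' - ⟪Z, X'⟫ • Z)))
      + (h * k * ⟪Y, X'⟫ * ⟪Z, X⟫) • X
      - (h * k * (⟪Z, X'⟫ * ⟪Y, X'⟫ + 2 * ⟪Z, X⟫ * ⟪Y, X⟫ - ⟪Z, e⟫ * ⟪Y, e⟫
        - 2 * ⟪Z, x⟫ * ⟪Y, x⟫)) • X') := by
    simp only [flowPosition, axialPart, angleShift, hN, inner_sub_left, real_inner_smul_left,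
      real_inner_smul_right]
    module
  rw [hF, ← key]
  refine (hasDerivAt_keplerCone_line hx hxe he hℓ φ).congr_deriv ?_
  simp only
  rw [axialInner_flowPosition_left hZ hYZ hN hx hxe, axialInner_flowMomentum_right hZ hYZ hN hxe he,
    axialInner_flowPosition_right hZ hYZ hN hxe he, axialInner_flowMomentum_left hZ hYZ hN hx hxe he]
  simp only [flowPosition, flowMomentum, axialPart, hN, inner_sub_left, real_inner_smul_left,
      real_inner_smul_right, axialInner_smul_left, axialInner_smul_right, he, hm]
  match_scalars <;> field_simp <;> ring

/-- Infinitesimal form of the invariance of D under p ↦ p + dq. -/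
lemma inner_flowPosition_left (hZ : ‖Z‖ = 1) (hYZ : ⟪Z, Y⟫ = 0) (hN : N = h • Y - k • Z)
    (hx : axialInner Z x x = 1) (hxe : axialInner Z x e = 0) :
    ⟪x, flowPosition Y Z N h (x, ℓ • e)⟫ = 0 := by
  rw [inner_eq_axialInner_add Z, axialInner_flowPosition_left hZ hYZ hN hx hxe]
  simp only [flowPosition, hN, inner_sub_left, real_inner_smul_left, real_inner_smul_right,
    inner_add_right, inner_sub_right, inner_axialPart_axis hZ, hYZ, real_inner_self_eq_norm_sq, hZ]
  ring

/-- If `V` is homogeneous of degree zero and `D` admits the correction `W` in the presence of the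
potential `V`, then the infinitesimal deformation of the time integral of `V` by the flow of `D` is
the integral of a derivative. -/
lemma exists_hasDerivAt_orbitIntegrand_flow (hZ : ‖Z‖ = 1) (hYZ : ⟪Z, Y⟫ = 0)
    (hN : N = h • Y - k • Z) (hx : axialInner Z x x = 1) (hxe : axialInner Z x e = 0)
    (he : axialInner Z e e = 1) (hm : m = M * k) (hℓ : 0 < ℓ) (φ : ℝ) {V W : H → ℝ} {X X' : H}
    (hX : X = keplerCone Z M (x, ℓ • e) φ) (hX' : X' = keplerConeDeriv Z M (x, ℓ • e) φ)
    (hV : DifferentiableAt ℝ V X) (hW : DifferentiableAt ℝ W X) (hV0 : fderiv ℝ V X X = 0)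
    (hVW : fderiv ℝ V X (flowPosition Y Z N h (X, ℓ • X'))
      = (1 + ⟪Z, X⟫ ^ 2) * fderiv ℝ W X (ℓ • X')) :
    ∃ D : ℝ, HasDerivAt (fun ε : ℝ =>
        V (keplerCone Z M ((x, ℓ • e) + ε •
          (flowPosition Y Z N h (x, ℓ • e), flowMomentum Y Z N h m (x, ℓ • e))) φ)
        * timeDensity Z M ((x, ℓ • e) + ε •
          (flowPosition Y Z N h (x, ℓ • e), flowMomentum Y Z N h m (x, ℓ • e))) φ) D 0 ∧
      HasDerivAt (fun φ => W (keplerCone Z M (x, ℓ • e) φ)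
        - (angleShift Y Z h k ℓ (keplerCone Z M (x, ℓ • e) φ) (keplerConeDeriv Z M (x, ℓ • e) φ)
            - angleShift Y Z h k ℓ x e)
          * (V (keplerCone Z M (x, ℓ • e) φ) * timeDensity Z M (x, ℓ • e) φ)) D φ := by
  set z : H × H := (x, ℓ • e) with hz
  set δ : H × H := (flowPosition Y Z N h z, flowMomentum Y Z N h m z) with hδ
  have h0 : z + (0 : ℝ) • δ = z := by simp
  have hZZ : ⟪Z, Z⟫ = 1 := by rw [real_inner_self_eq_norm_sq, hZ, one_pow]
  have hYZ' : ⟪Y, Z⟫ = 0 := by rw [real_inner_comm, hYZ]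
  have hmom : 0 < axialMomentumSq Z z := by
    rw [hz, axialMomentumSq_normalized hx hxe he]; positivity
  have hℓz : axialMomentum Z z = ℓ := axialMomentum_normalized hx hxe he hℓ
  have hXX : axialInner Z X X = 1 := by rw [hX, axialInner_keplerCone_self hZ M hmom]
  have hXX' : axialInner Z X X' = 0 := by
    rw [hX, hX', axialInner_keplerCone_keplerConeDeriv hZ M hmom]
  have hnX : ‖X‖ ^ 2 = 1 + ⟪Z, X⟫ ^ 2 := by rw [norm_sq_eq_axialInner Z, hXX]
  have hpos : 0 < 1 + ⟪Z, X⟫ ^ 2 := by positivity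
  have hXin : ⟪X, X⟫ = 1 + ⟪Z, X⟫ ^ 2 := by rw [real_inner_self_eq_norm_sq, hnX]
  have hXin' : ⟪X, X'⟫ = ⟪Z, X⟫ * ⟪Z, X'⟫ := by rw [inner_eq_axialInner_add Z, hXX', zero_add]
  have hdens : timeDensity Z M z φ = (ℓ * (1 + ⟪Z, X⟫ ^ 2))⁻¹ := by
    rw [timeDensity, hℓz, ← hX, hnX]
  have hc := hasDerivAt_keplerCone_flow hZ hYZ hN hx hxe he hm hℓ φ hX hX'
  have hl := hasDerivAt_axialMomentum_flow hZ hYZ hN hx hxe he hm hℓ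
  rw [← hz, ← hδ] at hc hl
  have hc0 : keplerCone Z M (z + (0 : ℝ) • δ) φ = X := by rw [h0, hX]
  have hl0 : axialMomentum Z (z + (0 : ℝ) • δ) = ℓ := by rw [h0, hℓz]
  have hVc := HasFDerivAt.comp_hasDerivAt (0 : ℝ) (by rw [hc0]; exact hV.hasFDerivAt) hc
  have hnc : HasDerivAt (fun ε : ℝ => ‖keplerCone Z M (z + ε • δ) φ‖ ^ 2) _ 0 := hc.norm_sq
  have hdc : HasDerivAt (fun ε : ℝ => timeDensity Z M (z + ε • δ) φ) _ 0 :=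
    (hl.mul hnc).inv (by rw [Pi.mul_apply, hl0, hc0, hnX]; positivity)
  have hk := hasDerivAt_keplerCone Z M z φ
  have hk' := hasDerivAt_keplerConeDeriv Z M z φ
  rw [← hX'] at hk
  rw [← hX, hℓz] at hk'
  have hVk := HasFDerivAt.comp_hasDerivAt φ (by rw [← hX]; exact hV.hasFDerivAt) hk
  have hWk := HasFDerivAt.comp_hasDerivAt φ (by rw [← hX]; exact hW.hasFDerivAt) hk
  have hnk : HasDerivAt (fun φ => ‖keplerCone Z M z φ‖ ^ 2) _ φ := hk.norm_sq
  have hdk : HasDerivAt (fun φ => timeDensity Z M z φ) _ φ :=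
    (hnk.const_mul (axialMomentum Z z)).inv (by rw [hℓz, ← hX, hnX]; positivity)
  have hcst := fun v : H => hasDerivAt_const φ v
  have hsk : HasDerivAt (fun φ => angleShift Y Z h k ℓ (keplerCone Z M z φ)
      (keplerConeDeriv Z M z φ)) _ φ :=
    ((((((hcst Z).inner ℝ hk').mul ((hcst Y).inner ℝ hk')).add
      ((((hcst Z).inner ℝ hk).const_mul 2).mul ((hcst Y).inner ℝ hk))).const_mul
        (h * k)).const_mul (2 * ℓ))
  refine ⟨_, hVc.mul hdc, ((hWk.sub ((hsk.sub_const _).mul (hVk.mul hdk))).congr_deriv ?_)⟩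
  -- The variation of ℓ is known at φ = 0 but needed at φ. It is a multiple of the determinant of
  -- the pairings of Y and Z with (X - κZ, X'), and this pair only rotates along the orbit.
  have hinv : ⟪Y, x⟫ * ⟪Z, e⟫ - ⟪Y, e⟫ * (⟪Z, x⟫ - M / ℓ ^ 2)
      = ⟪Y, X⟫ * ⟪Z, X'⟫ - ⟪Y, X'⟫ * (⟪Z, X⟫ - M / ℓ ^ 2) := by
    rw [hX, hX', hz]
    simp only [inner_keplerCone_normalized hx hxe he hℓ, inner_keplerConeDeriv_normalized hx hxe he
      hℓ, hYZ', hZZ]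
    linear_combination (-(⟪Y, x⟫ * ⟪Z, e⟫ - ⟪Y, e⟫ * (⟪Z, x⟫ - M / ℓ ^ 2))) *
      Real.sin_sq_add_cos_sq φ
  simp only [Function.comp_apply, Pi.mul_apply, h0, ← hX, ← hX', hℓz, hdens, hnX,
    inner_zero_left, add_zero, hinv]
  simp only [map_add, map_sub, map_smul, smul_eq_mul, hVW, hV0, inner_add_right, inner_sub_right,
    real_inner_smul_right, inner_flowPosition_left hZ hYZ hN hXX hXX', hXin, hXin', hYZ', hZZ,
    angleShift]
  field_simp
  ring

end Variation

/-! ### The first integral of the averaged potential -/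

section Invariance

variable {H : Type*} [NormedAddCommGroup H] [InnerProductSpace ℝ H]
  {Y Z N x e : H} {h m M k ℓ : ℝ}

/-- The variation of the integrand is the derivative of W - shift · V · density, a 2π-periodic
function of φ, so it integrates to zero over a turn. The factor 1 + ⟪Z, X⟫² = ‖X‖² in `hVW` converts
the derivative along ℓX' into a time derivative: the hypothesis says {V, D} = dW/dt. -/
lemma fderiv_orbitIntegral_flow (hZ : ‖Z‖ = 1) (hYZ : ⟪Z, Y⟫ = 0)
    (hN : N = h • Y - k • Z) (hx : axialInner Z x x = 1) (hxe : axialInner Z x e = 0)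
    (he : axialInner Z e e = 1) (hm : m = M * k) (hℓ : 0 < ℓ) {V W : H → ℝ}
    (hV : ∀ φ, ContDiffAt ℝ 1 V (keplerCone Z M (x, ℓ • e) φ))
    (hW : ∀ φ, DifferentiableAt ℝ W (keplerCone Z M (x, ℓ • e) φ))
    (hV0 : ∀ φ, fderiv ℝ V (keplerCone Z M (x, ℓ • e) φ) (keplerCone Z M (x, ℓ • e) φ) = 0)
    (hVW : ∀ X y : H, axialInner Z X X = 1 → axialInner Z X y = 0 →
      (∃ φ, X = keplerCone Z M (x, ℓ • e) φ) →
      fderiv ℝ V X (flowPosition Y Z N h (X, y)) = (1 + ⟪Z, X⟫ ^ 2) * fderiv ℝ W X y) :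
    fderiv ℝ (orbitIntegral Z M V) (x, ℓ • e)
      (flowPosition Y Z N h (x, ℓ • e), flowMomentum Y Z N h m (x, ℓ • e)) = 0 := by
  set z : H × H := (x, ℓ • e) with hz
  set δ : H × H := (flowPosition Y Z N h z, flowMomentum Y Z N h m z) with hδ
  have hmom : 0 < axialMomentumSq Z z := by
    rw [hz, axialMomentumSq_normalized hx hxe he]; positivity
  have hcont := continuousOn_fderiv_partial (b := 0) (c := 2 * Real.pi)
    fun φ _ => contDiffAt_orbitIntegrand (M := M) hZ hmom (hV φ)
  rw [(hasFDerivAt_orbitIntegral hZ hmom hV).fderiv,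
    ContinuousLinearMap.intervalIntegral_apply hcont.intervalIntegrable]
  have key : ∀ φ ∈ Set.uIcc (0 : ℝ) (2 * Real.pi), HasDerivAt (fun φ => W (keplerCone Z M z φ)
        - (angleShift Y Z h k ℓ (keplerCone Z M z φ) (keplerConeDeriv Z M z φ)
            - angleShift Y Z h k ℓ x e)
          * (V (keplerCone Z M z φ) * timeDensity Z M z φ))
      (fderiv ℝ (fun z => V (keplerCone Z M z φ) * timeDensity Z M z φ) z δ) φ := by
    intro φ _
    obtain ⟨D, hD1, hD2⟩ := exists_hasDerivAt_orbitIntegrand_flow hZ hYZ hN hx hxe he hm hℓ φ rfl rfl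
      ((hV φ).differentiableAt one_ne_zero) (hW φ) (hV0 φ)
      (hVW _ _ (axialInner_keplerCone_self hZ M hmom φ) (by
        rw [axialInner_smul_right, axialInner_keplerCone_keplerConeDeriv hZ M hmom, mul_zero])
        ⟨φ, rfl⟩)
    have h0 : z + (0 : ℝ) • δ = z := by simp
    have hdiff := (hasFDerivAt_partial (contDiffAt_orbitIntegrand (M := M) hZ hmom (hV φ)))
    have h1 := HasFDerivAt.comp_hasDerivAt (0 : ℝ)
      (by rw [h0]; exact hdiff.differentiableAt.hasFDerivAt) (hasDerivAt_line z δ)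
    rw [h1.unique hD1]
    exact hD2
  rw [intervalIntegral.integral_eq_sub_of_hasDerivAt key
    (hcont.clm_apply continuousOn_const).intervalIntegrable]
  have e1 := keplerCone_add_two_pi Z M z 0
  have e2 := keplerConeDeriv_add_two_pi Z M z 0
  have e3 := timeDensity_add_two_pi Z M z 0
  rw [zero_add] at e1 e2 e3
  simp only [e1, e2, e3, sub_self]

end Invariance

/-! ### The second center and the Hooke center, and the companion W. -/

section Potentials

variable {n : ℕ} {a m₂ f : ℝ}

lemma norm_center₂ (n : ℕ) (a : ℝ) : ‖center₂ n a‖ = 1 := norm_center₁ n (-a)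

/-- The correction of `D` due to the second center and the Hooke center. -/
def integralCorrection (n : ℕ) (a m₂ f : ℝ) (X : Ambient n) : ℝ :=
  2 * (a / √(1 + a ^ 2)) * m₂ * ((⟪axisVector n a, X⟫ - 2 * (a / √(1 + a ^ 2)) *
      ⟪northPole n, X⟫) / axialRadius (center₂ n a) X)
    - 2 * (a / √(1 + a ^ 2)) ^ 2 * f *
      ((axialInner (center₁ n a) X X - ⟪axisVector n a, X⟫ ^ 2) / ⟪northPole n, X⟫ ^ 2)

lemma perturbingPotential_eq (X : Ambient n) :
    perturbingPotential a m₂ f X =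
      -(m₂ * √(1 + a ^ 2)) * (⟪center₂ n a, X⟫ / axialRadius (center₂ n a) X)
        + f * (axialInner (northPole n) X X / ⟪northPole n, X⟫ ^ 2) := by
  have hS : southPole n = -northPole n := rfl
  have hN : ‖northPole n‖ = 1 := by simp [northPole]
  rw [perturbingPotential, keplerPotential, hookePotential, cot_angle_eq (norm_center₂ n a)]
  have ht : Real.tan (InnerProductGeometry.angle X (southPole n))
      = axialRadius (southPole n) X / ⟪southPole n, X⟫ := by
    have := cot_angle_eq (norm_southPole n) X
    rw [Real.cot_eq_cos_div_sin] at this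
    rw [Real.tan_eq_sin_div_cos, ← inv_div, this, inv_div]
  rw [ht, div_pow, axialRadius_sq (norm_southPole n), hS]
  simp only [axialInner, inner_neg_left, neg_sq, neg_mul_neg]

lemma perturbingPotential_smul (c : ℝ) (X : Ambient n) (hc : 0 < c) :
    perturbingPotential a m₂ f (c • X) = perturbingPotential a m₂ f X := by
  simp only [perturbingPotential, keplerPotential, hookePotential,
    InnerProductGeometry.angle_smul_left_of_pos _ _ hc]

/-- The cone over the points of the lower hemisphere distinct from the second center. -/
def regularCone (n : ℕ) (a : ℝ) : Set (Ambient n) :=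
  {X | ⟪northPole n, X⟫ < 0 ∧ 0 < axialInner (center₂ n a) X X}

lemma isOpen_regularCone : IsOpen (regularCone n a) := by
  have h₁ : IsOpen {X : Ambient n | ⟪northPole n, X⟫ < 0} :=
    isOpen_lt (continuous_const.inner continuous_id) continuous_const
  have hc : Continuous fun X : Ambient n => axialInner (center₂ n a) X X := by
    unfold axialInner; fun_prop
  exact h₁.inter (isOpen_lt continuous_const hc)

lemma contDiff_inner_right (u : Ambient n) : ContDiff ℝ 1 fun X : Ambient n => ⟪u, X⟫ :=
  contDiff_const.inner ℝ contDiff_id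

lemma contDiffAt_perturbingPotential {X : Ambient n} (hX : X ∈ regularCone n a) :
    ContDiffAt ℝ 1 (perturbingPotential a m₂ f) X := by
  rw [show perturbingPotential a m₂ f = _ from funext perturbingPotential_eq]
  exact (contDiffAt_const.mul ((contDiff_inner_right _).contDiffAt.div
    (contDiffAt_axialRadius hX.2) (axialRadius_pos hX.2).ne')).add
    (contDiffAt_const.mul ((contDiff_axialInner_self _).contDiffAt.div
      ((contDiff_inner_right _).contDiffAt.pow 2) (pow_ne_zero 2 hX.1.ne)))

lemma differentiableAt_integralCorrection {X : Ambient n} (hX : X ∈ regularCone n a) :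
    DifferentiableAt ℝ (integralCorrection n a m₂ f) X := by
  have : ContDiffAt ℝ 1 (integralCorrection n a m₂ f) X :=
    (contDiffAt_const.mul (((contDiff_inner_right _).contDiffAt.sub
      (contDiffAt_const.mul (contDiff_inner_right _).contDiffAt)).div
      (contDiffAt_axialRadius hX.2) (axialRadius_pos hX.2).ne')).sub
    (contDiffAt_const.mul (((contDiff_axialInner_self _).contDiffAt.sub
      ((contDiff_inner_right _).contDiffAt.pow 2)).div
      ((contDiff_inner_right _).contDiffAt.pow 2) (pow_ne_zero 2 hX.1.ne)))
  exact this.differentiableAt one_ne_zero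

/-- Euler's relation for a function homogeneous of degree zero. -/
lemma fderiv_perturbingPotential_self {X : Ambient n} (hX : X ∈ regularCone n a) :
    fderiv ℝ (perturbingPotential a m₂ f) X X = 0 := by
  have hd := ((contDiffAt_perturbingPotential (m₂ := m₂) (f := f) hX).differentiableAt
    one_ne_zero).hasFDerivAt
  have hline : HasDerivAt (fun c : ℝ => c • X) X 1 := by
    simpa using (hasDerivAt_id (1 : ℝ)).smul_const X
  have h1 := HasFDerivAt.comp_hasDerivAt (1 : ℝ) (by rw [one_smul]; exact hd) hline
  refine h1.unique ((hasDerivAt_const (1 : ℝ) (perturbingPotential a m₂ f X)).congr_of_eventuallyEq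
    ?_)
  filter_upwards [lt_mem_nhds one_pos] with c hc
  exact perturbingPotential_smul c X hc

lemma fderiv_perturbingPotential_apply {X : Ambient n} (hX : X ∈ regularCone n a) (v : Ambient n) :
    fderiv ℝ (perturbingPotential a m₂ f) X v =
      -(m₂ * √(1 + a ^ 2)) * ((⟪center₂ n a, v⟫ * axialInner (center₂ n a) X X
          - ⟪center₂ n a, X⟫ * axialInner (center₂ n a) X v) / axialRadius (center₂ n a) X ^ 3)
      + f * (2 * (axialInner (northPole n) X v * ⟪northPole n, X⟫
          - axialInner (northPole n) X X * ⟪northPole n, v⟫) / ⟪northPole n, X⟫ ^ 3) := by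
  have hd := ((contDiffAt_perturbingPotential (m₂ := m₂) (f := f) hX).differentiableAt
    one_ne_zero).hasFDerivAt
  have hline : HasDerivAt (fun t : ℝ => X + t • v) v 0 := by
    simpa using ((hasDerivAt_id (0 : ℝ)).smul_const v).const_add X
  have h0 : X + (0 : ℝ) • v = X := by simp
  have h1 := HasFDerivAt.comp_hasDerivAt (0 : ℝ) (by rw [h0]; exact hd) hline
  have hr := axialRadius_pos hX.2
  have hrad := hasDerivAt_axialRadius (center₂ n a) hline (by rw [h0]; exact hX.2)
  have hcst := fun u : Ambient n => (hasDerivAt_const (0 : ℝ) u).inner ℝ hline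
  have hN0 : ⟪northPole n, X⟫ ≠ 0 := hX.1.ne
  have h2 := (((hcst (center₂ n a)).div hrad (by rw [h0]; exact hr.ne')).const_mul
    (-(m₂ * √(1 + a ^ 2)))).add (((hasDerivAt_axialInner (northPole n) hline hline).div
      ((hcst (northPole n)).pow 2) (by rw [Pi.pow_apply, h0]; exact pow_ne_zero 2 hN0)).const_mul f)
  rw [h1.unique (h2.congr_of_eventuallyEq (Filter.Eventually.of_forall fun t =>
    perturbingPotential_eq (X + t • v)))]
  simp only [h0, inner_zero_left, add_zero, Pi.pow_apply, axialInner_comm _ v X,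
    ← axialRadius_sq (norm_center₂ n a)]
  field_simp
  ring

lemma fderiv_integralCorrection_apply {X : Ambient n} (hX : X ∈ regularCone n a) (v : Ambient n) :
    fderiv ℝ (integralCorrection n a m₂ f) X v =
      2 * (a / √(1 + a ^ 2)) * m₂ * (((⟪axisVector n a, v⟫ - 2 * (a / √(1 + a ^ 2)) *
          ⟪northPole n, v⟫) * axialInner (center₂ n a) X X
        - (⟪axisVector n a, X⟫ - 2 * (a / √(1 + a ^ 2)) * ⟪northPole n, X⟫)
          * axialInner (center₂ n a) X v) / axialRadius (center₂ n a) X ^ 3)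
      - 2 * (a / √(1 + a ^ 2)) ^ 2 * f *
        (2 * ((axialInner (center₁ n a) X v - ⟪axisVector n a, X⟫ * ⟪axisVector n a, v⟫)
            * ⟪northPole n, X⟫
          - (axialInner (center₁ n a) X X - ⟪axisVector n a, X⟫ ^ 2) * ⟪northPole n, v⟫)
            / ⟪northPole n, X⟫ ^ 3) := by
  have hd := (differentiableAt_integralCorrection (m₂ := m₂) (f := f) hX).hasFDerivAt
  have hline : HasDerivAt (fun t : ℝ => X + t • v) v 0 := by
    simpa using ((hasDerivAt_id (0 : ℝ)).smul_const v).const_add X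
  have h0 : X + (0 : ℝ) • v = X := by simp
  have h1 := HasFDerivAt.comp_hasDerivAt (0 : ℝ) (by rw [h0]; exact hd) hline
  have hr := axialRadius_pos hX.2
  have hrad := hasDerivAt_axialRadius (center₂ n a) hline (by rw [h0]; exact hX.2)
  have hcst := fun u : Ambient n => (hasDerivAt_const (0 : ℝ) u).inner ℝ hline
  have hN0 : ⟪northPole n, X⟫ ≠ 0 := hX.1.ne
  have h2 := ((((hcst (axisVector n a)).sub ((hcst (northPole n)).const_mul
    (2 * (a / √(1 + a ^ 2))))).div hrad (by rw [h0]; exact hr.ne')).const_mul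
    (2 * (a / √(1 + a ^ 2)) * m₂)).sub ((((hasDerivAt_axialInner (center₁ n a) hline hline).sub
      ((hcst (axisVector n a)).pow 2)).div
      ((hcst (northPole n)).pow 2) (by rw [Pi.pow_apply, h0]; exact pow_ne_zero 2 hN0)).const_mul
        (2 * (a / √(1 + a ^ 2)) ^ 2 * f))
  rw [h1.unique h2]
  have hs : 0 < √(1 + a ^ 2) := by positivity
  simp only [h0, inner_zero_left, add_zero, Pi.pow_apply, Pi.sub_apply, axialInner_comm _ v X,
    ← axialRadius_sq (norm_center₂ n a)]
  field_simp
  ring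

/-- `D + integralCorrection` is a first integral of the Lagrange problem, to first order in the
perturbation. -/
lemma fderiv_perturbingPotential_flowPosition {X y : Ambient n} (hX : X ∈ regularCone n a)
    (hXX : axialInner (center₁ n a) X X = 1) (hXy : axialInner (center₁ n a) X y = 0) :
    fderiv ℝ (perturbingPotential a m₂ f) X (flowPosition (axisVector n a) (center₁ n a)
        (northPole n) (a / √(1 + a ^ 2)) (X, y))
      = (1 + ⟪center₁ n a, X⟫ ^ 2) * fderiv ℝ (integralCorrection n a m₂ f) X y := by
  rw [fderiv_perturbingPotential_apply hX, fderiv_integralCorrection_apply hX]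
  have hs : 0 < √(1 + a ^ 2) := by positivity
  set s := √(1 + a ^ 2) with hsdef
  have hs2 : s ^ 2 = 1 + a ^ 2 := sqrt_one_add_sq a
  have hk : s = (s⁻¹)⁻¹ := (inv_inv s).symm
  have hrel : (s⁻¹) ^ 2 + (a / s) ^ 2 = 1 := by field_simp; linarith
  have hZ := norm_center₁ n a
  have hYZ := inner_center₁_axisVector (n := n) (a := a)
  have hYY := inner_axisVector_self (n := n) (a := a)
  have hN : northPole n = (a / s) • axisVector n a - s⁻¹ • center₁ n a := northPole_eq
  have hZ₂ : center₂ n a = (1 - 2 * (a / s) ^ 2) • center₁ n a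
      - (2 * (a / s) * s⁻¹) • axisVector n a := by
    rw [center₂_eq, ← hsdef, div_eq_mul_inv (2 * (a / s)) s]
  have hn0 : ⟪northPole n, X⟫ ≠ 0 := hX.1.ne
  have hr := axialRadius_pos hX.2
  have hk0 : s⁻¹ ≠ 0 := inv_ne_zero hs.ne'
  -- From here h = a/s and k = 1/s are free symbols bound by h² + k² = 1 and k ≠ 0, which makes the
  -- remaining identities polynomial.
  generalize a / s = h at *
  rw [hk]
  generalize s⁻¹ = k at *
  set Y := axisVector n a
  set Z := center₁ n a
  set N := northPole n
  set Z₂ := center₂ n a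
  have hYZ' : ⟪Y, Z⟫ = 0 := by rw [real_inner_comm, hYZ]
  have hZZ : ⟪Z, Z⟫ = 1 := by rw [real_inner_self_eq_norm_sq, hZ, one_pow]
  set v := flowPosition Y Z N h (X, y) with hv
  -- Since v is orthogonal to X, the derivatives of the two potentials along v reduce to multiples
  -- of ‖X‖²⟪Z₂, v⟫ and ‖X‖²⟪N, v⟫. This produces the factor 1 + w² and leaves one identity for each
  -- center.
  have hXv : ⟪X, v⟫ = 0 := by
    have := inner_flowPosition_left (ℓ := 1) hZ hYZ hN hXX hXy
    rwa [one_smul] at this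
  have hNi : ∀ u, ⟪N, u⟫ = h * ⟪Y, u⟫ - k * ⟪Z, u⟫ := fun u => by
    rw [hN, inner_sub_left, real_inner_smul_left, real_inner_smul_left]
  have hZ₂i : ∀ u, ⟪Z₂, u⟫ = (1 - 2 * h ^ 2) * ⟪Z, u⟫ - 2 * h * k * ⟪Y, u⟫ := fun u => by
    rw [hZ₂, inner_sub_left, real_inner_smul_left, real_inner_smul_left]
  have hZv : ⟪Z, v⟫ = 2 * h * k * ⟪Y, y⟫ := by
    rw [hv]
    simp only [flowPosition, inner_add_right, inner_sub_right, real_inner_smul_right,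
      inner_axialPart_axis hZ, hYZ, real_inner_comm N Z, hNi, hZZ, hYZ']
    ring
  have hYv : ⟪Y, v⟫ = 2 * ⟪Y, y⟫ - 2 * h * (⟪N, y⟫ + ⟪Y, y⟫ * h
      - (⟪Y, y⟫ * ⟪N, X⟫ + ⟪Y, X⟫ * ⟪N, y⟫) * ⟪Y, X⟫ + 2 * (⟪Y, X⟫ * ⟪N, X⟫) * ⟪Y, y⟫) := by
    have hpart : ∀ u, ⟪Y, axialPart Z u⟫ = ⟪Y, u⟫ := fun u => by
      rw [axialPart, inner_sub_right, real_inner_smul_right, hYZ', mul_zero, sub_zero]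
    have hYN : ⟪Y, N⟫ = h := by
      rw [hN, inner_sub_right, real_inner_smul_right, real_inner_smul_right, hYY, hYZ']; ring
    rw [hv]
    simp only [flowPosition, inner_add_right, inner_sub_right, real_inner_smul_right, hpart, hYY,
      hYN]
    ring
  have hXXi : ⟪X, X⟫ = 1 + ⟪Z, X⟫ ^ 2 := by rw [inner_eq_axialInner_add Z, hXX]; ring
  have hXyi : ⟪X, y⟫ = ⟪Z, X⟫ * ⟪Z, y⟫ := by rw [inner_eq_axialInner_add Z, hXy]; ring
  set α := ⟪Y, X⟫
  set α' := ⟪Y, y⟫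
  set w := ⟪Z, X⟫
  set w' := ⟪Z, y⟫
  have kepler : -⟪Z₂, v⟫ = 2 * h * k * ((α' - 2 * h * ⟪N, y⟫) * (1 + w ^ 2 - ⟪Z₂, X⟫ ^ 2)
      - (α - 2 * h * ⟪N, X⟫) * (w * w' - ⟪Z₂, X⟫ * ⟪Z₂, y⟫)) := by
    simp only [hZ₂i, hNi, hYv, hZv]
    linear_combination (-8 * h ^ 3 * k * w * w' * α + 8 * h ^ 3 * k * w ^ 2 * α'
      - 16 * h ^ 4 * k ^ 2 * w * α * α' + 16 * h ^ 4 * k ^ 2 * w' * α ^ 2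
      + 16 * h ^ 5 * k * w * w' * α - 16 * h ^ 5 * k * w ^ 2 * α') * hrel
  have hooke : ⟪N, v⟫ = -2 * h ^ 2 * (α * α' * ⟪N, X⟫ + (1 - α ^ 2) * ⟪N, y⟫) := by
    simp only [hNi, hYv, hZv]
    linear_combination (-2 * h * α') * hrel
  have e₁ : axialInner Z₂ X X = 1 + w ^ 2 - ⟪Z₂, X⟫ ^ 2 := by rw [axialInner, hXXi]; ring
  have e₂ : axialInner Z₂ X v = -(⟪Z₂, X⟫ * ⟪Z₂, v⟫) := by rw [axialInner, hXv]; ring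
  have e₃ : axialInner Z₂ X y = w * w' - ⟪Z₂, X⟫ * ⟪Z₂, y⟫ := by rw [axialInner, hXyi]
  have e₄ : axialInner N X X = 1 + w ^ 2 - ⟪N, X⟫ ^ 2 := by rw [axialInner, hXXi]; ring
  have e₅ : axialInner N X v = -(⟪N, X⟫ * ⟪N, v⟫) := by rw [axialInner, hXv]; ring
  have kepler' : -(m₂ * k⁻¹) * ⟪Z₂, v⟫ =
      2 * h * m₂ * ((α' - 2 * h * ⟪N, y⟫) * (1 + w ^ 2 - ⟪Z₂, X⟫ ^ 2)
      - (α - 2 * h * ⟪N, X⟫) * (w * w' - ⟪Z₂, X⟫ * ⟪Z₂, y⟫)) := by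
    rw [show -(m₂ * k⁻¹) * ⟪Z₂, v⟫ = m₂ * k⁻¹ * -⟪Z₂, v⟫ by ring, kepler]
    field_simp
  rw [e₁, e₂, e₃, e₄, e₅, hXX, hXy]
  simp only [div_eq_mul_inv]
  linear_combination (1 + w ^ 2) * (axialRadius Z₂ X ^ 3)⁻¹ * kepler'
    - 2 * f * (1 + w ^ 2) * (⟪N, X⟫ ^ 3)⁻¹ * hooke

end Potentials

/-! ### Invariance under rescaling -/

section Rescaling

variable {H : Type*} [NormedAddCommGroup H] [InnerProductSpace ℝ H]

/-- The linear symplectic map `(q, p) ↦ (c⁻¹ q, c p + d q)`. -/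
def rescale (c d : ℝ) : H × H →L[ℝ] H × H :=
  (c⁻¹ • ContinuousLinearMap.fst ℝ H H).prod
    (c • ContinuousLinearMap.snd ℝ H H + d • ContinuousLinearMap.fst ℝ H H)

lemma rescale_apply (c d : ℝ) (z : H × H) : rescale c d z = (c⁻¹ • z.1, c • z.2 + d • z.1) := rfl

variable {Y Z N : H} {h m M c d : ℝ} {z : H × H}

lemma axialRadius_inv_smul (hc : 0 < c) (q : H) :
    axialRadius Z (c⁻¹ • q) = c⁻¹ * axialRadius Z q := by
  rw [axialRadius, axialInner_smul_left, axialInner_smul_right, ← mul_assoc, ← pow_two,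
    Real.sqrt_mul (by positivity), Real.sqrt_sq (by positivity), axialRadius]

lemma axialMomentumSq_rescale (hc : 0 < c) (z : H × H) :
    axialMomentumSq Z (rescale c d z) = axialMomentumSq Z z := by
  simp only [axialMomentumSq, rescale_apply, axialInner_smul_left, axialInner_smul_right,
    axialInner_add_left, axialInner_add_right, axialInner_comm Z z.2 z.1]
  field_simp
  ring

lemma axialMomentum_rescale (hc : 0 < c) (z : H × H) :
    axialMomentum Z (rescale c d z) = axialMomentum Z z := by
  rw [axialMomentum, axialMomentumSq_rescale hc, axialMomentum]

lemma conePosition_rescale (hc : 0 < c) (z : H × H) :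
    conePosition Z (rescale c d z) = conePosition Z z := by
  rw [conePosition, rescale_apply, axialRadius_inv_smul hc, smul_smul, conePosition]
  congr 1
  field_simp

lemma coneVelocity_rescale (hZ : ‖Z‖ = 1) (hc : 0 < c) (hz : 0 < axialInner Z z.1 z.1) :
    coneVelocity Z (rescale c d z) = coneVelocity Z z := by
  have hr := axialRadius_pos hz
  simp only [coneVelocity, rescale_apply, axialRadius_inv_smul hc, axialInner_smul_left,
    axialInner_smul_right, axialInner_add_right, ← axialRadius_sq hZ z.1]
  match_scalars <;> field_simp
  ring

lemma keplerCone_rescale (hZ : ‖Z‖ = 1) (hc : 0 < c) (hz : 0 < axialInner Z z.1 z.1) (φ : ℝ) :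
    keplerCone Z M (rescale c d z) φ = keplerCone Z M z φ := by
  rw [keplerCone, axialMomentum_rescale hc, conePosition_rescale hc, coneVelocity_rescale hZ hc hz,
    keplerCone]

lemma orbitIntegral_rescale (hZ : ‖Z‖ = 1) (hc : 0 < c) (hz : 0 < axialInner Z z.1 z.1)
    (U : H → ℝ) : orbitIntegral Z M U (rescale c d z) = orbitIntegral Z M U z := by
  simp only [orbitIntegral, timeDensity, keplerCone_rescale hZ hc hz, axialMomentum_rescale hc]

lemma axialIntegral_rescale (hc : 0 < c) (z : H × H) :
    axialIntegral Y Z N h m (rescale c d z) = axialIntegral Y Z N h m z := by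
  rw [axialIntegral, axialMomentumSq_rescale hc, axialIntegral]
  simp only [rescale_apply, axialRadius_inv_smul hc, axialInner_smul_left, axialInner_smul_right,
    axialInner_add_left, axialInner_add_right, inner_add_right, real_inner_smul_right,
    axialInner_comm Z z.2 z.1, mul_div_mul_left _ _ (inv_ne_zero hc.ne')]
  field_simp
  ring

lemma axialEnergy_rescale (hc : 0 < c) (z : H × H) :
    axialEnergy Z M (rescale c d z) = axialEnergy Z M z := by
  simp only [axialEnergy, rescale_apply, axialRadius_inv_smul hc, inner_add_right, inner_add_left,
    real_inner_smul_right, real_inner_smul_left, real_inner_comm z.1 z.2,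
    mul_div_mul_left _ _ (inv_ne_zero hc.ne')]
  field_simp
  ring

lemma exists_rescale_eq (hz : 0 < axialInner Z z.1 z.1) :
    ∃ c d : ℝ, 0 < c ∧ rescale c d z = (conePosition Z z, coneVelocity Z z) := by
  refine ⟨axialRadius Z z.1, -(axialInner Z z.1 z.2 / axialRadius Z z.1), axialRadius_pos hz, ?_⟩
  rw [rescale_apply, conePosition, coneVelocity, neg_smul, sub_eq_add_neg]

/-- Here c and d are frozen while the point varies, so the invariance is under a fixed linear map
and the chain rule applies. -/
lemma fderiv_eq_fderiv_rescale {F : H × H → ℝ} (hF : DifferentiableAt ℝ F (rescale c d z))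
    (hinv : ∀ᶠ w in nhds z, F (rescale c d w) = F w) (δ : H × H) :
    fderiv ℝ F z δ = fderiv ℝ F (rescale c d z) (rescale c d δ) := by
  have h1 : F =ᶠ[nhds z] F ∘ rescale c d := hinv.mono fun w hw => hw.symm
  rw [h1.fderiv_eq, fderiv_comp z hF (rescale (H := H) c d).differentiableAt,
    ContinuousLinearMap.fderiv, ContinuousLinearMap.comp_apply]

end Rescaling

/-! ### Brackets as derivatives along Hamiltonian vector fields. -/

section Bracket

variable {n : ℕ} {F G : Ambient n × Ambient n → ℝ} {z : Ambient n × Ambient n}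

lemma canonicalBracket_eq {gq gp : Ambient n}
    (hG : ∀ δ, fderiv ℝ G z δ = ⟪gq, δ.1⟫ + ⟪gp, δ.2⟫) :
    canonicalBracket F G z = fderiv ℝ F z (gp, -gq) := by
  have hsum : ((gp, -gq) : Ambient n × Ambient n) =
      ∑ i, (gp i • ((EuclideanSpace.single i 1, 0) : Ambient n × Ambient n)
        - gq i • ((0, EuclideanSpace.single i 1) : Ambient n × Ambient n)) := by
    have hb : ∀ u : Ambient n, u = ∑ i, u i • EuclideanSpace.single i (1 : ℝ) := fun u => by
      simpa using ((EuclideanSpace.basisFun (Fin (n + 2)) ℝ).sum_repr u).symm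
    refine Prod.ext ?_ ?_
    · simpa [Prod.fst_sum] using hb gp
    · simpa [Prod.snd_sum] using hb gq
  rw [hsum, map_sum, canonicalBracket]
  refine Finset.sum_congr rfl fun i _ => ?_
  simp only [map_sub, map_smul, hG, inner_zero_right, zero_add, add_zero, smul_eq_mul,
    EuclideanSpace.inner_single_right]
  simp
  ring

/-- Linear symplectic maps preserve the bracket, so it can be evaluated at the normalized point,
where the gradient of D is known. -/
lemma canonicalBracket_rescale {c d : ℝ} (hc : 0 < c)
    (hF : DifferentiableAt ℝ F (rescale c d z)) (hG : DifferentiableAt ℝ G (rescale c d z))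
    (hFinv : ∀ᶠ w in nhds z, F (rescale c d w) = F w)
    (hGinv : ∀ᶠ w in nhds z, G (rescale c d w) = G w) {gq gp : Ambient n}
    (hgrad : ∀ δ, fderiv ℝ G (rescale c d z) δ = ⟪gq, δ.1⟫ + ⟪gp, δ.2⟫) :
    canonicalBracket F G z = fderiv ℝ F (rescale c d z) (gp, -gq) := by
  rw [canonicalBracket_eq (gq := c⁻¹ • gq + d • gp) (gp := c • gp) fun δ => ?_,
    fderiv_eq_fderiv_rescale hF hFinv]
  · congr 1
    rw [rescale_apply]
    refine Prod.ext ?_ ?_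
    · simp [hc.ne']
    · simp only
      match_scalars <;> field_simp
      ring
  · rw [fderiv_eq_fderiv_rescale hG hGinv, hgrad, rescale_apply]
    simp only [inner_add_left, inner_add_right, real_inner_smul_left, real_inner_smul_right]
    ring

end Bracket

/-! ### The averaged system in homogeneous coordinates -/

section Reduction

variable {n : ℕ} {a m₁ m₂ f : ℝ} {z : Ambient n × Ambient n}

/-- The projection to the sphere is a rescaling with point-dependent coefficients, so functions
invariant under all rescalings factor through it. -/
lemma toTangentSphere_eq_rescale (hz : z.1 ≠ 0) :
    toTangentSphere z = rescale ‖z.1‖ (-⟪‖z.1‖⁻¹ • z.1, z.2⟫) z := by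
  have h1 : ‖z.1‖ ≠ 0 := norm_ne_zero_iff.2 hz
  rw [toTangentSphere, rescale_apply, tangentialPart]
  refine Prod.ext rfl ?_
  simp only [real_inner_smul_left]
  match_scalars <;> field_simp

lemma norm_toTangentSphere_fst (hz : z.1 ≠ 0) : ‖(toTangentSphere z).1‖ = 1 := by
  rw [toTangentSphere, norm_smul, norm_inv, norm_norm, inv_mul_cancel₀ (norm_ne_zero_iff.2 hz)]

lemma inner_toTangentSphere (hz : z.1 ≠ 0) :
    ⟪(toTangentSphere z).1, (toTangentSphere z).2⟫ = 0 := by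
  have h1 := norm_toTangentSphere_fst hz
  rw [toTangentSphere] at h1 ⊢
  simp only at h1 ⊢
  rw [real_inner_smul_right, tangentialPart, inner_sub_right, real_inner_smul_right,
    real_inner_self_eq_norm_sq, h1]
  ring

/-- The points whose Kepler orbit is non-singular, stays in the lower hemisphere and avoids the
second center, in homogeneous coordinates. -/
def IsRegularPoint (n : ℕ) (a m₁ : ℝ) (z : Ambient n × Ambient n) : Prop :=
  0 < axialMomentumSq (center₁ n a) z ∧
    ∀ φ, keplerCone (center₁ n a) (m₁ * √(1 + a ^ 2)) z φ ∈ regularCone n a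

lemma smul_mem_regularCone_iff {c : ℝ} (hc : 0 < c) {X : Ambient n} :
    c • X ∈ regularCone n a ↔ X ∈ regularCone n a := by
  simp only [regularCone, Set.mem_ofPred_eq, real_inner_smul_right, axialInner_smul_left,
    axialInner_smul_right, ← neg_pos (a := c * _), ← mul_neg, mul_pos_iff_of_pos_left hc, neg_pos]

lemma mem_regularCone {q : Ambient n} (hq : q ∈ lowerHemisphere n) (h₂ : q ≠ center₂ n a) :
    q ∈ regularCone n a := by
  refine ⟨by rw [inner_northPole]; exact hq.2,
    -- The antipode of the second center lies in the upper hemisphere.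
    axialInner_self_pos_of_ne (norm_center₂ n a) hq.1 h₂ fun h => ?_⟩
  have hz := hq.2
  have hs : 0 < √(1 + a ^ 2) := by positivity
  rw [h, PiLp.neg_apply, ← inner_northPole, center₂, real_inner_comm, inner_center₁] at hz
  simp [northPole, yIdx_ne_zIdx n] at hz
  exact absurd hz (not_lt.2 hs.le)

lemma norm_fst_of_mem_averagingRegion (hz : z ∈ averagingRegion n a m₁) : ‖z.1‖ = 1 := by
  obtain ⟨γ, hγ, -⟩ := hz
  rw [← hγ.position, hγ.norm_eq_one]

lemma inner_of_mem_averagingRegion (hm₁ : 0 < m₁) (hz : z ∈ averagingRegion n a m₁) :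
    ⟪z.1, z.2⟫ = 0 := by
  obtain ⟨γ, hγ, -⟩ := hz
  exact (hγ.exists_angle hm₁).2.1

/-- The angle increases at rate at least ℓ, so the motion runs through every angle and its
conditions hold on the whole cone. The resulting condition is open in the ambient phase space, as
differentiation requires. -/
lemma isRegularPoint_of_mem_averagingRegion (hm₁ : 0 < m₁) (hz : z ∈ averagingRegion n a m₁) :
    IsRegularPoint n a m₁ z := by
  obtain ⟨γ, hγ, hlow, hne⟩ := hz
  obtain ⟨hmom, -, -, φ, -, hφ, hγφ⟩ := hγ.exists_angle hm₁
  have hZ := norm_center₁ n a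
  have hl := axialMomentum_pos hmom
  have hsurj : Function.Surjective φ := surjective_of_le_hasDerivAt hl hφ fun t => by
    rw [norm_keplerCone_sq hZ _ hmom]
    nlinarith [sq_nonneg ⟪center₁ n a, keplerCone (center₁ n a) (m₁ * √(1 + a ^ 2)) z (φ t)⟫]
  refine ⟨hmom, fun ψ => ?_⟩
  obtain ⟨t, rfl⟩ := hsurj ψ
  have := mem_regularCone (hlow t) (hne t)
  rwa [hγφ t, smul_mem_regularCone_iff (inv_pos.2 (norm_keplerCone_pos hZ _ hmom _))] at this

lemma IsRegularPoint.eventually (hz : IsRegularPoint n a m₁ z) :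
    ∀ᶠ y in nhds z, IsRegularPoint n a m₁ y :=
  eventually_keplerCone_mem (norm_center₁ n a) hz.1 isOpen_regularCone hz.2

lemma IsRegularPoint.axialInner_pos (hz : IsRegularPoint n a m₁ z) :
    0 < axialInner (center₁ n a) z.1 z.1 :=
  axialInner_self_pos_of_momentum (norm_center₁ n a) hz.1

lemma IsRegularPoint.fst_ne_zero (hz : IsRegularPoint n a m₁ z) : z.1 ≠ 0 := fun h => by
  have := hz.axialInner_pos
  simp [h, axialInner] at this

lemma IsRegularPoint.fst_apply_zIdx_neg (hz : IsRegularPoint n a m₁ z) : z.1 (zIdx n) < 0 := by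
  have h0 := hz.2 0
  rw [keplerCone_zero, conePosition,
    smul_mem_regularCone_iff (inv_pos.2 (axialRadius_pos hz.axialInner_pos))] at h0
  rw [← inner_northPole]
  exact h0.1

lemma IsRegularPoint.map_rescale {c d : ℝ} (hz : IsRegularPoint n a m₁ z) (hc : 0 < c) :
    IsRegularPoint n a m₁ (rescale c d z) :=
  ⟨by rw [axialMomentumSq_rescale hc]; exact hz.1, fun φ => by
    rw [keplerCone_rescale (norm_center₁ n a) hc hz.axialInner_pos]; exact hz.2 φ⟩

/-- The averaged energy in homogeneous coordinates. -/
def reducedEnergy (n : ℕ) (a m₁ m₂ f : ℝ) (z : Ambient n × Ambient n) : ℝ :=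
  axialEnergy (center₁ n a) (m₁ * √(1 + a ^ 2)) z
    + orbitIntegral (center₁ n a) (m₁ * √(1 + a ^ 2)) (perturbingPotential a m₂ f) z
      / orbitIntegral (center₁ n a) (m₁ * √(1 + a ^ 2)) (fun _ => 1) z

lemma reducedEnergy_rescale {c d : ℝ} (hz : IsRegularPoint n a m₁ z) (hc : 0 < c) :
    reducedEnergy n a m₁ m₂ f (rescale c d z) = reducedEnergy n a m₁ m₂ f z := by
  have hZ := norm_center₁ n a
  rw [reducedEnergy, axialEnergy_rescale hc, orbitIntegral_rescale hZ hc hz.axialInner_pos,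
    orbitIntegral_rescale hZ hc hz.axialInner_pos, reducedEnergy]

/-- A closed motion exists, so the average is not the default value, and `average_eq` holds for
whichever motion and period are chosen. -/
lemma averagedEnergy_eq_reducedEnergy (hm₁ : 0 < m₁) (h1 : ‖z.1‖ = 1) (horth : ⟪z.1, z.2⟫ = 0)
    (hz : IsRegularPoint n a m₁ z) :
    averagedEnergy a m₁ m₂ f z = reducedEnergy n a m₁ m₂ f z := by
  obtain ⟨γ, T, hγ⟩ := exists_isClosedKeplerMotion (m₁ := m₁) h1 horth hz.1
  have hex : ∃ p : (ℝ → Ambient n) × ℝ, IsClosedKeplerMotion a m₁ z p.1 p.2 := ⟨(γ, T), hγ⟩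
  have hcont : Continuous fun φ => perturbingPotential a m₂ f
      (keplerCone (center₁ n a) (m₁ * √(1 + a ^ 2)) z φ) :=
    continuous_iff_continuousAt.2 fun φ => ContinuousAt.comp
      (contDiffAt_perturbingPotential (hz.2 φ)).continuousAt
      (contDiff_keplerCone (m := 0) _ _ z).continuous.continuousAt
  rw [averagedEnergy, reducedEnergy, orbitAverage, dif_pos hex,
    hex.choose_spec.average_eq hm₁ perturbingPotential_smul hcont, keplerEnergy, firstPotential_eq,
    axialEnergy, horth, real_inner_self_eq_norm_sq, real_inner_self_eq_norm_sq, h1]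
  ring

lemma averagedEnergy_toTangentSphere (hm₁ : 0 < m₁) (hz : IsRegularPoint n a m₁ z) :
    averagedEnergy a m₁ m₂ f (toTangentSphere z) = reducedEnergy n a m₁ m₂ f z := by
  have h0 := hz.fst_ne_zero
  have hr := toTangentSphere_eq_rescale h0
  rw [averagedEnergy_eq_reducedEnergy hm₁ (norm_toTangentSphere_fst h0) (inner_toTangentSphere h0)
    (by rw [hr]; exact hz.map_rescale (norm_pos_iff.2 h0)), hr,
    reducedEnergy_rescale hz (norm_pos_iff.2 h0)]

lemma functionD_toTangentSphere (hz : IsRegularPoint n a m₁ z) :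
    functionD a m₁ (toTangentSphere z) = axialIntegral (axisVector n a) (center₁ n a) (northPole n)
      (a / √(1 + a ^ 2)) m₁ z := by
  have h0 := hz.fst_ne_zero
  have hr := toTangentSphere_eq_rescale h0
  have hreg : IsRegularPoint n a m₁ (toTangentSphere z) := by
    rw [hr]; exact hz.map_rescale (norm_pos_iff.2 h0)
  rw [← Prod.mk.eta (p := toTangentSphere z), functionD_eq_axialIntegral
    (norm_toTangentSphere_fst h0) hreg.fst_apply_zIdx_neg hreg.axialInner_pos, Prod.mk.eta, hr,
    axialIntegral_rescale (norm_pos_iff.2 h0)]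

lemma hasDerivAt_line_of_differentiableAt {F : Ambient n × Ambient n → ℝ}
    (hF : DifferentiableAt ℝ F z) (δ : Ambient n × Ambient n) :
    HasDerivAt (fun ε : ℝ => F (z + ε • δ)) (fderiv ℝ F z δ) 0 := by
  have h0 : z + (0 : ℝ) • δ = z := by simp
  exact HasFDerivAt.comp_hasDerivAt (l := F) (0 : ℝ) (by rw [h0]; exact hF.hasFDerivAt)
    (hasDerivAt_line z δ)

lemma differentiableAt_axialEnergy {Z : Ambient n} {M : ℝ} (hz : 0 < axialInner Z z.1 z.1) :
    DifferentiableAt ℝ (axialEnergy Z M) z := by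
  have h : ContDiffAt ℝ 1 (axialEnergy Z M) z :=
    ((((contDiffAt_fst.inner ℝ contDiffAt_fst).mul (contDiffAt_snd.inner ℝ contDiffAt_snd)).sub
      ((contDiffAt_fst.inner ℝ contDiffAt_snd).pow 2)).div_const 2).sub
    (contDiffAt_const.mul ((contDiffAt_const.inner ℝ contDiffAt_fst).div
      (contDiffAt_axialRadius_fst hz) (axialRadius_pos hz).ne'))
  exact h.differentiableAt one_ne_zero

lemma differentiableAt_axialIntegral {Y Z N : Ambient n} {h m : ℝ}
    (hz : 0 < axialInner Z z.1 z.1) :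
    DifferentiableAt ℝ (axialIntegral Y Z N h m) z := by
  have hq : ∀ u : Ambient n, ContDiffAt ℝ 1 (fun z : Ambient n × Ambient n => ⟪u, z.1⟫) z :=
    fun u => contDiffAt_const.inner ℝ contDiffAt_fst
  have hp : ∀ u : Ambient n, ContDiffAt ℝ 1 (fun z : Ambient n × Ambient n => ⟪u, z.2⟫) z :=
    fun u => contDiffAt_const.inner ℝ contDiffAt_snd
  have hsmooth : ContDiffAt ℝ 1 (axialIntegral Y Z N h m) z :=
    (contDiff_axialMomentumSq Z).contDiffAt.sub (contDiffAt_const.mul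
      ((((((contDiff_axialInner_self Z).comp contDiff_fst).contDiffAt.mul ((hp Y).mul (hp N))).sub
        ((contDiff_axialInner Z).contDiffAt.mul
          (((hp Y).mul (hq N)).add ((hq Y).mul (hp N))))).add
        (((contDiff_axialInner_self Z).comp contDiff_snd).contDiffAt.mul ((hq Y).mul (hq N)))).add
      (contDiffAt_const.mul ((hq Y).div (contDiffAt_axialRadius_fst hz)
        (axialRadius_pos hz).ne'))))
  exact hsmooth.differentiableAt one_ne_zero

lemma IsRegularPoint.differentiableAt_orbitIntegral (hz : IsRegularPoint n a m₁ z) :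
    DifferentiableAt ℝ
      (orbitIntegral (center₁ n a) (m₁ * √(1 + a ^ 2)) (perturbingPotential a m₂ f)) z :=
  (hasFDerivAt_orbitIntegral (norm_center₁ n a) hz.1 fun φ =>
    contDiffAt_perturbingPotential (hz.2 φ)).differentiableAt

lemma IsRegularPoint.differentiableAt_orbitIntegral_one (hz : IsRegularPoint n a m₁ z) :
    DifferentiableAt ℝ (orbitIntegral (center₁ n a) (m₁ * √(1 + a ^ 2)) fun _ => 1) z :=
  (hasFDerivAt_orbitIntegral (norm_center₁ n a) hz.1 fun _ => contDiffAt_const).differentiableAt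

lemma IsRegularPoint.orbitIntegral_one_ne_zero (hz : IsRegularPoint n a m₁ z) :
    orbitIntegral (center₁ n a) (m₁ * √(1 + a ^ 2)) (fun _ => 1) z ≠ 0 :=
  (orbitIntegral_one_pos (norm_center₁ n a) hz.1).ne'

lemma IsRegularPoint.differentiableAt_reducedEnergy (hz : IsRegularPoint n a m₁ z) :
    DifferentiableAt ℝ (reducedEnergy n a m₁ m₂ f) z := by
  unfold reducedEnergy
  simp only [div_eq_mul_inv]
  exact (differentiableAt_axialEnergy hz.axialInner_pos).add
    (hz.differentiableAt_orbitIntegral.mul (hz.differentiableAt_orbitIntegral_one.inv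
      hz.orbitIntegral_one_ne_zero))

lemma fderiv_axialIntegral {Y Z N : Ambient n} {h m : ℝ} (hx : axialInner Z z.1 z.1 = 1)
    (hxy : axialInner Z z.1 z.2 = 0) (δ : Ambient n × Ambient n) :
    fderiv ℝ (axialIntegral Y Z N h m) z δ
      = ⟪-flowMomentum Y Z N h m z, δ.1⟫ + ⟪flowPosition Y Z N h z, δ.2⟫ := by
  exact (hasDerivAt_line_of_differentiableAt (differentiableAt_axialIntegral (hx ▸ one_pos)) δ).unique
    (hasDerivAt_axialIntegral_line hx hxy)

/-- The derivative of the averaged energy along the Hamiltonian vector field of `D` vanishes. -/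
lemma fderiv_reducedEnergy_flow {x e : Ambient n} {ℓ : ℝ} (hx : axialInner (center₁ n a) x x = 1)
    (hxe : axialInner (center₁ n a) x e = 0) (he : axialInner (center₁ n a) e e = 1) (hℓ : 0 < ℓ)
    (hz : IsRegularPoint n a m₁ (x, ℓ • e)) :
    fderiv ℝ (reducedEnergy n a m₁ m₂ f) (x, ℓ • e)
      (flowPosition (axisVector n a) (center₁ n a) (northPole n) (a / √(1 + a ^ 2)) (x, ℓ • e),
        flowMomentum (axisVector n a) (center₁ n a) (northPole n) (a / √(1 + a ^ 2)) m₁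
          (x, ℓ • e)) = 0 := by
  have hZ := norm_center₁ n a
  have hs : 0 < √(1 + a ^ 2) := by positivity
  -- The planar mass in D is k times the spherical mass M = m₁√(1 + a²); with this ratio D commutes
  -- with the Kepler energy.
  have hm : m₁ = m₁ * √(1 + a ^ 2) * (√(1 + a ^ 2))⁻¹ := by field_simp
  have hN := northPole_eq (n := n) (a := a)
  have hYZ := inner_center₁_axisVector (n := n) (a := a)
  set z : Ambient n × Ambient n := (x, ℓ • e) with hzdef
  set δ : Ambient n × Ambient n := (flowPosition (axisVector n a) (center₁ n a) (northPole n)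
    (a / √(1 + a ^ 2)) z, flowMomentum (axisVector n a) (center₁ n a) (northPole n)
      (a / √(1 + a ^ 2)) m₁ z) with hδ
  have hE : HasDerivAt (fun ε : ℝ => axialEnergy (center₁ n a) (m₁ * √(1 + a ^ 2)) (z + ε • δ))
      0 0 := hasDerivAt_axialEnergy_flow hZ hYZ hN hx hxe he hm
  have hV : fderiv ℝ (orbitIntegral (center₁ n a) (m₁ * √(1 + a ^ 2))
      (perturbingPotential a m₂ f)) z δ = 0 :=
    fderiv_orbitIntegral_flow (W := integralCorrection n a m₂ f) hZ hYZ hN hx hxe he hm hℓ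
      (fun φ => contDiffAt_perturbingPotential (hz.2 φ))
      (fun φ => differentiableAt_integralCorrection (hz.2 φ))
      (fun φ => fderiv_perturbingPotential_self (hz.2 φ))
      (by
        rintro X y hXX hXy ⟨φ, rfl⟩
        exact fderiv_perturbingPotential_flowPosition (hz.2 φ) hXX hXy)
  -- The time of one turn is also unchanged by the flow of D: this is the case V = 1, W = 0.
  have hone : fderiv ℝ (orbitIntegral (center₁ n a) (m₁ * √(1 + a ^ 2)) fun _ => 1) z δ = 0 :=
    fderiv_orbitIntegral_flow (W := fun _ => 0) hZ hYZ hN hx hxe he hm hℓ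
      (fun φ => contDiffAt_const) (fun φ => differentiableAt_const _) (fun φ => by simp)
      (fun X y _ _ _ => by simp)
  have h0 : z + (0 : ℝ) • δ = z := by simp
  have hV' := hasDerivAt_line_of_differentiableAt
    (hz.differentiableAt_orbitIntegral (m₂ := m₂) (f := f)) δ
  have hone' := hasDerivAt_line_of_differentiableAt hz.differentiableAt_orbitIntegral_one δ
  have hsum := hE.add (hV'.div hone' (by rw [h0]; exact hz.orbitIntegral_one_ne_zero))
  refine ((hasDerivAt_line_of_differentiableAt hz.differentiableAt_reducedEnergy δ).unique
    hsum).trans ?_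
  simp [hV, hone]

lemma IsRegularPoint.canonicalBracket_eq_zero (hz : IsRegularPoint n a m₁ z) :
    canonicalBracket (reducedEnergy n a m₁ m₂ f) (axialIntegral (axisVector n a) (center₁ n a)
      (northPole n) (a / √(1 + a ^ 2)) m₁) z = 0 := by
  have hZ := norm_center₁ n a
  have hq := hz.axialInner_pos
  have hℓ := axialMomentum_pos hz.1
  obtain ⟨c, d, hc, hcd⟩ := exists_rescale_eq hq
  set x := conePosition (center₁ n a) z
  set e := (axialMomentum (center₁ n a) z)⁻¹ • coneVelocity (center₁ n a) z with he
  have hle : axialMomentum (center₁ n a) z • e = coneVelocity (center₁ n a) z := by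
    rw [he, smul_smul, mul_inv_cancel₀ hℓ.ne', one_smul]
  have hx : axialInner (center₁ n a) x x = 1 := axialInner_conePosition_self hZ hq
  have hxy := axialInner_conePosition_coneVelocity hZ hq
  have hxe : axialInner (center₁ n a) x e = 0 := by rw [he, axialInner_smul_right, hxy, mul_zero]
  have hee : axialInner (center₁ n a) e e = 1 := by
    rw [he, axialInner_smul_right, axialInner_smul_left, axialInner_coneVelocity_self hZ hq,
      ← axialMomentum_sq hZ]
    field_simp
  have hreg : IsRegularPoint n a m₁ (rescale c d z) := hz.map_rescale hc
  rw [canonicalBracket_rescale hc hreg.differentiableAt_reducedEnergy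
    (differentiableAt_axialIntegral hreg.axialInner_pos)
    (hz.eventually.mono fun w hw => reducedEnergy_rescale hw hc)
    (Filter.Eventually.of_forall fun w => axialIntegral_rescale hc w)
    (fderiv_axialIntegral (by rw [hcd]; exact hx) (by rw [hcd]; exact hxy)), neg_neg]
  rw [hcd, ← hle] at hreg ⊢
  exact fderiv_reducedEnergy_flow hx hxe hee hℓ hreg

end Reduction

end HemisphericalLagrange

end

open HemisphericalLagrange in
theorem proposition4 (n : ℕ) (a m₁ m₂ f : ℝ) (hm₁ : 0 < m₁)
    (z : Ambient n × Ambient n) (hz : z ∈ averagingRegion n a m₁) :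
    (∃ (γ : ℝ → Ambient n) (T : ℝ), IsClosedKeplerMotion a m₁ z γ T) ∧
      DifferentiableAt ℝ (averagedEnergy a m₁ m₂ f ∘ toTangentSphere) z ∧
      DifferentiableAt ℝ (functionD a m₁ ∘ toTangentSphere) z ∧
      spherePoisson (averagedEnergy a m₁ m₂ f) (functionD a m₁) z = 0 := by
  have hreg := isRegularPoint_of_mem_averagingRegion hm₁ hz
  -- Derivatives and brackets see only germs, so equality near z suffices to replace both functions
  -- by their homogeneous forms.
  have hF : averagedEnergy a m₁ m₂ f ∘ toTangentSphere =ᶠ[nhds z] reducedEnergy n a m₁ m₂ f :=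
    hreg.eventually.mono fun _ hw => averagedEnergy_toTangentSphere hm₁ hw
  have hG : functionD a m₁ ∘ toTangentSphere =ᶠ[nhds z] axialIntegral (axisVector n a)
      (center₁ n a) (northPole n) (a / √(1 + a ^ 2)) m₁ :=
    hreg.eventually.mono fun _ hw => functionD_toTangentSphere hw
  refine ⟨exists_isClosedKeplerMotion (norm_fst_of_mem_averagingRegion hz)
    (inner_of_mem_averagingRegion hm₁ hz) hreg.1,
    hreg.differentiableAt_reducedEnergy.congr_of_eventuallyEq hF,
    (differentiableAt_axialIntegral hreg.axialInner_pos).congr_of_eventuallyEq hG, ?_⟩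
  rw [spherePoisson, canonicalBracket, hF.fderiv_eq, hG.fderiv_eq, ← canonicalBracket]
  exact hreg.canonicalBracket_eq_zero
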